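/- All graphs are finite, simple and undirected. A matching of a graph $G$ is a set of pairwise non-adjacent edges; it is maximal if it is not properly contained in a larger matching. Let $\gamma(G)$ be the minimum size (number of edges) of a maximal matching of $G$. A graph is subcubic if its maximum degree is at most $3$, and cubic if it is $3$-regular. Let $G$ be a connected subcubic graph with $n$ vertices and $m$ edges. Then $$\gamma(G)\le\frac{4n-m}{6}+\frac12,$$ with equality if and only if $G$ is isomorphic to the complete bipartite graph $K_{3,3}$. Moreover, if $G$ is not cubic, then $$\gamma(G)\le\frac{4n-m}{6}.$$ -/

import Mathlib

namespace SimpleGraph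

/-- A maximal matching of `G`: a matching that is not properly contained in a larger matching.
A matching is a subgraph in which every vertex lies on exactly one edge, so that it is determined
by its edges, and containment of matchings is containment of their edge sets. -/
def Subgraph.IsMaximalMatching {V : Type*} {G : SimpleGraph V} (M : G.Subgraph) : Prop :=
  Maximal (fun M' : G.Subgraph => M'.IsMatching) M

/-- The edge domination number `γ(G)`: the minimum number of edges of a maximal matching. -/
noncomputable def edgeDominationNumber {V : Type*} (G : SimpleGraph V) : ℕ :=
  sInf {k : ℕ | ∃ M : G.Subgraph, M.IsMaximalMatching ∧ M.edgeSet.ncard = k}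

/-- In a finite graph the minimum in the definition of `γ(G)` is attained. -/
theorem edgeDominationNumber_isLeast {V : Type*} [Finite V] (G : SimpleGraph V) :
    IsLeast {k : ℕ | ∃ M : G.Subgraph, M.IsMaximalMatching ∧ M.edgeSet.ncard = k}
      G.edgeDominationNumber := by
  have hbot : (⊥ : G.Subgraph).IsMatching := fun v hv => hv.elim
  have hfin : {M : G.Subgraph | M.IsMatching}.Finite := Set.toFinite _
  obtain ⟨M, -, hM⟩ := hfin.exists_le_maximal hbot
  exact ⟨Nat.sInf_mem ⟨_, M, hM, rfl⟩, fun k hk => Nat.sInf_le hk⟩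

/-- A graph is subcubic if its maximum degree is at most `3`. -/
def IsSubcubic {V : Type*} [Fintype V] (G : SimpleGraph V) [DecidableRel G.Adj] : Prop :=
  G.maxDegree ≤ 3

/-- A graph is cubic if it is `3`-regular. -/
def IsCubic {V : Type*} [Fintype V] (G : SimpleGraph V) [DecidableRel G.Adj] : Prop :=
  G.IsRegularOfDegree 3

end SimpleGraph

/-! Give an independent set `I ⊆ W` such that `W \ I` has a perfect matching the value `3|I| + |W| -
e(W)`. That matching is maximal in the graph induced on `W` and has `(|W| - |I|)/2` edges, so for
the whole graph a value of at least `k` means that six times its size is at most `4n - m - k`. Hence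
a value of 0 is wanted for non-cubic graphs, -3 for cubic graphs, and -2 for cubic graphs other than
`K₃,₃`. The predicate `Sol` also asks that the vertices of `Z` be matched ("covered"). This is what
allows a solution on part of the graph to be combined with unmatched vertices next to it. The value
has the parity of `e(W)`, so a bound of the wrong parity improves by one for free (`Sol.parity`).

The induction runs over subcubic 2-degenerate vertex sets (`Ok`); a connected subcubic graph that is
not cubic is of this kind. It carries more than the value 0 (`Claims`). A vertex of degree at most
one gains 1. A prescribed vertex of degree 1 or 2 can be covered at a loss of 2, and at a loss of 1
unless it is a `Twin`, that is, a degree-2 vertex of a `K₂,₃`. For a twin, either the loss of 1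
suffices or the uncovered problem gains 2.

Two operations drive the induction. `loc` deletes a small configuration in which some vertices stay
unmatched and the others are matched in pairs; its conditions on the indices are checked by
computation. `Sol.suppress` replaces a path `t v₁ v o` by an edge `t o`, which covers `v` and `v₁`.
The new edge may destroy 2-degeneracy, and `Bad` describes the set responsible. Two such sets for
the same `v₁` cut off two disjoint lobes, which parity then handles (`lobes`, `two_bad`).

For the value 0, take `u` of degree two with neighbours `a`, `b` in a graph of minimum degree two.
Leaving `u` unmatched gains 2, so `a` and `b` must both be covered at a total loss of 2. Suppressing
a path through `a` covers `a`, and `cover` in the new graph covers `b` at the same time. The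
exceptions are triangles and four-cycles through `u`, twins at `a` or `b` (`twin_side`), low degrees
nearby (`near_low`), and failures of the suppression (`Gen.suppress` and what follows it).

In a cubic graph, deleting an adjacent pair leaves an `Ok` set and loses 3. A triangle or a
suppression saves one unit unless every path of three edges closes to a four-cycle, which forces
`K₃,₃` (`cubic_sol_or_iso`). There every maximal matching is perfect (`three_le_of_iso`), so
equality holds. -/

namespace MatchingBound

/-! ### Data of a local reduction -/

/-- The vertices deleted by a local reduction: first the unmatched, then the matched ones. -/
def sv {n : ℕ} (I : List (Fin n)) (M : List (Fin n × Fin n)) : List (Fin n) :=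
  I ++ M.flatMap (fun e => [e.1, e.2])

/-- The combinatorial conditions on a local reduction. -/
def locCheck {n : ℕ} (E : List (Fin n × Fin n)) (δ : Fin n → ℕ) (I : List (Fin n))
    (M : List (Fin n × Fin n)) (B C : List (Fin n)) (c : ℤ) : Bool :=
  decide (sv I M).Nodup && decide E.Nodup && decide (∀ e ∈ E, e.1 < e.2) &&
  decide (∀ e ∈ M, e ∈ E ∨ e.swap ∈ E) &&
  decide (∀ i ∈ I, δ i ≤ (E.filter (fun e => e.1 = i ∨ e.2 = i)).length) &&
  decide (∀ i ∈ I, ∀ j ∈ I, (i, j) ∉ E) &&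
  decide (∀ i ∈ I, ∀ e ∈ E,
    (e.1 = i → e.2 ∈ sv I M ∨ e.2 ∈ B) ∧ (e.2 = i → e.1 ∈ sv I M ∨ e.1 ∈ B)) &&
  decide (∀ i ∈ B, i ∉ sv I M) && decide (∀ i ∈ C, i ∈ B ∨ (i ∈ sv I M ∧ i ∉ I)) &&
  decide (c + (((sv I M).map δ).sum : ℤ) ≤
    3 * (I.length : ℤ) + (sv I M).length
      + (E.filter (fun e => e.1 ∈ sv I M ∧ e.2 ∈ sv I M)).length)

open Finset
open scoped Classical

variable {V : Type*}

/-! ### Counting neighbours and edges inside a vertex set -/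

/-- The neighbours of `v` inside `W`. -/
noncomputable def nb (G : SimpleGraph V) (W : Finset V) (v : V) : Finset V :=
  W.filter (fun w => G.Adj v w)

/-- The number of edges of `G` inside `W`. -/
noncomputable def ed (G : SimpleGraph V) (W : Finset V) : ℕ :=
  (W.sym2.filter (· ∈ G.edgeSet)).card

@[simp] lemma mem_nb {G : SimpleGraph V} {W : Finset V} {v w : V} :
    w ∈ nb G W v ↔ w ∈ W ∧ G.Adj v w := by simp [nb]

lemma nb_mono (G : SimpleGraph V) {U W : Finset V} (h : U ⊆ W) (v : V) : nb G U v ⊆ nb G W v :=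
  Finset.filter_subset_filter _ h

lemma card_nb_mono (G : SimpleGraph V) {U W : Finset V} (h : U ⊆ W) (v : V) :
    (nb G U v).card ≤ (nb G W v).card :=
  Finset.card_le_card (nb_mono G h v)

lemma ed_empty (G : SimpleGraph V) : ed G ∅ = 0 := by simp [ed]

lemma ed_insert (G : SimpleGraph V) {W : Finset V} {v : V} (hv : v ∉ W) :
    ed G (insert v W) = ed G W + (nb G W v).card := by
  unfold ed
  rw [Finset.sym2_insert, Finset.filter_union, Finset.card_union_of_disjoint, add_comm]
  · congr 1
    refine (Finset.card_bij (fun w _ => s(v, w)) ?_ ?_ ?_).symm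
    · intro w hw
      simp only [mem_nb] at hw
      simp only [Finset.mem_filter, Finset.mem_image, SimpleGraph.mem_edgeSet]
      exact ⟨⟨w, by simp [hw.1], rfl⟩, hw.2⟩
    · intro a _ b _ h
      exact Sym2.congr_right.1 h
    · intro e he
      simp only [Finset.mem_filter, Finset.mem_image] at he
      obtain ⟨⟨w, hw, rfl⟩, he⟩ := he
      have hadj : G.Adj v w := by simpa using he
      refine ⟨w, ?_, rfl⟩
      rcases Finset.mem_insert.1 hw with rfl | hw
      · exact (hadj.ne rfl).elim
      · simp [hw, hadj]
  · rw [Finset.disjoint_left]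
    intro e he he'
    simp only [Finset.mem_filter, Finset.mem_image] at he he'
    obtain ⟨⟨w, hw, rfl⟩, -⟩ := he
    exact hv (by simpa using (Finset.mk_mem_sym2_iff.1 he'.1).1)

lemma card_nb_insert (G : SimpleGraph V) {W : Finset V} {v : V} (hv : v ∉ W) (x : V) :
    (nb G (insert v W) x).card = (nb G W x).card + if G.Adj x v then 1 else 0 := by
  unfold nb
  rw [Finset.filter_insert]
  split_ifs with h
  · rw [Finset.card_insert_of_notMem (by simp [hv])]
  · simp

lemma card_nb_union (G : SimpleGraph V) {A B : Finset V} (h : Disjoint A B) (x : V) :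
    (nb G (A ∪ B) x).card = (nb G A x).card + (nb G B x).card := by
  unfold nb
  rw [Finset.filter_union, Finset.card_union_of_disjoint]
  exact Finset.disjoint_filter_filter h

/-- The degree sum over `S` counts the edges between `R` and `S` once and those inside `S` twice.
The term `ed G S` on the left absorbs the second count and avoids subtraction in `ℕ`. -/
lemma ed_union (G : SimpleGraph V) {R S : Finset V} (h : Disjoint R S) :
    ed G (R ∪ S) + ed G S = ed G R + ∑ v ∈ S, (nb G (R ∪ S) v).card := by
  induction S using Finset.induction_on with
  | empty => simp [ed_empty]
  | insert v S hv ih =>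
    rw [Finset.disjoint_insert_right] at h
    have hvRS : v ∉ R ∪ S := by simp [h.1, hv]
    rw [Finset.union_insert, ed_insert G hvRS, ed_insert G hv, Finset.sum_insert hv,
      card_nb_insert G hvRS v]
    have h1 : ∑ x ∈ S, (nb G (insert v (R ∪ S)) x).card
        = ∑ x ∈ S, (nb G (R ∪ S) x).card + (nb G S v).card := by
      rw [Finset.sum_congr rfl (fun x _ => card_nb_insert G hvRS x), Finset.sum_add_distrib,
        ← Finset.card_filter]
      congr 2
      ext x
      simp [nb, G.adj_comm]
    rw [h1]
    have := ih h.2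
    simp only [SimpleGraph.irrefl, if_false]
    omega

lemma two_ed (G : SimpleGraph V) (S : Finset V) : 2 * ed G S = ∑ v ∈ S, (nb G S v).card := by
  have := ed_union G (R := ∅) (S := S) (by simp)
  simp only [Finset.empty_union, ed_empty] at this
  omega

lemma ed_sdiff (G : SimpleGraph V) {W S : Finset V} (h : S ⊆ W) :
    ed G W + ed G S = ed G (W \ S) + ∑ v ∈ S, (nb G W v).card := by
  have := ed_union G (R := W \ S) (S := S) Finset.sdiff_disjoint
  rwa [Finset.sdiff_union_of_subset h] at this

lemma ed_disjUnion (G : SimpleGraph V) {A B : Finset V} (h : Disjoint A B)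
    (hAB : ∀ a ∈ A, ∀ b ∈ B, ¬ G.Adj a b) : ed G (A ∪ B) = ed G A + ed G B := by
  have h1 := ed_union G h
  have h2 := two_ed G B
  have h3 : ∑ v ∈ B, (nb G (A ∪ B) v).card = ∑ v ∈ B, (nb G B v).card := by
    refine Finset.sum_congr rfl fun v hv => ?_
    rw [card_nb_union G h]
    have : nb G A v = ∅ := by
      ext x
      simp only [mem_nb, Finset.notMem_empty, iff_false, not_and]
      exact fun hx hadj => hAB x hx v hv hadj.symm
    simp [this]
  omega

lemma nb_sup_edge_of_ne (G : SimpleGraph V) {t o : V} (W : Finset V) {v : V} (h1 : v ≠ t)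
    (h2 : v ≠ o) : nb (G ⊔ SimpleGraph.edge t o) W v = nb G W v := by
  ext x
  simp only [mem_nb, SimpleGraph.sup_adj, SimpleGraph.edge_adj]
  grind

lemma nb_sup_edge_left (G : SimpleGraph V) {t o : V} {W : Finset V} (hne : t ≠ o) (ho : o ∈ W) :
    nb (G ⊔ SimpleGraph.edge t o) W t = insert o (nb G W t) := by
  ext x
  simp only [mem_nb, SimpleGraph.sup_adj, SimpleGraph.edge_adj, Finset.mem_insert]
  grind

lemma nb_sup_edge_right (G : SimpleGraph V) {t o : V} {W : Finset V} (hne : t ≠ o) (ht : t ∈ W) :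
    nb (G ⊔ SimpleGraph.edge t o) W o = insert t (nb G W o) := by
  ext x
  simp only [mem_nb, SimpleGraph.sup_adj, SimpleGraph.edge_adj, Finset.mem_insert]
  grind

lemma ed_sup_edge (G : SimpleGraph V) {t o : V} {W : Finset V} (hne : t ≠ o) (ht : t ∈ W)
    (ho : o ∈ W) (hadj : ¬ G.Adj t o) : ed (G ⊔ SimpleGraph.edge t o) W = ed G W + 1 := by
  unfold ed
  rw [← Finset.card_insert_of_notMem (a := s(t, o)) (s := W.sym2.filter (· ∈ G.edgeSet))]
  · congr 1
    ext e
    simp only [Finset.mem_filter, Finset.mem_insert, SimpleGraph.edgeSet_sup, Set.mem_union,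
      SimpleGraph.edgeSet_edge_of_ne hne, Set.mem_singleton_iff]
    constructor
    · rintro ⟨h1, h2 | h2⟩
      · exact Or.inr ⟨h1, h2⟩
      · exact Or.inl h2
    · rintro (rfl | ⟨h1, h2⟩)
      · exact ⟨by simp [ht, ho], Or.inr rfl⟩
      · exact ⟨h1, Or.inl h2⟩
  · simp [hadj]

/-! ### Partial solutions, parity and suppression of a path -/

/-- `W` minus an independent set `I` that avoids `Z` is perfectly matched, with `I` large. -/
def Sol (G : SimpleGraph V) (W Z : Finset V) (k : ℤ) : Prop :=
  ∃ I ⊆ W, Disjoint I Z ∧ (∀ a ∈ I, ∀ b ∈ I, ¬ G.Adj a b) ∧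
    (∃ f : V → V, ∀ v ∈ W \ I, f v ∈ W \ I ∧ f (f v) = v ∧ G.Adj v (f v)) ∧
    k ≤ 3 * (I.card : ℤ) + W.card - ed G W

lemma Sol.mono {G : SimpleGraph V} {W Z Z' : Finset V} {k k' : ℤ} (h : Sol G W Z k)
    (hZ : Z' ⊆ Z) (hk : k' ≤ k) : Sol G W Z' k' := by
  obtain ⟨I, h1, h2, h3, h4, h5⟩ := h
  exact ⟨I, h1, h2.mono_right hZ, h3, h4, hk.trans h5⟩

lemma Sol.empty (G : SimpleGraph V) (Z : Finset V) : Sol G ∅ Z 0 :=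
  ⟨∅, by simp, by simp, by simp, ⟨id, by simp⟩, by simp [ed_empty]⟩

lemma even_card_of_matched {G : SimpleGraph V} {S : Finset V} {f : V → V}
    (h : ∀ v ∈ S, f v ∈ S ∧ f (f v) = v ∧ G.Adj v (f v)) : Even S.card := by
  have : ∑ _v ∈ S, (1 : ZMod 2) = 0 := by
    refine Finset.sum_involution (fun a _ => f a) ?_ ?_ ?_ ?_
    · intro a _; decide
    · intro a ha _ h'; exact (h a ha).2.2.ne h'.symm
    · intro a ha; exact (h a ha).1
    · intro a ha; exact (h a ha).2.1
  simp only [Finset.sum_const, nsmul_eq_mul, mul_one] at this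
  exact (ZMod.natCast_eq_zero_iff_even).1 this

/-- Since `|W| - |I|` is even, `3|I| + |W| - e(W)` has the parity of `e(W)`. A bound `k` of the
other parity cannot be attained with equality. -/
lemma Sol.parity {G : SimpleGraph V} {W Z : Finset V} {k : ℤ} (h : Sol G W Z k)
    (hk : ¬ Even (k + ed G W)) : Sol G W Z (k + 1) := by
  obtain ⟨I, h1, h2, h3, ⟨f, h4⟩, h5⟩ := h
  refine ⟨I, h1, h2, h3, ⟨f, h4⟩, ?_⟩
  obtain ⟨r, hr⟩ := even_card_of_matched h4
  have := Finset.card_sdiff_add_card_eq_card h1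
  rcases h5.lt_or_eq with h | h
  · omega
  · exact (hk ⟨2 * I.card + r, by omega⟩).elim

lemma Sol.union {G : SimpleGraph V} {A B Z : Finset V} {k l : ℤ} (hA : Sol G A Z k)
    (hB : Sol G B Z l) (h : Disjoint A B) (hAB : ∀ a ∈ A, ∀ b ∈ B, ¬ G.Adj a b) :
    Sol G (A ∪ B) Z (k + l) := by
  obtain ⟨I, h1, h2, h3, ⟨f, h4⟩, h5⟩ := hA
  obtain ⟨J, g1, g2, g3, ⟨g, g4⟩, g5⟩ := hB
  have hd := Finset.disjoint_left.1 h
  refine ⟨I ∪ J, Finset.union_subset_union h1 g1, Finset.disjoint_union_left.2 ⟨h2, g2⟩, ?_,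
    ⟨fun v => if v ∈ A then f v else g v, ?_⟩, ?_⟩
  · intro a ha b hb hadj
    rcases Finset.mem_union.1 ha with ha | ha <;> rcases Finset.mem_union.1 hb with hb | hb
    · exact h3 a ha b hb hadj
    · exact hAB a (h1 ha) b (g1 hb) hadj
    · exact hAB b (h1 hb) a (g1 ha) hadj.symm
    · exact g3 a ha b hb hadj
  · intro v hv
    simp only [Finset.mem_sdiff, Finset.mem_union, not_or] at hv h4 g4 ⊢
    have hJ : ∀ x ∈ A, x ∉ J := fun x hx hJ => hd hx (g1 hJ)
    have hI : ∀ x ∈ B, x ∉ I := fun x hx hI => hd (h1 hI) hx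
    rcases hv with ⟨hv | hv, hv'⟩
    · have := h4 v ⟨hv, hv'.1⟩
      simp only [hv, if_true, this.1.1]
      exact ⟨⟨Or.inl trivial, this.1.2, hJ _ this.1.1⟩, this.2⟩
    · have := g4 v ⟨hv, hv'.2⟩
      have hvA : v ∉ A := fun h => hd h hv
      have hgA : g v ∉ A := fun h => hd h this.1.1
      simp only [hvA, if_false, hgA]
      exact ⟨⟨Or.inr this.1.1, hI _ this.1.1, this.1.2⟩, this.2⟩
  · rw [ed_disjUnion G h hAB, Finset.card_union_of_disjoint h,
      Finset.card_union_of_disjoint (h.mono h1 g1)]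
    push_cast
    linarith

/-- Every degree inside `W` is at most three, and `W` is 2-degenerate. -/
structure Ok (G : SimpleGraph V) (W : Finset V) : Prop where
  deg : ∀ v ∈ W, (nb G W v).card ≤ 3
  degen : ∀ U ⊆ W, U.Nonempty → ∃ v ∈ U, (nb G U v).card ≤ 2

lemma Ok.subset {G : SimpleGraph V} {U W : Finset V} (h : Ok G W) (hU : U ⊆ W) : Ok G U :=
  ⟨fun v hv => (card_nb_mono G hU v).trans (h.deg v (hU hv)),
    fun T hT => h.degen T (hT.trans hU)⟩

/-- Replacing the edge `t o` by the path `t v₁ v o`. -/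
lemma Sol.suppress {G : SimpleGraph V} {W Z : Finset V} {v v₁ t o : V} {k : ℤ}
    (h : Sol (G ⊔ SimpleGraph.edge t o) (W \ {v, v₁}) Z k) (hv : v ∈ W) (hv₁ : v₁ ∈ W)
    (ht : t ∈ W) (ho : o ∈ W) (hvv : G.Adj v v₁) (hvo : G.Adj v o) (hvt : G.Adj v₁ t)
    (htv : t ≠ v) (hov : o ≠ v₁) (hto : t ≠ o) (hadj : ¬ G.Adj t o) :
    Sol G W (insert v (insert v₁ Z)) (k + 4 - (nb G W v).card - (nb G W v₁).card) := by
  obtain ⟨I, h1, h2, h3, ⟨f, h4⟩, h5⟩ := h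
  have hvv' := hvv.ne
  have hvo' := hvo.ne
  have hvt' := hvt.ne
  have ht' : t ∈ W \ {v, v₁} := by simp [ht, htv, hvt'.symm]
  have ho' : o ∈ W \ {v, v₁} := by simp [ho, hvo'.symm, hov]
  have hsub : ({v, v₁} : Finset V) ⊆ W := by
    intro x; simp only [Finset.mem_insert, Finset.mem_singleton]; rintro (rfl | rfl) <;> assumption
  have hvI : v ∉ I := fun h => by simpa using h1 h
  have hv₁I : v₁ ∉ I := fun h => by simpa using h1 h
  have e1 := ed_sdiff G hsub
  rw [Finset.sum_pair hvv'] at e1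
  have e2 : ed G {v, v₁} = 1 := by
    rw [ed_insert G (by simpa using hvv')]
    have : nb G {v₁} v = {v₁} := by ext x; simp; rintro rfl; exact hvv
    rw [this, show ({v₁} : Finset V) = insert v₁ ∅ from rfl, ed_insert G (by simp), ed_empty]
    simp [nb]
  have e3 := ed_sup_edge G hto ht' ho' hadj
  have e4 := Finset.card_sdiff_add_card_eq_card hsub
  rw [Finset.card_pair hvv'] at e4
  refine ⟨I, h1.trans Finset.sdiff_subset, ?_, ?_, ?_, ?_⟩
  · simp [hvI, hv₁I, h2]
  · exact fun a ha b hb hab => h3 a ha b hb (Or.inl hab)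
  -- If the matching uses the new edge `t o`, the edges `t v₁` and `v o` replace it; otherwise the
  -- edge `v v₁` is added. In both cases `v` and `v₁` end up matched.
  · by_cases hf : t ∉ I ∧ f t = o
    · obtain ⟨htI, hf⟩ := hf
      have a1 := h4 t (Finset.mem_sdiff.2 ⟨ht', htI⟩)
      rw [hf] at a1
      have hoI := (Finset.mem_sdiff.1 a1.1).2
      refine ⟨fun x => if x = v then o else if x = o then v else if x = v₁ then t else
        if x = t then v₁ else f x, ?_⟩
      intro x hx
      by_cases q1 : x = v
      · subst q1; simp [hvo'.symm, ho, hoI, hvo]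
      by_cases q2 : x = o
      · subst q2; simp [q1, hv, hvI, hvo.symm]
      by_cases q3 : x = v₁
      · subst q3; simp [hvv'.symm, q2, htv, hto, hvt'.symm, ht, htI, hvt]
      by_cases q4 : x = t
      · subst q4
        simp [q1, q2, q3, hvv'.symm, hov.symm, hv₁, hv₁I, hvt.symm]
      simp only [q1, q2, q3, q4, if_false]
      have b := h4 x (by simp at hx ⊢; exact ⟨⟨hx.1, q1, q3⟩, hx.2⟩)
      have c1 : f x ≠ v := by rintro h; simp [h] at b
      have c2 : f x ≠ v₁ := by rintro h; simp [h] at b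
      have c3 : f x ≠ o := by rintro h; rw [h] at b; rw [a1.2.1] at b; exact q4 b.2.1.symm
      have c4 : f x ≠ t := by rintro h; rw [h, hf] at b; exact q2 b.2.1.symm
      simp only [c1, c2, c3, c4, if_false]
      refine ⟨?_, b.2.1, ?_⟩
      · have := b.1; simp at this ⊢; exact ⟨this.1.1, this.2⟩
      · rcases b.2.2 with h | h
        · exact h
        · rw [SimpleGraph.edge_adj] at h; exfalso; grind
    · refine ⟨fun x => if x = v then v₁ else if x = v₁ then v else f x, ?_⟩
      intro x hx
      by_cases q1 : x = v
      · subst q1; simp [hvv'.symm, hv₁, hv₁I, hvv]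
      by_cases q3 : x = v₁
      · subst q3; simp [hvv'.symm, hv, hvI, hvv.symm]
      simp only [q1, q3, if_false]
      have hx' : x ∈ (W \ {v, v₁}) \ I := by simp at hx ⊢; exact ⟨⟨hx.1, q1, q3⟩, hx.2⟩
      have b := h4 x hx'
      have c1 : f x ≠ v := by rintro h; simp [h] at b
      have c2 : f x ≠ v₁ := by rintro h; simp [h] at b
      simp only [c1, c2, if_false]
      refine ⟨?_, b.2.1, ?_⟩
      · have := b.1; simp at this ⊢; exact ⟨this.1.1, this.2⟩
      · rcases b.2.2 with h | h
        · exact h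
        · exfalso
          rw [SimpleGraph.edge_adj] at h
          simp only [Finset.mem_sdiff] at hx' b
          grind
  -- Restoring the path adds two vertices, removes the edge `t o`, and adds `deg v + deg v₁ - 1`
  -- edges.
  · omega

/-! ### Local reductions on an explicit configuration -/

/-- The finite set of the entries of a list. -/
noncomputable def lf : List V → Finset V
  | [] => ∅
  -- With a separate singleton case the value unfolds to the notation `{a, b, c}`, so that `S = lf
  -- _` holds by `rfl` in `loc'`.
  | [a] => {a}
  | a :: b :: l => insert a (lf (b :: l))

lemma mem_lf {l : List V} {x : V} : x ∈ lf l ↔ x ∈ l := by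
  induction l with
  | nil => simp [lf]
  | cons a l ih =>
    cases l with
    | nil => simp [lf]
    | cons b l => rw [lf, Finset.mem_insert, ih]; simp

/-- Requiring `e.1 < e.2` prevents an edge from being listed in both orientations, so distinct pairs
give distinct elements of `Sym2 V`. -/
lemma card_le_ed {n : ℕ} {G : SimpleGraph V} {S : Finset V} {φ : Fin n → V}
    (hφ : Function.Injective φ) {E : List (Fin n × Fin n)} (hE : E.Nodup)
    (hlt : ∀ e ∈ E, e.1 < e.2) (hadj : ∀ e ∈ E, G.Adj (φ e.1) (φ e.2) ∧ φ e.1 ∈ S ∧ φ e.2 ∈ S) :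
    E.length ≤ ed G S := by
  rw [← List.toFinset_card_of_nodup hE]
  refine Finset.card_le_card_of_injOn (fun e => s(φ e.1, φ e.2)) ?_ ?_
  · intro e he
    have := hadj e (by simpa using he)
    simp [this.1, this.2.1, this.2.2]
  · intro e he e' he' h
    have h1 := hlt e (by simpa using he)
    have h2 := hlt e' (by simpa using he')
    simp only [Sym2.eq_iff] at h
    rcases h with ⟨h, h'⟩ | ⟨h, h'⟩
    · exact Prod.ext (hφ h) (hφ h')
    · rw [hφ h, hφ h'] at h1
      exact (lt_asymm h1 h2).elim

lemma exists_partner {n : ℕ} {M : List (Fin n × Fin n)}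
    (h : (M.flatMap (fun e => [e.1, e.2])).Nodup) :
    ∃ μ : Fin n → Fin n, ∀ i ∈ M.flatMap (fun e => [e.1, e.2]), μ (μ i) = i ∧
      ((i, μ i) ∈ M ∨ (μ i, i) ∈ M) := by
  induction M with
  | nil => exact ⟨id, by simp⟩
  | cons e M ih =>
    rw [List.flatMap_cons, List.nodup_append] at h
    obtain ⟨h1, h2, h3⟩ := h
    obtain ⟨μ, hμ⟩ := ih h2
    have h12 : e.1 ≠ e.2 := by simpa using h1
    refine ⟨fun i => if i = e.1 then e.2 else if i = e.2 then e.1 else μ i, ?_⟩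
    intro i hi
    by_cases q1 : i = e.1
    · subst q1; simp [h12.symm]
    by_cases q2 : i = e.2
    · subst q2; simp [q1]
    have hiM : i ∈ M.flatMap (fun e => [e.1, e.2]) := by
      simp only [List.flatMap_cons, List.mem_append] at hi
      rcases hi with hi | hi
      · simp [q1, q2] at hi
      · exact hi
    have := hμ i hiM
    have hm : μ i ∈ M.flatMap (fun e => [e.1, e.2]) := by
      simp only [List.mem_flatMap]
      rcases this.2 with h | h
      · exact ⟨_, h, by simp⟩
      · exact ⟨_, h, by simp⟩
    have c1 : μ i ≠ e.1 := fun h => h3 e.1 (by simp) _ hm h.symm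
    have c2 : μ i ≠ e.2 := fun h => h3 e.2 (by simp) _ hm h.symm
    simp only [q1, q2, c1, c2, if_false]
    exact ⟨this.1, by rcases this.2 with h | h <;> simp [h]⟩

/-- A local reduction: the vertices `φ i` with `i ∈ sv I M` are deleted, those with `i ∈ I` are
left unmatched, and the pairs in `M` are matched. -/
theorem loc {G : SimpleGraph V} {W S Z Z' : Finset V} {k : ℤ}
    (h3 : ∀ v ∈ W, (nb G W v).card ≤ 3) {n : ℕ} (φ : Fin n → V)
    (E : List (Fin n × Fin n)) (δ : Fin n → ℕ) (I : List (Fin n)) (M : List (Fin n × Fin n))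
    (B C : List (Fin n)) (c : ℤ) (hc : locCheck E δ I M B C c)
    (hS : S = lf ((sv I M).map φ)) (hφ : (List.ofFn φ).Nodup) (hW : ∀ i, φ i ∈ W)
    (hE : ∀ e ∈ E, G.Adj (φ e.1) (φ e.2))
    (hδ : ∀ i, δ i < 3 → (nb G W (φ i)).card ≤ δ i)
    (hB : ∀ i ∈ B, φ i ∈ Z') (hZ : ∀ z ∈ Z, ∃ i ∈ C, φ i = z)
    (h : Sol G (W \ S) Z' k) : Sol G W Z (k + c) := by
  rw [List.nodup_ofFn] at hφ
  simp only [locCheck, Bool.and_eq_true, decide_eq_true_eq, and_assoc] at hc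
  obtain ⟨k1, k2, k3, k4, k5, k6, k7, k8, k9, k10⟩ := hc
  have hmS : ∀ i, φ i ∈ S ↔ i ∈ sv I M := by
    intro i
    rw [hS, mem_lf, List.mem_map_of_injective hφ]
  have hSW : S ⊆ W := by
    intro x hx
    rw [hS, mem_lf, List.mem_map] at hx
    obtain ⟨i, -, rfl⟩ := hx
    exact hW i
  have hdeg : ∀ i, (nb G W (φ i)).card ≤ δ i := by
    intro i
    by_cases h : δ i < 3
    · exact hδ i h
    · exact (h3 _ (hW i)).trans (not_lt.1 h)
  -- the neighbours of the unmatched vertices are all listed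
  have hI : ∀ i ∈ I, ∀ x ∈ W, G.Adj (φ i) x → ∃ j, φ j = x ∧ ((i, j) ∈ E ∨ (j, i) ∈ E) := by
    intro i hi x hx hadj
    set F := E.filter (fun e => e.1 = i ∨ e.2 = i) with hF
    let g : Fin n × Fin n → V := fun e => if e.1 = i then φ e.2 else φ e.1
    have hFE : ∀ e ∈ F, e ∈ E ∧ (e.1 = i ∨ e.2 = i) := by
      intro e he
      simpa [hF] using he
    have hsub : F.toFinset.image g ⊆ nb G W (φ i) := by
      intro y hy
      simp only [Finset.mem_image, List.mem_toFinset] at hy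
      obtain ⟨e, he, rfl⟩ := hy
      obtain ⟨he, he'⟩ := hFE e he
      have := hE e he
      simp only [g, mem_nb]
      split_ifs with h
      · rw [h] at this; exact ⟨hW _, this⟩
      · rw [he'.resolve_left h] at this; exact ⟨hW _, this.symm⟩
    have hcard : (F.toFinset.image g).card = F.length := by
      rw [Finset.card_image_of_injOn, List.toFinset_card_of_nodup (k2.filter _)]
      intro e he e' he' hee
      simp only [List.coe_toFinset, Set.mem_ofPred_eq] at he he'
      obtain ⟨p1, p2⟩ := hFE e he
      obtain ⟨q1, q2⟩ := hFE e' he'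
      have r1 := k3 e p1
      have r2 := k3 e' q1
      simp only [g] at hee
      split_ifs at hee with h h' h'
      · exact Prod.ext (h.trans h'.symm) (hφ hee)
      · have := hφ hee
        have h2 := q2.resolve_left h'
        rw [← this, h2] at r2
        rw [h] at r1
        exact (lt_asymm r1 r2).elim
      · have := hφ hee
        have h2 := p2.resolve_left h
        rw [this, h2] at r1
        rw [h'] at r2
        exact (lt_asymm r1 r2).elim
      · exact Prod.ext (hφ hee) ((p2.resolve_left h).trans (q2.resolve_left h').symm)
    -- At least `δ i` edges are listed at `i`, and `φ i` has degree at most `δ i`, so the listed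
    -- neighbours are all of them.
    have heq := Finset.eq_of_subset_of_card_le hsub (by
      rw [hcard]; exact (hdeg i).trans (k5 i hi))
    have hx' : x ∈ F.toFinset.image g := by rw [heq]; simp [hx, hadj]
    simp only [Finset.mem_image, List.mem_toFinset] at hx'
    obtain ⟨e, he, rfl⟩ := hx'
    obtain ⟨he, he'⟩ := hFE e he
    simp only [g]
    split_ifs with h
    · exact ⟨e.2, rfl, Or.inl (by rw [← h]; exact he)⟩
    · exact ⟨e.1, rfl, Or.inr (by rw [← he'.resolve_left h]; exact he)⟩
  obtain ⟨J, h1, h2, h4, ⟨f, h5⟩, h6⟩ := h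
  have hnM : (M.flatMap (fun e => [e.1, e.2])).Nodup := (List.nodup_append.1 k1).2.1
  have hdis := (List.nodup_append.1 k1).2.2
  obtain ⟨μ, hμ⟩ := exists_partner hnM
  have hI' : ∀ x, x ∈ (I.toFinset.image φ : Finset V) ↔ ∃ i ∈ I, φ i = x := by simp
  have hIsv : ∀ i ∈ I, i ∈ sv I M := fun i hi => List.mem_append_left _ hi
  have hJS : ∀ i, φ i ∈ J → i ∉ sv I M := fun i hi hi' =>
    (Finset.mem_sdiff.1 (h1 hi)).2 ((hmS i).2 hi')
  -- A neighbour of an unmatched vertex is either deleted or indexed by `B`, and the vertices of `B`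
  -- are covered by the remaining solution because they lie in `Z'`.
  have hIJ : ∀ i ∈ I, ∀ b ∈ J, ¬ G.Adj (φ i) b := by
    intro i hi b hb hadj
    obtain ⟨j, rfl, hj⟩ := hI i hi b (Finset.mem_sdiff.1 (h1 hb)).1 hadj
    have hjS := hJS j hb
    have : j ∈ B := by
      rcases hj with hj | hj
      · exact ((k7 i hi _ hj).1 rfl).resolve_left hjS
      · exact ((k7 i hi _ hj).2 rfl).resolve_left hjS
    exact Finset.disjoint_left.1 h2 hb (hB j this)
  have hdisj : Disjoint (I.toFinset.image φ) J := by
    rw [Finset.disjoint_left]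
    intro x hx hx'
    obtain ⟨i, hi, rfl⟩ := (hI' x).1 hx
    exact hJS i hx' (hIsv i hi)
  have hcI : (I.toFinset.image φ).card = I.length := by
    rw [Finset.card_image_of_injective _ hφ,
      List.toFinset_card_of_nodup (List.nodup_append.1 k1).1]
  have hcS : S.card = (sv I M).length := by
    have : S = ((sv I M).map φ).toFinset := by ext x; rw [hS, mem_lf, List.mem_toFinset]
    rw [this, List.toFinset_card_of_nodup (k1.map hφ), List.length_map]
  have hsum : ∑ v ∈ S, (nb G W v).card ≤ ((sv I M).map δ).sum := by
    have : S = (sv I M).toFinset.image φ := by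
      ext x; rw [hS, mem_lf]; simp
    rw [this, Finset.sum_image hφ.injOn, ← List.sum_toFinset _ k1]
    exact Finset.sum_le_sum fun i _ => hdeg i
  have hed : (E.filter (fun e => e.1 ∈ sv I M ∧ e.2 ∈ sv I M)).length ≤ ed G S := by
    refine card_le_ed hφ (k2.filter _) ?_ ?_
    · intro e he
      simp only [List.mem_filter] at he
      exact k3 e he.1
    · intro e he
      simp only [List.mem_filter, decide_eq_true_eq] at he
      exact ⟨hE e he.1, (hmS _).2 he.2.1, (hmS _).2 he.2.2⟩
  refine ⟨I.toFinset.image φ ∪ J, ?_, ?_, ?_,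
    ⟨fun v => if hv : ∃ i ∈ sv I M, φ i = v then φ (μ hv.choose) else f v, ?_⟩, ?_⟩
  · refine Finset.union_subset ?_ (h1.trans Finset.sdiff_subset)
    intro x hx
    obtain ⟨i, -, rfl⟩ := (hI' x).1 hx
    exact hW i
  · rw [Finset.disjoint_left]
    intro x hx hx'
    obtain ⟨i, hi, rfl⟩ := hZ x hx'
    rcases Finset.mem_union.1 hx with hx | hx
    · obtain ⟨j, hj, hji⟩ := (hI' _).1 hx
      rcases k9 i hi with hi | hi
      · exact k8 i hi (hφ hji ▸ hIsv j hj)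
      · exact hi.2 (hφ hji ▸ hj)
    · rcases k9 i hi with hi | hi
      · exact Finset.disjoint_left.1 h2 hx (hB i hi)
      · exact hJS i hx hi.1
  · intro a ha b hb hadj
    rw [Finset.mem_union, hI'] at ha hb
    rcases ha with ⟨i, hi, rfl⟩ | ha <;> rcases hb with ⟨j, hj, rfl⟩ | hb
    · obtain ⟨j', h, h'⟩ := hI i hi _ (hW j) hadj
      rw [hφ h] at h'
      rcases h' with h' | h'
      · exact k6 i hi j hj h'
      · exact k6 j hj i hi h'
    · exact hIJ i hi b hb hadj
    · exact hIJ j hj a ha hadj.symm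
    · exact h4 a ha b hb hadj
  · intro v hv
    simp only [Finset.mem_sdiff, Finset.mem_union, not_or] at hv
    by_cases q : ∃ i ∈ sv I M, φ i = v
    · have hval : ∀ i ∈ sv I M, ∀ h : ∃ j ∈ sv I M, φ j = φ i, h.choose = i :=
        fun i _ h => hφ h.choose_spec.2
      obtain ⟨i, hi, rfl⟩ := q
      have hiI : i ∉ I := fun h => hv.2.1 ((hI' _).2 ⟨i, h, rfl⟩)
      have hiM := (List.mem_append.1 hi).resolve_left hiI
      have hm := hμ i hiM
      have hmM : μ i ∈ M.flatMap (fun e => [e.1, e.2]) := by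
        simp only [List.mem_flatMap]
        rcases hm.2 with h | h
        · exact ⟨_, h, by simp⟩
        · exact ⟨_, h, by simp⟩
      have hms : μ i ∈ sv I M := List.mem_append_right _ hmM
      have d1 : ∃ j ∈ sv I M, φ j = φ i := ⟨i, hi, rfl⟩
      have d2 : ∃ j ∈ sv I M, φ j = φ (μ i) := ⟨μ i, hms, rfl⟩
      beta_reduce
      rw [dif_pos d1, hval i hi d1, dif_pos d2, hval _ hms d2, hm.1]
      refine ⟨?_, rfl, ?_⟩
      · simp only [Finset.mem_sdiff, Finset.mem_union, not_or]
        refine ⟨hW _, fun h => ?_, fun h => hJS _ h hms⟩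
        obtain ⟨j, hj, hj'⟩ := (hI' _).1 h
        exact hdis j hj _ hmM (hφ hj')
      · rcases hm.2 with h | h
        · rcases k4 _ h with h | h
          · exact hE _ h
          · exact (hE _ h).symm
        · rcases k4 _ h with h | h
          · exact (hE _ h).symm
          · exact hE _ h
    · have hvS : v ∉ S := by
        intro h; rw [hS, mem_lf, List.mem_map] at h; exact q h
      have := h5 v (by simp [hv.1, hvS, hv.2.2])
      simp only [Finset.mem_sdiff] at this
      have q' : ¬ ∃ i ∈ sv I M, φ i = f v := by
        rintro ⟨i, hi, hi'⟩
        exact this.1.1.2 (hi' ▸ (hmS i).2 hi)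
      beta_reduce
      rw [dif_neg q, dif_neg q']
      refine ⟨?_, this.2⟩
      simp only [Finset.mem_sdiff, Finset.mem_union, not_or]
      refine ⟨this.1.1.1, fun h => ?_, this.1.2⟩
      obtain ⟨i, hi, hi'⟩ := (hI' _).1 h
      exact q' ⟨i, hIsv i hi, hi'⟩
  -- Deleting `S` removes `∑ deg - e(S)` edges. The upper bounds `δ` on the degrees and the listed
  -- edges as a lower bound for `e(S)` both act in the required direction, so unlisted edges do no
  -- harm.
  · have e1 := ed_sdiff G hSW
    have e2 := Finset.card_sdiff_add_card_eq_card hSW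
    rw [Finset.card_union_of_disjoint hdisj, hcI]
    have k10' : c + (((sv I M).map δ).sum : ℤ) ≤ 3 * (I.length : ℤ) + (sv I M).length
      + (E.filter (fun e => e.1 ∈ sv I M ∧ e.2 ∈ sv I M)).length := k10
    zify at hsum hed e1 e2 hcS
    push_cast at *
    linarith

/-- `loc`, with the routine side conditions filled in. -/
theorem loc' {G : SimpleGraph V} {W S Z Z' : Finset V} {k k' : ℤ}
    (h : Sol G (W \ S) Z' k)
    (h3 : ∀ v ∈ W, (nb G W v).card ≤ 3) {n : ℕ} (φ : Fin n → V)
    (E : List (Fin n × Fin n)) (δ : Fin n → ℕ) (I : List (Fin n)) (M : List (Fin n × Fin n))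
    (B C : List (Fin n)) (c : ℤ) (hc : locCheck E δ I M B C c = true := by decide)
    (hk : k' ≤ k + c := by norm_num)
    (hS : S = lf ((sv I M).map φ) := by rfl)
    (hφ : (List.ofFn φ).Nodup := by simp [List.ofFn_succ] <;> grind [→ SimpleGraph.Adj.ne])
    (hW : ∀ i, φ i ∈ W := by simp [Fin.forall_fin_succ, *])
    (hE : ∀ e ∈ E, G.Adj (φ e.1) (φ e.2) := by simp <;> grind [→ SimpleGraph.Adj.symm])
    (hδ : ∀ i, δ i < 3 → (nb G W (φ i)).card ≤ δ i := by simp [Fin.forall_fin_succ] <;> grind)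
    (hB : ∀ i ∈ B, φ i ∈ Z' := by simp)
    (hZ : ∀ z ∈ Z, ∃ i ∈ C, φ i = z := by simp) : Sol G W Z k' :=
  (loc h3 φ E δ I M B C c hc hS hφ hW hE hδ hB hZ h).mono subset_rfl hk

/-! ### Twins and the induction statement -/

/-- Both neighbours of `v` have the same two further neighbours. -/
def Twin (G : SimpleGraph V) (W : Finset V) (v : V) : Prop :=
  ∃ v₁ v₂ p q, v₁ ≠ v₂ ∧ p ≠ q ∧ v ≠ p ∧ v ≠ q ∧ nb G W v = {v₁, v₂} ∧ nb G W v₁ = {v, p, q} ∧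
    nb G W v₂ = {v, p, q}

/-- The statement that is proved by induction on `W`. -/
structure Claims (G : SimpleGraph V) (W : Finset V) : Prop where
  zero : Sol G W ∅ 0
  leaf : ∀ v ∈ W, (nb G W v).card ≤ 1 → Sol G W ∅ 1
  weak : ∀ v ∈ W, 1 ≤ (nb G W v).card → (nb G W v).card ≤ 2 → Sol G W {v} (-2)
  cover : ∀ v ∈ W, 1 ≤ (nb G W v).card → (nb G W v).card ≤ 2 → ¬ Twin G W v → Sol G W {v} (-1)
  either : ∀ v ∈ W, 1 ≤ (nb G W v).card → (nb G W v).card ≤ 2 →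
    Sol G W {v} (-1) ∨ Sol G W ∅ 2

/-- The induction hypothesis. -/
def IH (W : Finset V) : Prop :=
  ∀ (G : SimpleGraph V) (W' : Finset V), W'.card < W.card → Ok G W' → Claims G W'

/-! ### Extracting neighbours from degree conditions -/

section degrees

variable {G : SimpleGraph V} {W S : Finset V} {v a b c x : V}

lemma sdiff_lt (hx : x ∈ W) (hxS : x ∈ S) : (W \ S).card < W.card :=
  Finset.card_lt_card (by
    rw [Finset.ssubset_iff_of_subset Finset.sdiff_subset]
    exact ⟨x, hx, by simp [hxS]⟩)

lemma IH.sdiff (h : IH W) (hG : Ok G W) (hx : x ∈ W) (hxS : x ∈ S) : Claims G (W \ S) :=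
  h G _ (sdiff_lt hx hxS) (hG.subset Finset.sdiff_subset)

lemma one_le_deg (ha : a ∈ W) (hva : G.Adj v a) : 1 ≤ (nb G W v).card :=
  Finset.card_pos.2 ⟨a, by simp [ha, hva]⟩

lemma two_le_deg (ha : a ∈ W) (hva : G.Adj v a) (hb : b ∈ W) (hvb : G.Adj v b) (hab : a ≠ b) :
    2 ≤ (nb G W v).card := by
  rw [← Finset.card_pair hab]
  refine Finset.card_le_card ?_
  intro y; simp only [Finset.mem_insert, Finset.mem_singleton, mem_nb]
  rintro (rfl | rfl) <;> simp [*]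

lemma three_le_deg (ha : a ∈ W) (hva : G.Adj v a) (hb : b ∈ W) (hvb : G.Adj v b) (hc : c ∈ W)
    (hvc : G.Adj v c) (hab : a ≠ b) (hac : a ≠ c) (hbc : b ≠ c) : 3 ≤ (nb G W v).card := by
  rw [← Finset.card_eq_three.2 ⟨a, b, c, hab, hac, hbc, rfl⟩]
  refine Finset.card_le_card ?_
  intro y; simp only [Finset.mem_insert, Finset.mem_singleton, mem_nb]
  rintro (rfl | rfl | rfl) <;> simp [*]

lemma exists_nb (h : 1 ≤ (nb G W v).card) : ∃ a ∈ W, G.Adj v a := by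
  obtain ⟨a, ha⟩ := Finset.card_pos.1 h
  exact ⟨a, mem_nb.1 ha⟩

lemma exists_nb_ne (h : 2 ≤ (nb G W v).card) (a : V) : ∃ b ∈ W, G.Adj v b ∧ b ≠ a := by
  obtain ⟨b, hb, hba⟩ := Finset.exists_mem_ne (s := nb G W v) (by omega) a
  exact ⟨b, (mem_nb.1 hb).1, (mem_nb.1 hb).2, hba⟩

lemma exists_nb_ne_ne (h : 3 ≤ (nb G W v).card) (a b : V) :
    ∃ c ∈ W, G.Adj v c ∧ c ≠ a ∧ c ≠ b := by
  have : ({a, b} : Finset V).card < (nb G W v).card := Finset.card_le_two.trans_lt (by omega)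
  obtain ⟨c, hc, hc'⟩ := Finset.exists_mem_notMem_of_card_lt_card this
  simp only [Finset.mem_insert, Finset.mem_singleton, not_or] at hc'
  exact ⟨c, (mem_nb.1 hc).1, (mem_nb.1 hc).2, hc'⟩

lemma eq_of_deg_le_two (h : (nb G W v).card ≤ 2) (ha : a ∈ W) (hva : G.Adj v a) (hb : b ∈ W)
    (hvb : G.Adj v b) (hab : a ≠ b) (hx : x ∈ W) (hvx : G.Adj v x) : x = a ∨ x = b := by
  by_contra! hne
  have := three_le_deg ha hva hb hvb hx hvx hab hne.1.symm hne.2.symm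
  omega

lemma eq_of_deg_le_three (h : (nb G W v).card ≤ 3) (ha : a ∈ W) (hva : G.Adj v a) (hb : b ∈ W)
    (hvb : G.Adj v b) (hc : c ∈ W) (hvc : G.Adj v c) (hab : a ≠ b) (hac : a ≠ c) (hbc : b ≠ c)
    (hx : x ∈ W) (hvx : G.Adj v x) : x = a ∨ x = b ∨ x = c := by
  by_contra! hne
  have h1 : ({a, b, c, x} : Finset V).card = 4 := by
    rw [Finset.card_insert_of_notMem (by simp [hab, hac, hne.1.symm]),
      Finset.card_eq_three.2 ⟨b, c, x, hbc, hne.2.1.symm, hne.2.2.symm, rfl⟩]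
  have h2 : ({a, b, c, x} : Finset V) ⊆ nb G W v := by
    intro y; simp only [Finset.mem_insert, Finset.mem_singleton, mem_nb]
    rintro (rfl | rfl | rfl | rfl) <;> simp [*]
  have := Finset.card_le_card h2
  omega

lemma card_nb_sdiff_lt (hx : x ∈ W) (hxS : x ∈ S) (hvx : G.Adj v x) :
    (nb G (W \ S) v).card < (nb G W v).card := by
  refine Finset.card_lt_card ?_
  rw [Finset.ssubset_iff_of_subset (nb_mono G Finset.sdiff_subset v)]
  exact ⟨x, by simp [hx, hvx], by simp [hxS]⟩

lemma card_nb_sdiff_add_two_le (ha : a ∈ W) (haS : a ∈ S) (hva : G.Adj v a) (hb : b ∈ W)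
    (hbS : b ∈ S) (hvb : G.Adj v b) (hab : a ≠ b) :
    (nb G (W \ S) v).card + 2 ≤ (nb G W v).card := by
  have h : nb G (W \ S) v ∪ {a, b} ⊆ nb G W v := by
    intro y
    simp only [Finset.mem_union, mem_nb, Finset.mem_sdiff, Finset.mem_insert,
      Finset.mem_singleton]
    rintro (h | rfl | rfl) <;> simp_all
  have h2 := Finset.card_le_card h
  rw [Finset.card_union_of_disjoint, Finset.card_pair hab] at h2
  · exact h2
  · rw [Finset.disjoint_right]
    intro y
    simp only [Finset.mem_insert, Finset.mem_singleton, mem_nb, Finset.mem_sdiff]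
    rintro (rfl | rfl) <;> simp [*]

lemma nb_eq_pair (ha : a ∈ W) (hb : b ∈ W) (hva : G.Adj v a) (hvb : G.Adj v b) (hab : a ≠ b)
    (h : (nb G W v).card ≤ 2) : nb G W v = {a, b} := by
  ext x
  simp only [mem_nb, Finset.mem_insert, Finset.mem_singleton]
  constructor
  · exact fun hx => eq_of_deg_le_two h ha hva hb hvb hab hx.1 hx.2
  · rintro (rfl | rfl) <;> simp [*]

end degrees

variable {G : SimpleGraph V} {W : Finset V}

/-! ### The claims `leaf` and `weak`, and gluing of components -/

/-- An isolated vertex stays unmatched and gains 4. A leaf stays unmatched while its neighbour is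
matched elsewhere, gaining 1. If that neighbour has no other neighbour, the two form an isolated
edge, which is matched and also gains 1. -/
lemma leaf_claim (ih : IH W) (hG : Ok G W) {v : V} (hv : v ∈ W) (hd : (nb G W v).card ≤ 1) :
    Sol G W ∅ 1 := by
  by_cases h0 : (nb G W v).card = 0
  · have h := (ih.sdiff hG hv (S := {v}) (by simp)).zero
    exact loc' h hG.deg ![v] [] ![0] [0] [] [] [] 4
  obtain ⟨w, hw, hvw⟩ := exists_nb (Nat.one_le_iff_ne_zero.2 h0)
  by_cases h2 : 2 ≤ (nb G W w).card
  · obtain ⟨z, hz, hwz, hzv⟩ := exists_nb_ne h2 v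
    have h := (ih.sdiff hG hv (S := {v, w, z}) (by simp)).zero
    have := hvw.ne
    have := hwz.ne
    exact loc' h hG.deg ![v, w, z] [(0, 1), (1, 2)] ![1, 3, 3] [0] [(1, 2)] [] [] 1
  · have h := (ih.sdiff hG hv (S := {v, w}) (by simp)).zero
    have h2' : (nb G W w).card ≤ 1 := by omega
    exact loc' h hG.deg ![v, w] [(0, 1)] ![1, 1] [] [(0, 1)] [] [] 1

/-- Matching `v` to any neighbour deletes two vertices and at most `2 + 3 - 1` edges. -/
lemma weak_claim (ih : IH W) (hG : Ok G W) {v : V} (hv : v ∈ W) (h1 : 1 ≤ (nb G W v).card)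
    (h2 : (nb G W v).card ≤ 2) : Sol G W {v} (-2) := by
  obtain ⟨w, hw, hvw⟩ := exists_nb h1
  have h := (ih.sdiff hG hv (S := {v, w}) (by simp)).zero
  exact loc' h hG.deg ![v, w] [(0, 1)] ![2, 3] [] [(0, 1)] [] [0] (-2)
    (hφ := by simp [List.ofFn_succ, hvw.ne])

lemma Sol.enlarge {Z Z' : Finset V} {k : ℤ} (h : Sol G W Z k) (hZ : ∀ z ∈ Z', z ∈ W → z ∈ Z) :
    Sol G W Z' k := by
  obtain ⟨I, h1, h2, h3⟩ := h
  refine ⟨I, h1, ?_, h3⟩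
  rw [Finset.disjoint_left] at h2 ⊢
  exact fun a ha ha' => h2 ha (hZ a ha' (h1 ha))

lemma Sol.of_closed {X Z : Finset V} {k l : ℤ} (hX : Sol G X Z k) (hR : Sol G (W \ X) Z l)
    (hXW : X ⊆ W) (hcl : ∀ s ∈ X, ∀ z ∈ W, G.Adj s z → z ∈ X) : Sol G W Z (k + l) := by
  have := hX.union hR Finset.disjoint_sdiff fun a ha b hb hab =>
    (Finset.mem_sdiff.1 hb).2 (hcl a ha b (Finset.mem_sdiff.1 hb).1 hab)
  rwa [Finset.union_sdiff_of_subset hXW] at this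

/-- A lobe of value 1 would give value 1 on `W`, as the rest contributes at least 0. Otherwise
parity makes its edge count even and excludes the alternative of value 2 in `either`; the remaining
bound -1 then rises to 0 by parity. Hence `x` and `y` are covered without loss, and they lie in
separate components even after `w` is removed. -/
lemma lobes {X Y : Finset V} {w x y : V} (hc : ∀ T ⊆ W, Claims G T) (hX : X ⊆ W) (hY : Y ⊆ W)
    (hXY : Disjoint X Y) (hXc : ∀ s ∈ X, ∀ z ∈ W, G.Adj s z → z ∈ X)
    (hYc : ∀ s ∈ Y, ∀ z ∈ W, G.Adj s z → z ∈ Y) (hwX : w ∉ X) (hwY : w ∉ Y) (hx : x ∈ X)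
    (hx1 : 1 ≤ (nb G X x).card) (hx2 : (nb G X x).card ≤ 2) (hy : y ∈ Y)
    (hy1 : 1 ≤ (nb G Y y).card) (hy2 : (nb G Y y).card ≤ 2) :
    Sol G W ∅ 1 ∨ Sol G (W \ {w}) {x, y} 0 := by
  have key : ∀ T ⊆ W, (∀ s ∈ T, ∀ z ∈ W, G.Adj s z → z ∈ T) → ∀ t ∈ T, 1 ≤ (nb G T t).card →
      (nb G T t).card ≤ 2 → ¬ Sol G W ∅ 1 → Sol G T {t} 0 := by
    intro T hT hTc t ht ht1 ht2 hn
    have hn' : ¬ Sol G T ∅ 1 := fun h =>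
      hn (h.of_closed (hc _ Finset.sdiff_subset).zero hT hTc)
    have hev : Even (ed G T) := by
      by_contra h
      refine hn' ((hc T hT).zero.parity ?_)
      rw [zero_add]
      exact_mod_cast h
    rcases (hc T hT).either t ht ht1 ht2 with h | h
    · refine (h.parity ?_).mono subset_rfl (by norm_num)
      obtain ⟨r, hr⟩ := hev
      rintro ⟨r', hr'⟩
      omega
    · exact (hn' (h.mono subset_rfl (by norm_num))).elim
  by_cases hn : Sol G W ∅ 1
  · exact Or.inl hn
  right
  have h1 := key X hX hXc x hx hx1 hx2 hn
  have h2 := key Y hY hYc y hy hy1 hy2 hn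
  have hd := Finset.disjoint_left.1 hXY
  have h3 := (hc (((W \ {w}) \ X) \ Y)
    ((Finset.sdiff_subset.trans Finset.sdiff_subset).trans Finset.sdiff_subset)).zero
  have h4 : Sol G ((W \ {w}) \ X) {x, y} (0 + 0) := by
    refine Sol.of_closed (X := Y) (h2.enlarge ?_) (h3.enlarge ?_) ?_ ?_
    · intro z hz hzY
      simp only [Finset.mem_insert, Finset.mem_singleton] at hz ⊢
      rcases hz with rfl | rfl
      · exact (hd hx hzY).elim
      · rfl
    · intro z hz hz'
      simp only [Finset.mem_insert, Finset.mem_singleton, Finset.mem_sdiff] at hz hz'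
      rcases hz with rfl | rfl
      · exact (hz'.1.2 hx).elim
      · exact (hz'.2 hy).elim
    · intro s hs
      simp only [Finset.mem_sdiff, Finset.mem_singleton]
      exact ⟨⟨hY hs, fun h => hwY (h ▸ hs)⟩, fun h => hd h hs⟩
    · intro s hs z hz
      simp only [Finset.mem_sdiff] at hz
      exact hYc s hs z hz.1.1
  have h5 : Sol G (W \ {w}) {x, y} (0 + (0 + 0)) := by
    refine Sol.of_closed (X := X) (h1.enlarge ?_) h4 ?_ ?_
    · intro z hz hzX
      simp only [Finset.mem_insert, Finset.mem_singleton] at hz ⊢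
      rcases hz with rfl | rfl
      · rfl
      · exact (hd hzX hy).elim
    · intro s hs
      simp only [Finset.mem_sdiff, Finset.mem_singleton]
      exact ⟨hX hs, fun h => hwX (h ▸ hs)⟩
    · intro s hs z hz
      simp only [Finset.mem_sdiff] at hz
      exact hXc s hs z hz.1
  simpa using h5

/-! ### The obstruction to suppressing a path -/

/-- The obstruction to 2-degeneracy after the path `t v₁ v o` has been replaced by an edge. -/
structure Bad (G : SimpleGraph V) (W : Finset V) (v v₁ t o : V) (U : Finset V) : Prop where
  sub : U ⊆ W
  notMem : v ∉ U
  notMem₁ : v₁ ∉ U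
  left : t ∈ U
  right : o ∈ U
  closed : ∀ s ∈ U, ∀ x ∈ W, G.Adj s x → x ≠ v → x ≠ v₁ → x ∈ U
  three : ∀ s ∈ U, s ≠ t → s ≠ o → 3 ≤ (nb G U s).card
  two : 2 ≤ (nb G U t).card
  two' : 2 ≤ (nb G U o).card

/-- A vertex of `U` other than `t` and `o` already has three neighbours inside `U`, so the degree
bound leaves none outside. -/
lemma Bad.not_adj {v v₁ t o s : V} {U : Finset V} (h : Bad G W v v₁ t o U)
    (h3 : ∀ v ∈ W, (nb G W v).card ≤ 3) (hs : s ∈ U) (hst : s ≠ t) (hso : s ≠ o) {x : V}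
    (hx : x ∈ W) (hxU : x ∉ U) : ¬ G.Adj s x := by
  intro hadj
  have h1 := h.three s hs hst hso
  have h2 : nb G U s ⊂ nb G W s := by
    rw [Finset.ssubset_iff_of_subset (nb_mono G h.sub s)]
    exact ⟨x, by simp [hx, hadj], by simp [hxU]⟩
  have := Finset.card_lt_card h2
  have := h3 s (h.sub hs)
  omega

/-- Each of `t`, `o` loses a neighbour on the path and gains the other, so degrees stay at most
three. A set `U` of minimum degree three in the new graph must contain both `t` and `o`. Its degrees
are then saturated, so it has no neighbours outside except `v` and `v₁`. -/
lemma ok_sup_edge_or_bad {v v₁ t o : V} (h3 : ∀ v ∈ W, (nb G W v).card ≤ 3)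
    (hD : ∀ U ⊆ W \ {v, v₁}, U.Nonempty → ∃ x ∈ U, (nb G U x).card ≤ 2) (hv : v ∈ W)
    (hv₁ : v₁ ∈ W) (ht : t ∈ W) (ho : o ∈ W) (hvo : G.Adj v o) (hvt : G.Adj v₁ t)
    (htv : t ≠ v) (hov : o ≠ v₁) (hto : t ≠ o) (hadj : ¬ G.Adj t o) :
    Ok (G ⊔ SimpleGraph.edge t o) (W \ {v, v₁}) ∨ ∃ U, Bad G W v v₁ t o U := by
  have ht' : t ∈ W \ {v, v₁} := by simp [ht, htv, hvt.ne.symm]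
  have ho' : o ∈ W \ {v, v₁} := by simp [ho, hov, hvo.ne.symm]
  have hdeg : ∀ x ∈ W \ {v, v₁},
      (nb (G ⊔ SimpleGraph.edge t o) (W \ {v, v₁}) x).card ≤ 3 := by
    intro x hx
    by_cases h1 : x = t
    · subst h1
      rw [nb_sup_edge_left G hto ho']
      have := card_nb_sdiff_lt (S := {v, v₁}) hv₁ (by simp) hvt.symm
      have := h3 _ ht
      exact (Finset.card_insert_le _ _).trans (by omega)
    by_cases h2 : x = o
    · subst h2
      rw [nb_sup_edge_right G hto ht']
      have := card_nb_sdiff_lt (S := {v, v₁}) hv (by simp) hvo.symm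
      have := h3 _ ho
      exact (Finset.card_insert_le _ _).trans (by omega)
    rw [nb_sup_edge_of_ne G _ h1 h2]
    exact (card_nb_mono G Finset.sdiff_subset x).trans (h3 x (Finset.mem_sdiff.1 hx).1)
  by_cases hbad : ∀ U ⊆ W \ {v, v₁}, U.Nonempty →
      ∃ x ∈ U, (nb (G ⊔ SimpleGraph.edge t o) U x).card ≤ 2
  · exact Or.inl ⟨hdeg, hbad⟩
  right
  push Not at hbad
  obtain ⟨U, hU, hne, hU3⟩ := hbad
  have htoU : t ∈ U ∧ o ∈ U := by
    by_contra h
    obtain ⟨x, hx, hx2⟩ := hD U hU hne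
    refine absurd hx2 (not_le.2 ((hU3 x hx).trans_le (Finset.card_le_card ?_)))
    intro y
    simp only [mem_nb, SimpleGraph.sup_adj, SimpleGraph.edge_adj]
    grind
  refine ⟨U, hU.trans Finset.sdiff_subset, fun h => by simpa using hU h,
    fun h => by simpa using hU h, htoU.1, htoU.2, ?_, ?_, ?_, ?_⟩
  · intro s hs x hx hsx hxv hxv₁
    have h1 := nb_mono (G ⊔ SimpleGraph.edge t o) hU s
    have h2 := Finset.eq_of_subset_of_card_le h1 ((hdeg s (hU hs)).trans (hU3 s hs))
    have : x ∈ nb (G ⊔ SimpleGraph.edge t o) (W \ {v, v₁}) s := by simp [hx, hxv, hxv₁, hsx]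
    rw [← h2] at this
    exact (mem_nb.1 this).1
  · intro s hs h1 h2
    have := hU3 s hs
    rw [nb_sup_edge_of_ne G _ h1 h2] at this
    exact this
  · have := hU3 t htoU.1
    rw [nb_sup_edge_left G hto htoU.2] at this
    have := this.trans_le (Finset.card_insert_le _ _)
    omega
  · have := hU3 o htoU.2
    rw [nb_sup_edge_right G hto htoU.1] at this
    have := this.trans_le (Finset.card_insert_le _ _)
    omega

/-- Two obstructions at the two further neighbours of `v₁` give two disjoint lobes. -/
lemma two_bad {v v₁ w x y : V} (h3 : ∀ v ∈ W, (nb G W v).card ≤ 3)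
    (hc : ∀ T ⊆ W \ {v, v₁}, Claims G T) {U U' : Finset V} (hU : Bad G W v v₁ x w U)
    (hU' : Bad G W v v₁ y w U') (hv₁ : v₁ ∈ W) (hx : x ∈ W)
    (hy : y ∈ W) (h1x : G.Adj v₁ x) (h1y : G.Adj v₁ y) (hxy : x ≠ y) (hxw : x ≠ w) (hyw : y ≠ w) :
    Sol G (W \ {v, v₁}) ∅ 1 ∨ Sol G (W \ {v₁, v, w}) {x, y} 0 := by
  have hvv : ∀ s ∈ U, s ≠ v ∧ s ≠ v₁ := fun s hs =>
    ⟨fun h => hU.notMem (h ▸ hs), fun h => hU.notMem₁ (h ▸ hs)⟩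
  have hvv' : ∀ s ∈ U', s ≠ v ∧ s ≠ v₁ := fun s hs =>
    ⟨fun h => hU'.notMem (h ▸ hs), fun h => hU'.notMem₁ (h ▸ hs)⟩
  -- The neighbour `v₁` of `y` lies outside `U`, while `y` is neither of the two exceptional
  -- vertices `x` and `w`. By symmetry `x ∉ U'`, so `U \ U'` and `U' \ U` are the two lobes.
  have hyU : y ∉ U := fun h => hU.not_adj h3 h hxy.symm hyw hv₁ hU.notMem₁ h1y.symm
  have hxU' : x ∉ U' := fun h => hU'.not_adj h3 h hxy hxw hv₁ hU'.notMem₁ h1x.symm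
  have hcX : ∀ s ∈ U \ U', ∀ z ∈ W \ {v, v₁}, G.Adj s z → z ∈ U \ U' := by
    intro s hs z hz hsz
    simp only [Finset.mem_sdiff, Finset.mem_insert, Finset.mem_singleton, not_or] at hs hz ⊢
    exact ⟨hU.closed s hs.1 z hz.1 hsz hz.2.1 hz.2.2, fun h => hs.2
      (hU'.closed z h s (hU.sub hs.1) hsz.symm (hvv s hs.1).1 (hvv s hs.1).2)⟩
  have hcY : ∀ s ∈ U' \ U, ∀ z ∈ W \ {v, v₁}, G.Adj s z → z ∈ U' \ U := by
    intro s hs z hz hsz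
    simp only [Finset.mem_sdiff, Finset.mem_insert, Finset.mem_singleton, not_or] at hs hz ⊢
    exact ⟨hU'.closed s hs.1 z hz.1 hsz hz.2.1 hz.2.2, fun h => hs.2
      (hU.closed z h s (hU'.sub hs.1) hsz.symm (hvv' s hs.1).1 (hvv' s hs.1).2)⟩
  have hsX : U \ U' ⊆ W \ {v, v₁} := by
    intro s hs
    have := (Finset.mem_sdiff.1 hs).1
    simp [hU.sub this, (hvv s this).1, (hvv s this).2]
  have hsY : U' \ U ⊆ W \ {v, v₁} := by
    intro s hs
    have := (Finset.mem_sdiff.1 hs).1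
    simp [hU'.sub this, (hvv' s this).1, (hvv' s this).2]
  have hxX : x ∈ U \ U' := by simp [hU.left, hxU']
  have hyY : y ∈ U' \ U := by simp [hU'.left, hyU]
  have dx : 1 ≤ (nb G (U \ U') x).card := by
    refine (one_le_two.trans hU.two).trans (Finset.card_le_card ?_)
    intro z hz
    rw [mem_nb] at hz ⊢
    exact ⟨hcX x hxX z (by simp [hU.sub hz.1, (hvv z hz.1).1, (hvv z hz.1).2]) hz.2, hz.2⟩
  have dy : 1 ≤ (nb G (U' \ U) y).card := by
    refine (one_le_two.trans hU'.two).trans (Finset.card_le_card ?_)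
    intro z hz
    rw [mem_nb] at hz ⊢
    exact ⟨hcY y hyY z (by simp [hU'.sub hz.1, (hvv' z hz.1).1, (hvv' z hz.1).2]) hz.2, hz.2⟩
  have dx2 : (nb G (U \ U') x).card ≤ 2 := by
    have h1 := card_nb_mono G hsX x
    have h2 := card_nb_sdiff_lt (W := W) (S := {v, v₁}) hv₁ (by simp) h1x.symm
    have := h3 x hx
    omega
  have dy2 : (nb G (U' \ U) y).card ≤ 2 := by
    have h1 := card_nb_mono G hsY y
    have h2 := card_nb_sdiff_lt (W := W) (S := {v, v₁}) hv₁ (by simp) h1y.symm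
    have := h3 y hy
    omega
  have := lobes hc hsX hsY (Finset.disjoint_left.2 fun a ha hb =>
    (Finset.mem_sdiff.1 ha).2 (Finset.mem_sdiff.1 hb).1) hcX hcY (w := w)
    (by simp [hU'.right]) (by simp [hU.right]) hxX dx dx2 hyY dy dy2
  refine this.imp_right fun h => ?_
  have hset : W \ {v₁, v, w} = (W \ {v, v₁}) \ {w} := by
    ext z; simp; tauto
  rwa [hset]

/-! ### The claim `cover` -/

/-- Suppressing a path `t v₁ v v₂` covers `v` at a loss of `2 + 3 - 4 = 1`. This is tried with `t =
y` and `t = x`. If both attempts are obstructed, either the rest gains 1, or `v₁` can stay unmatched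
with `v` matched to `v₂` and both `x` and `y` covered. -/
lemma cover_aux (ih : IH W) (hG : Ok G W) {v v₁ v₂ x y : V} (hv : v ∈ W) (hv₁ : v₁ ∈ W)
    (hv₂ : v₂ ∈ W) (hx : x ∈ W) (hy : y ∈ W) (h01 : G.Adj v v₁) (h02 : G.Adj v v₂)
    (h1x : G.Adj v₁ x) (h1y : G.Adj v₁ y) (hn12 : v₁ ≠ v₂) (h12 : ¬ G.Adj v₁ v₂) (hxv : x ≠ v)
    (hyv : y ≠ v) (hxy : x ≠ y) (h2y : ¬ G.Adj v₂ y) (hd : (nb G W v).card ≤ 2) :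
    Sol G W {v} (-1) := by
  have hxv₂ : x ≠ v₂ := fun h => h12 (h ▸ h1x)
  have hyv₂ : y ≠ v₂ := fun h => h12 (h ▸ h1y)
  have hd2 := hG.deg v₁ hv₁
  have hcl : ∀ T ⊆ W \ {v, v₁}, Claims G T := fun T hT =>
    ih G T ((Finset.card_le_card hT).trans_lt (sdiff_lt hv (by simp)))
      (hG.subset (hT.trans Finset.sdiff_subset))
  have main : ∀ t ∈ W, G.Adj v₁ t → t ≠ v → ¬ G.Adj v₂ t →
      Sol G W {v} (-1) ∨ ∃ U, Bad G W v v₁ t v₂ U := by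
    intro t ht h1t htv h2t
    have hto : t ≠ v₂ := fun h => h12 (h ▸ h1t)
    have hto' : ¬ G.Adj t v₂ := fun h => h2t h.symm
    refine (ok_sup_edge_or_bad hG.deg (fun U hU => hG.degen U (hU.trans Finset.sdiff_subset)) hv
      hv₁ ht hv₂ h02 h1t htv hn12.symm hto hto').imp_left fun h => ?_
    have := (ih _ _ (sdiff_lt hv (by simp)) h).zero.suppress hv hv₁ ht hv₂ h01 h02 h1t htv
      hn12.symm hto hto'
    exact this.mono (by simp) (by omega)
  rcases main y hy h1y hyv h2y with h | ⟨U, hU⟩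
  · exact h
  by_cases h2x : G.Adj v₂ x
  -- A common neighbour `x` of `v₁` and `v₂` would be pulled into `U` by `v₂`, although its
  -- neighbour `v₁` lies outside.
  · have hxU : x ∈ U := hU.closed v₂ hU.right x hx h2x hxv h1x.ne.symm
    exact (hU.not_adj hG.deg hxU hxy hxv₂ hv₁ hU.notMem₁ h1x.symm).elim
  rcases main x hx h1x hxv h2x with h | ⟨U', hU'⟩
  · exact h
  rcases two_bad hG.deg hcl hU' hU hv₁ hx hy h1x h1y hxy hxv₂ hyv₂ with h | h
  · exact loc' h hG.deg ![v, v₁] [(0, 1)] ![2, 3] [] [(0, 1)] [] [0] (-2)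
  · have := h01.ne
    have := h02.ne
    have := h1x.ne
    have := h1y.ne
    exact loc' h hG.deg ![v₁, v, v₂, x, y] [(0, 1), (1, 2), (0, 3), (0, 4)] ![3, 2, 3, 3, 3]
      [0] [(1, 2)] [3, 4] [1] 0

/-- Low degree of `v` or of a neighbour makes matching `v` directly cheap enough. If the two
neighbours are adjacent, matching one of them to `v` leaves the other as a leaf. Otherwise some
further neighbour of `v₁` is not adjacent to `v₂`, for else `v` is a twin, and `cover_aux` applies.
-/
lemma cover_claim (ih : IH W) (hG : Ok G W) {v : V} (hv : v ∈ W) (h1 : 1 ≤ (nb G W v).card)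
    (hd : (nb G W v).card ≤ 2) (hT : ¬ Twin G W v) : Sol G W {v} (-1) := by
  have low : ∀ w ∈ W, G.Adj v w → (nb G W w).card ≤ 2 → Sol G W {v} (-1) := by
    intro w hw hvw hdw
    have h := (ih.sdiff hG hv (S := {v, w}) (by simp)).zero
    exact loc' h hG.deg ![v, w] [(0, 1)] ![2, 2] [] [(0, 1)] [] [0] (-1)
  obtain ⟨v₁, hv₁, h01⟩ := exists_nb h1
  by_cases hd1 : (nb G W v).card ≤ 1
  · have h := (ih.sdiff hG hv (S := {v, v₁}) (by simp)).zero
    exact loc' h hG.deg ![v, v₁] [(0, 1)] ![1, 3] [] [(0, 1)] [] [0] (-1)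
  obtain ⟨v₂, hv₂, h02, hn21⟩ := exists_nb_ne (by omega : 2 ≤ (nb G W v).card) v₁
  by_cases hd₁ : (nb G W v₁).card ≤ 2
  · exact low v₁ hv₁ h01 hd₁
  by_cases hd₂ : (nb G W v₂).card ≤ 2
  · exact low v₂ hv₂ h02 hd₂
  by_cases h12 : G.Adj v₁ v₂
  · have h := (ih.sdiff hG hv (S := {v, v₁}) (by simp)).leaf v₂
      (by simp [hv₂, h02.ne.symm, hn21]) (by
        have := card_nb_sdiff_add_two_le (S := {v, v₁}) hv (by simp) h02.symm hv₁ (by simp)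
          h12.symm h01.ne
        have := hG.deg v₂ hv₂
        omega)
    exact loc' h hG.deg ![v, v₁] [(0, 1)] ![2, 3] [] [(0, 1)] [] [0] (-2)
  obtain ⟨x, hx, h1x, hxv⟩ := exists_nb_ne (by omega : 2 ≤ (nb G W v₁).card) v
  obtain ⟨y, hy, h1y, hyv, hyx⟩ := exists_nb_ne_ne (by omega : 3 ≤ (nb G W v₁).card) v x
  by_cases h2y : G.Adj v₂ y
  · by_cases h2x : G.Adj v₂ x
    · refine (hT ⟨v₁, v₂, x, y, hn21.symm, hyx.symm, hxv.symm, hyv.symm,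
        nb_eq_pair hv₁ hv₂ h01 h02 hn21.symm hd, ?_, ?_⟩).elim
      · ext z
        simp only [mem_nb, Finset.mem_insert, Finset.mem_singleton]
        constructor
        · exact fun hz => eq_of_deg_le_three (hG.deg v₁ hv₁) hv h01.symm hx h1x hy h1y hxv.symm
            hyv.symm hyx.symm hz.1 hz.2
        · rintro (rfl | rfl | rfl) <;> simp [*, h01.symm]
      · ext z
        simp only [mem_nb, Finset.mem_insert, Finset.mem_singleton]
        constructor
        · exact fun hz => eq_of_deg_le_three (hG.deg v₂ hv₂) hv h02.symm hx h2x hy h2y hxv.symm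
            hyv.symm hyx.symm hz.1 hz.2
        · rintro (rfl | rfl | rfl) <;> simp [*, h02.symm]
    · exact cover_aux ih hG hv hv₁ hv₂ hy hx h01 h02 h1y h1x hn21.symm h12 hyv hxv hyx h2x hd
  · exact cover_aux ih hG hv hv₁ hv₂ hx hy h01 h02 h1x h1y hn21.symm h12 hxv hyv hyx.symm h2y hd

/-! ### Twins and the claim `either` -/

/-- The local structure around a twin vertex. -/
structure TwinAt (G : SimpleGraph V) (W : Finset V) (v v₁ v₂ p q : V) : Prop where
  mem₁ : v₁ ∈ W
  mem₂ : v₂ ∈ W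
  memp : p ∈ W
  memq : q ∈ W
  ne₁₂ : v₁ ≠ v₂
  nepq : p ≠ q
  nep : v ≠ p
  neq : v ≠ q
  adj₁ : G.Adj v v₁
  adj₂ : G.Adj v v₂
  adj₁p : G.Adj v₁ p
  adj₁q : G.Adj v₁ q
  adj₂p : G.Adj v₂ p
  adj₂q : G.Adj v₂ q
  deg : (nb G W v).card = 2
  full : ∀ x ∈ W, G.Adj v x → x = v₁ ∨ x = v₂
  full₁ : ∀ x ∈ W, G.Adj v₁ x → x = v ∨ x = p ∨ x = q
  full₂ : ∀ x ∈ W, G.Adj v₂ x → x = v ∨ x = p ∨ x = q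

lemma Twin.exists {v : V} (h : Twin G W v) : ∃ v₁ v₂ p q, TwinAt G W v v₁ v₂ p q := by
  obtain ⟨v₁, v₂, p, q, h1, h2, h3, h4, h5, h6, h7⟩ := h
  have e5 : ∀ x, x ∈ nb G W v ↔ x = v₁ ∨ x = v₂ := by simp [h5]
  have e6 : ∀ x, x ∈ nb G W v₁ ↔ x = v ∨ x = p ∨ x = q := by simp [h6]
  have e7 : ∀ x, x ∈ nb G W v₂ ↔ x = v ∨ x = p ∨ x = q := by simp [h7]
  simp only [mem_nb] at e5 e6 e7
  refine ⟨v₁, v₂, p, q, ?_⟩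
  constructor <;> first | assumption | grind [Finset.card_pair]

lemma TwinAt.swap {v v₁ v₂ p q : V} (h : TwinAt G W v v₁ v₂ p q) : TwinAt G W v v₁ v₂ q p := by
  cases h
  constructor <;> first | assumption | grind

lemma either_twin_low (ih : IH W) (hG : Ok G W) {v v₁ v₂ p q : V} (hv : v ∈ W)
    (h : TwinAt G W v v₁ v₂ p q) (hq : (nb G W q).card ≤ 2) : Sol G W {v} (-1) := by
  obtain ⟨_, _, _, _, _, _, _, _, _, _, _, _, _, _, _, _, _, _⟩ := h
  have h := (ih.sdiff hG hv (S := {q, v, v₁, v₂, p}) (by simp)).zero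
  exact loc' h hG.deg ![v, v₁, v₂, p, q] [(0, 1), (0, 2), (1, 3), (1, 4), (2, 3), (2, 4)]
    ![2, 3, 3, 3, 2] [4] [(0, 1), (2, 3)] [] [0] 1

/-- The alternative propagates through the twin to the third neighbour `q'` of `q`. If `q'` can be
covered at a loss of 1, then `q` stays unmatched and `v` is covered; if instead the rest gains 2,
then `v` stays unmatched. Neither deletion changes the value, as both have `c = 0`. -/
lemma either_claim (ih : IH W) (hG : Ok G W) {v : V} (hv : v ∈ W) (h1 : 1 ≤ (nb G W v).card)
    (hd : (nb G W v).card ≤ 2) : Sol G W {v} (-1) ∨ Sol G W ∅ 2 := by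
  by_cases hT : ¬ Twin G W v
  · exact Or.inl (cover_claim ih hG hv h1 hd hT)
  obtain ⟨v₁, v₂, p, q, hT⟩ := (not_not.1 hT).exists
  by_cases hp2 : (nb G W p).card ≤ 2
  · exact Or.inl (either_twin_low ih hG hv hT.swap hp2)
  by_cases hq2 : (nb G W q).card ≤ 2
  · exact Or.inl (either_twin_low ih hG hv hT hq2)
  obtain ⟨_, _, hp, hq, _, _, _, _, _, _, _, _, _, _, _, full, full₁, full₂⟩ := hT
  by_cases hpq : G.Adj p q
  · left
    have h := (ih.sdiff hG hv (S := {v₂, v, v₁, p, q}) (by simp)).zero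
    exact loc' h hG.deg ![v, v₁, v₂, p, q]
      [(0, 1), (0, 2), (1, 3), (1, 4), (2, 3), (2, 4), (3, 4)]
      ![2, 3, 3, 3, 3] [2] [(0, 1), (3, 4)] [] [0] 1
  obtain ⟨q', hq', hqq', hq'1, hq'2⟩ := exists_nb_ne_ne (by omega : 3 ≤ (nb G W q).card) v₁ v₂
  have hq'v : q' ≠ v := by grind [→ SimpleGraph.Adj.symm]
  have hq'p : q' ≠ p := by rintro rfl; exact hpq hqq'.symm
  have hq'q := hqq'.ne
  by_cases hiso : 1 ≤ (nb G (W \ {q, v, v₁, v₂, p}) q').card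
  · have hle : (nb G (W \ {q, v, v₁, v₂, p}) q').card ≤ 2 := by
      have := card_nb_sdiff_lt (W := W) (S := {q, v, v₁, v₂, p}) hq (by simp) hqq'.symm
      have := hG.deg q' hq'
      omega
    have hc := ih.sdiff hG hv (S := {q, v, v₁, v₂, p}) (by simp)
    rcases hc.either q' (by simp [*, hq'q.symm]) hiso hle with h | h
    · left
      exact loc' h hG.deg ![v, v₁, v₂, p, q, q']
        [(0, 1), (0, 2), (1, 3), (1, 4), (2, 3), (2, 4), (4, 5)]
        ![2, 3, 3, 3, 3, 3] [4] [(0, 1), (2, 3)] [5] [0] 0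
    · right
      have hset : W \ {q, v, v₁, v₂, p} = W \ {v, v₁, p, v₂, q} := by
        ext z; simp; tauto
      rw [hset] at h
      exact loc' h hG.deg ![v, v₁, v₂, p, q] [(0, 1), (0, 2), (1, 3), (1, 4), (2, 3), (2, 4)]
        ![2, 3, 3, 3, 3] [0] [(1, 3), (2, 4)] [] [] 0
  have hnq' : ∀ x ∈ W, G.Adj q' x → x = p ∨ x = q := by
    intro x hx hadj
    by_contra! hne
    refine hiso (one_le_deg (a := x) ?_ hadj)
    have h1 : x ≠ v := by rintro rfl; rcases full q' hq' hadj.symm with h | h <;> grind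
    have h2 : x ≠ v₁ := by rintro rfl; rcases full₁ q' hq' hadj.symm with h | h | h <;> grind
    have h3 : x ≠ v₂ := by rintro rfl; rcases full₂ q' hq' hadj.symm with h | h | h <;> grind
    simp [*]
  by_cases hpq' : G.Adj p q'
  · right
    have hd' : (nb G W q').card ≤ 2 := by
      refine (Finset.card_le_card (t := {p, q}) fun x hx => ?_).trans Finset.card_le_two
      rw [mem_nb] at hx
      simpa using hnq' x hx.1 hx.2
    have h := (ih.sdiff hG hv (S := {v, q', v₁, p, v₂, q}) (by simp)).zero
    exact loc' h hG.deg ![v, v₁, v₂, p, q, q']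
      [(0, 1), (0, 2), (1, 3), (1, 4), (2, 3), (2, 4), (3, 5), (4, 5)]
      ![2, 3, 3, 3, 3, 2] [0, 5] [(1, 3), (2, 4)] [] [] 4
  · have hd' : (nb G W q').card ≤ 1 := by
      refine (Finset.card_le_card (t := {q}) fun x hx => ?_).trans (by simp)
      rw [mem_nb] at hx
      rcases hnq' x hx.1 hx.2 with rfl | rfl
      · exact (hpq' hx.2.symm).elim
      · simp
    -- Here `q'` is a leaf hanging on `q`. For an even number of edges, parity raises the leaf bound
    -- 1 to 2; for an odd number it raises the weak bound -2 to -1.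
    by_cases hev : Even (ed G W)
    · right
      refine (leaf_claim ih hG hq' hd').parity ?_
      obtain ⟨r, hr⟩ := hev
      rintro ⟨r', hr'⟩
      omega
    · left
      refine ((weak_claim ih hG hv h1 hd).parity ?_).mono subset_rfl (by norm_num)
      rintro ⟨r', hr'⟩
      exact hev ⟨(r' + 1).toNat, by omega⟩

/-! ### A vertex of degree two on a four-cycle -/

/-- A vertex `u` of degree two with neighbours `a` and `b`, in a graph of minimum degree two. -/
structure Deg2 (G : SimpleGraph V) (W : Finset V) (u a b : V) : Prop where
  memu : u ∈ W
  mema : a ∈ W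
  memb : b ∈ W
  adja : G.Adj u a
  adjb : G.Adj u b
  nab : ¬ G.Adj a b
  ne : a ≠ b
  degu : (nb G W u).card ≤ 2
  full : ∀ x ∈ W, G.Adj u x → x = a ∨ x = b
  min : ∀ x ∈ W, 2 ≤ (nb G W x).card

lemma Deg2.symm {u a b : V} (h : Deg2 G W u a b) : Deg2 G W u b a := by
  cases h
  constructor <;> first | assumption | grind [→ SimpleGraph.Adj.symm]

lemma TwinAt.symm {v v₁ v₂ p q : V} (h : TwinAt G W v v₁ v₂ p q) : TwinAt G W v v₂ v₁ p q := by
  cases h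
  constructor <;> first | assumption | grind

lemma TwinAt.twin {v v₁ v₂ p q : V} (h : TwinAt G W v v₁ v₂ p q) (hv : v ∈ W) : Twin G W v := by
  obtain ⟨_, _, _, _, _, _, _, _, _, _, _, _, _, _, _, h1, h2, h3⟩ := h
  refine ⟨v₁, v₂, p, q, ‹_›, ‹_›, ‹_›, ‹_›, ?_, ?_, ?_⟩ <;>
  · ext x
    simp only [mem_nb, Finset.mem_insert, Finset.mem_singleton]
    grind [→ SimpleGraph.Adj.symm]

lemma nb_eq_of_card_le {R : Finset V} (h : R ⊆ W) {v : V}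
    (hc : (nb G W v).card ≤ (nb G R v).card) : nb G W v = nb G R v :=
  (Finset.eq_of_subset_of_card_le (nb_mono G h v) hc).symm

/-- The relevant vertices already reach their maximal degrees 2, 3 and 3 inside `R`, so passing to
`W` adds no neighbours. This transfers the absence of twins to smaller sets. -/
lemma Twin.of_subset {R : Finset V} (h3 : ∀ v ∈ W, (nb G W v).card ≤ 3) (hR : R ⊆ W) {v : V}
    (hd : (nb G W v).card ≤ 2) (h : Twin G R v) : Twin G W v := by
  obtain ⟨v₁, v₂, p, q, h1, h2, h3', h4, h5, h6, h7⟩ := h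
  have m1 : v₁ ∈ R := (mem_nb.1 (by rw [h5]; simp : v₁ ∈ nb G R v)).1
  have m2 : v₂ ∈ R := (mem_nb.1 (by rw [h5]; simp : v₂ ∈ nb G R v)).1
  have hc : ({v, p, q} : Finset V).card = 3 := Finset.card_eq_three.2 ⟨v, p, q, h3', h4, h2, rfl⟩
  refine ⟨v₁, v₂, p, q, h1, h2, h3', h4, ?_, ?_, ?_⟩
  · rw [nb_eq_of_card_le hR, h5]; rwa [h5, Finset.card_pair h1]
  · rw [nb_eq_of_card_le hR, h6]; rw [h6, hc]; exact h3 _ (hR m1)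
  · rw [nb_eq_of_card_le hR, h7]; rw [h7, hc]; exact h3 _ (hR m2)

/-- The basic move: leaving `u` unmatched gains `3 + 1 - 2 = 2`, provided both neighbours are
covered in `W \ {u}`. -/
lemma Deg2.unmatched {u a b : V} {Z : Finset V} {k k' : ℤ} (hu : Deg2 G W u a b) (hG : Ok G W)
    (h : Sol G (W \ {u}) Z k) (ha : a ∈ Z) (hb : b ∈ Z) (hk : k' ≤ k + 2) : Sol G W ∅ k' := by
  obtain ⟨_, _, _, _, _, _, _, _, _, _⟩ := hu
  exact loc' h hG.deg ![u, a, b] [(0, 1), (0, 2)] ![2, 3, 3] [0] [] [1, 2] [] 2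
    (hB := by simp [ha, hb]) (hk := hk)

/-- Matching `v` to a neighbour deletes at most one of the two leaves. The surviving one gains 1
against the loss of 2. -/
lemma cover_of_leaves (ih : IH W) (hG : Ok G W) {v l m : V} (hv : v ∈ W) (hl : l ∈ W) (hm : m ∈ W)
    (hlm : l ≠ m) (hvl : v ≠ l) (hvm : v ≠ m) (h1 : 1 ≤ (nb G W v).card)
    (h2 : (nb G W v).card ≤ 2) (hdl : (nb G W l).card ≤ 1) (hdm : (nb G W m).card ≤ 1) :
    Sol G W {v} (-1) := by
  obtain ⟨w, hw, hvw⟩ := exists_nb h1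
  have h : Sol G (W \ {v, w}) ∅ 1 := by
    by_cases hwl : w = l
    · exact (ih.sdiff hG hv (S := {v, w}) (by simp)).leaf m (by simp; grind)
        ((card_nb_mono G Finset.sdiff_subset _).trans hdm)
    · exact (ih.sdiff hG hv (S := {v, w}) (by simp)).leaf l (by simp; grind)
        ((card_nb_mono G Finset.sdiff_subset _).trans hdl)
  exact loc' h hG.deg ![v, w] [(0, 1)] ![2, 3] [] [(0, 1)] [] [0] (-2)

lemma four_cycle_low (ih : IH W) (hG : Ok G W) {u a b c : V} (hu : Deg2 G W u a b) (hc : c ∈ W)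
    (hac : G.Adj a c) (hbc : G.Adj b c) (hcu : c ≠ u) (hda : (nb G W a).card ≤ 2) :
    Sol G W ∅ 0 := by
  obtain ⟨_, _, _, _, _, _, _, _, full, _⟩ := hu
  by_cases hdc : (nb G W c).card ≤ 2
  · by_cases hdb : (nb G W b).card ≤ 2
    · have h := (ih.sdiff hG hc (S := {u, a, b, c}) (by simp)).zero
      exact loc' h hG.deg ![u, a, b, c] [(0, 1), (0, 2), (1, 3), (2, 3)]
        ![2, 2, 2, 2] [] [(0, 1), (2, 3)] [] [] 0
    · obtain ⟨b₂, _, hbb, _, _⟩ := exists_nb_ne_ne (by omega : 3 ≤ (nb G W b).card) u c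
      have : b₂ ≠ a := by rintro rfl; exact absurd hbb.symm ‹_›
      have h := (ih.sdiff hG hc (S := {u, a, c, b, b₂}) (by simp)).zero
      exact loc' h hG.deg ![u, a, b, c, b₂] [(0, 1), (0, 2), (1, 3), (2, 3), (2, 4)]
        ![2, 2, 3, 2, 3] [0] [(1, 3), (2, 4)] [] [] 1
  · obtain ⟨c', _, hcc, _, _⟩ := exists_nb_ne_ne (by omega : 3 ≤ (nb G W c).card) a b
    have : c' ≠ u := by
      rintro rfl
      have := full c hc hcc.symm
      grind [→ SimpleGraph.Adj.ne]
    have h := (ih.sdiff hG hc (S := {a, u, b, c, c'}) (by simp)).zero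
    exact loc' h hG.deg ![u, a, b, c, c'] [(0, 1), (0, 2), (1, 3), (2, 3), (3, 4)]
      ![2, 2, 3, 3, 3] [1] [(0, 2), (3, 4)] [] [] 0

/-- In the generic case `u` stays unmatched and the path `b c a a₂` is suppressed in `W \ {u}`,
which covers `a`, while `cover` in the new graph takes care of `b`. If `b` is a twin there, then
`a₂` and `b₂` share two neighbours `p`, `q`, and this structure is deleted directly. -/
lemma four_cycle (ih : IH W) (hG : Ok G W) {u a b c : V} (hu : Deg2 G W u a b) (hc : c ∈ W)
    (hac : G.Adj a c) (hbc : G.Adj b c) (hcu : c ≠ u) : Sol G W ∅ 0 := by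
  by_cases hda : (nb G W a).card ≤ 2
  · exact four_cycle_low ih hG hu hc hac hbc hcu hda
  by_cases hdb : (nb G W b).card ≤ 2
  · exact four_cycle_low ih hG hu.symm hc hbc hac hcu hdb
  have hu' := hu
  obtain ⟨humem, ha, hb, hua, hub, hnab, hab, hdu, full, hmin⟩ := hu
  obtain ⟨a₂, ha₂, haa, ha₂u, ha₂c⟩ := exists_nb_ne_ne (by omega : 3 ≤ (nb G W a).card) u c
  obtain ⟨b₂, hb₂, hbb, hb₂u, hb₂c⟩ := exists_nb_ne_ne (by omega : 3 ≤ (nb G W b).card) u c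
  have ha₂b : a₂ ≠ b := by rintro rfl; exact hnab haa
  have hb₂a : b₂ ≠ a := by rintro rfl; exact hnab hbb.symm
  have fa : ∀ x ∈ W, G.Adj a x → x = u ∨ x = c ∨ x = a₂ := fun x hx h =>
    eq_of_deg_le_three (hG.deg a ha) humem hua.symm hc hac ha₂ haa hcu.symm ha₂u.symm ha₂c.symm hx h
  have fb : ∀ x ∈ W, G.Adj b x → x = u ∨ x = c ∨ x = b₂ := fun x hx h =>
    eq_of_deg_le_three (hG.deg b hb) humem hub.symm hc hbc hb₂ hbb hcu.symm hb₂u.symm hb₂c.symm hx h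
  by_cases hab₂ : a₂ = b₂
  · subst hab₂
    have h := (ih.sdiff hG hc (S := {u, a, c, b, a₂}) (by simp)).zero
    exact loc' h hG.deg ![u, a, b, c, a₂] [(0, 1), (0, 2), (1, 3), (2, 3), (1, 4), (2, 4)]
      ![2, 3, 3, 3, 3] [0] [(1, 3), (2, 4)] [] [] 0
  by_cases hdc : (nb G W c).card ≤ 2
  · have h := (ih.sdiff hG hc (S := {u, a, c, b, b₂}) (by simp)).zero
    exact loc' h hG.deg ![u, a, b, c, b₂] [(0, 1), (0, 2), (1, 3), (2, 3), (2, 4)]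
      ![2, 3, 3, 2, 3] [0] [(1, 3), (2, 4)] [] [] 0
  obtain ⟨c', hc', hcc, hc'a, hc'b⟩ := exists_nb_ne_ne (by omega : 3 ≤ (nb G W c).card) a b
  have fc : ∀ x ∈ W, G.Adj c x → x = a ∨ x = b ∨ x = c' := fun x hx h =>
    eq_of_deg_le_three (hG.deg c hc) ha hac.symm hb hbc.symm hc' hcc hab hc'a.symm hc'b.symm hx h
  have hc'u : c' ≠ u := by
    rintro rfl
    have := full c hc hcc.symm
    grind [→ SimpleGraph.Adj.ne]
  by_cases hca₂ : c' = a₂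
  · subst hca₂
    have h := (ih.sdiff hG hc (S := {u, a, c', b, c}) (by simp)).zero
    exact loc' h hG.deg ![u, a, b, c, c'] [(0, 1), (0, 2), (1, 3), (2, 3), (1, 4), (3, 4)]
      ![2, 3, 3, 3, 3] [0] [(1, 4), (2, 3)] [] [] 0
  by_cases hcb₂ : c' = b₂
  · subst hcb₂
    have h := (ih.sdiff hG hc (S := {u, b, c', a, c}) (by simp)).zero
    exact loc' h hG.deg ![u, a, b, c, c'] [(0, 1), (0, 2), (1, 3), (2, 3), (2, 4), (3, 4)]
      ![2, 3, 3, 3, 3] [0] [(2, 4), (1, 3)] [] [] 0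
  have hba₂ : ¬ G.Adj b a₂ := fun h => by rcases fb a₂ ha₂ h with h | h | h <;> contradiction
  have hG1 : Ok G (W \ {u}) := hG.subset Finset.sdiff_subset
  have m : ∀ x, x ∈ W → x ≠ u → x ∈ W \ {u} := fun x hx h => by simp [hx, h]
  have ma := m a ha hua.ne.symm
  have mb := m b hb hub.ne.symm
  have mc := m c hc hcu
  have ma₂ := m a₂ ha₂ ha₂u
  have hda1 : (nb G (W \ {u}) a).card ≤ 2 := by
    have := card_nb_sdiff_lt (S := {u}) humem (by simp) hua.symm
    have := hG.deg a ha
    omega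
  rcases ok_sup_edge_or_bad hG1.deg (fun U hU => hG1.degen U (hU.trans Finset.sdiff_subset)) ma mc
    mb ma₂ haa hbc.symm hab.symm ha₂c ha₂b.symm hba₂ with h | ⟨U, hU⟩
  swap
  -- An obstruction needs two neighbours of `b` inside `U`, but `u` has been deleted and `c` lies on
  -- the suppressed path.
  · have h1 : nb G U b ⊆ {b₂} := by
      intro x hx
      rw [mem_nb] at hx
      have hxW := Finset.mem_sdiff.1 (hU.sub hx.1)
      rcases fb x hxW.1 hx.2 with rfl | rfl | rfl
      · simp at hxW
      · exact (hU.notMem₁ hx.1).elim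
      · simp
    have := hU.two.trans (Finset.card_le_card h1)
    simp at this
  have hcl := ih _ ((W \ {u}) \ {a, c}) ((sdiff_lt ma (by simp)).trans (sdiff_lt humem (by simp))) h
  have mb' : b ∈ (W \ {u}) \ {a, c} := by simp [mb, hab.symm, hbc.ne]
  have ma₂' : a₂ ∈ (W \ {u}) \ {a, c} := by simp [ma₂, haa.ne.symm, ha₂c]
  have hb1 : 1 ≤ (nb (G ⊔ SimpleGraph.edge b a₂) ((W \ {u}) \ {a, c}) b).card := by
    rw [nb_sup_edge_left G ha₂b.symm ma₂']
    simp
  have hb2 := h.deg b mb'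
  by_cases hT : Twin (G ⊔ SimpleGraph.edge b a₂) ((W \ {u}) \ {a, c}) b
  swap
  · have hb3 : (nb (G ⊔ SimpleGraph.edge b a₂) ((W \ {u}) \ {a, c}) b).card ≤ 2 := by
      refine (Finset.card_le_card (t := {a₂, b₂}) ?_).trans Finset.card_le_two
      intro x
      simp only [mem_nb, Finset.mem_sdiff, SimpleGraph.sup_adj, SimpleGraph.edge_adj,
        Finset.mem_insert, Finset.mem_singleton]
      grind
    have h' := (hcl.cover b mb' hb1 hb3 hT).suppress ma mc mb ma₂ hac haa hbc.symm hab.symm ha₂c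
      ha₂b.symm hba₂
    refine hu'.unmatched hG h' (by simp) (by simp) ?_
    have := hG1.deg c mc
    omega
  obtain ⟨v₁, v₂, p, q, hT⟩ := hT.exists
  have hT' : ∃ p q, TwinAt (G ⊔ SimpleGraph.edge b a₂) ((W \ {u}) \ {a, c}) b a₂ b₂ p q := by
    have e1 := hT.mem₁
    have e2 := hT.mem₂
    have e3 := hT.adj₁
    have e4 := hT.adj₂
    have e5 := hT.ne₁₂
    simp only [Finset.mem_sdiff, SimpleGraph.sup_adj, SimpleGraph.edge_adj,
      Finset.mem_insert, Finset.mem_singleton] at e1 e2 e3 e4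
    have : (v₁ = a₂ ∧ v₂ = b₂) ∨ (v₁ = b₂ ∧ v₂ = a₂) := by grind
    rcases this with ⟨rfl, rfl⟩ | ⟨rfl, rfl⟩
    · exact ⟨p, q, hT⟩
    · exact ⟨p, q, hT.symm⟩
  clear! p q v₁ v₂
  obtain ⟨p, q, _, mb₂, mp, mq, _, hpq, hbp, hbq, _, _, hap, haq, hb₂p, hb₂q, _, _, _, _⟩ := hT'
  simp only [Finset.mem_sdiff, SimpleGraph.sup_adj, SimpleGraph.edge_adj,
    Finset.mem_insert, Finset.mem_singleton, not_or] at mp mq mb₂ hap haq hb₂p hb₂q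
  have hb₂b := hbb.ne
  replace hap : G.Adj a₂ p := by grind
  replace haq : G.Adj a₂ q := by grind
  replace hb₂p : G.Adj b₂ p := by grind
  replace hb₂q : G.Adj b₂ q := by grind
  have conf : ∀ p q, p ∈ W → q ∈ W → p ≠ q → p ≠ b → q ≠ b → p ≠ a → q ≠ a → p ≠ u → q ≠ u →
      q ≠ c →
      G.Adj a₂ p → G.Adj a₂ q → G.Adj b₂ p → G.Adj b₂ q → c' = p → Sol G W ∅ 0 := by
    rintro p q hp hq hpq hpb hqb hpa hqa hpu hqu hqc h1 h2 h3 h4 rfl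
    have h := (ih.sdiff hG hc (S := {u, c', a, c, b, b₂, a₂, q}) (by simp)).zero
    exact loc' h hG.deg ![u, a, b, c, a₂, b₂, c', q] [(0, 1), (0, 2), (1, 3), (1, 4), (2, 3),
      (2, 5), (3, 6), (4, 6), (4, 7), (5, 6), (5, 7)]
      ![2, 3, 3, 3, 3, 3, 3, 3] [0, 6] [(1, 3), (2, 5), (4, 7)] [] [] 2
  by_cases hc'p : c' = p
  · exact conf p q mp.1.1 mq.1.1 hpq hbp.symm hbq.symm mp.2.1 mq.2.1 mp.1.2 mq.1.2 mq.2.2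
      hap haq hb₂p hb₂q hc'p
  by_cases hc'q : c' = q
  · exact conf q p mq.1.1 mp.1.1 hpq.symm hbq.symm hbp.symm mq.2.1 mp.2.1 mq.1.2 mp.1.2 mp.2.2
      haq hap hb₂q hb₂p hc'q
  -- Deleting these six vertices takes both `a₂` and `b₂` from `p` and from `q`, which are left with
  -- degree at most one. So `cover_of_leaves` covers `c'`, and `u` and `c` can stay unmatched.
  have hok : Ok G (W \ {u, c, a, a₂, b, b₂}) := hG.subset Finset.sdiff_subset
  have fa₂ : ∀ x ∈ W, G.Adj a₂ x → x = a ∨ x = p ∨ x = q := fun x hx h =>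
    eq_of_deg_le_three (hG.deg a₂ ha₂) ha haa.symm mp.1.1 hap mq.1.1 haq (Ne.symm mp.2.1)
      (Ne.symm mq.2.1) hpq hx h
  have fb₂ : ∀ x ∈ W, G.Adj b₂ x → x = b ∨ x = p ∨ x = q := fun x hx h =>
    eq_of_deg_le_three (hG.deg b₂ hb₂) hb hbb.symm mp.1.1 hb₂p mq.1.1 hb₂q hbp hbq hpq hx h
  have hp' := card_nb_sdiff_add_two_le (W := W) (S := {u, c, a, a₂, b, b₂}) ha₂ (by simp)
    hap.symm hb₂ (by simp) hb₂p.symm hab₂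
  have hq' := card_nb_sdiff_add_two_le (W := W) (S := {u, c, a, a₂, b, b₂}) ha₂ (by simp)
    haq.symm hb₂ (by simp) hb₂q.symm hab₂
  have hc'' := card_nb_sdiff_lt (W := W) (S := {u, c, a, a₂, b, b₂}) hc (by simp) hcc.symm
  have dp := hG.deg p mp.1.1
  have dq := hG.deg q mq.1.1
  have dc' := hG.deg c' hc'
  obtain ⟨z, hz, hcz, hzc⟩ := exists_nb_ne (hmin c' hc') c
  have hc'c : c' ≠ c := hcc.ne.symm
  have zu : z ≠ u := by rintro rfl; rcases full c' hc' hcz.symm with h | h <;> contradiction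
  have za : z ≠ a := by rintro rfl; rcases fa c' hc' hcz.symm with h | h | h <;> contradiction
  have zb : z ≠ b := by rintro rfl; rcases fb c' hc' hcz.symm with h | h | h <;> contradiction
  have za₂ : z ≠ a₂ := by rintro rfl; rcases fa₂ c' hc' hcz.symm with h | h | h <;> contradiction
  have zb₂ : z ≠ b₂ := by rintro rfl; rcases fb₂ c' hc' hcz.symm with h | h | h <;> contradiction
  have h := cover_of_leaves (fun G' W' h => ih G' W' (h.trans (sdiff_lt humem (by simp)))) hok
    (v := c') (l := p) (m := q) (by simp; grind [→ SimpleGraph.Adj.ne])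
    (by simp; grind [→ SimpleGraph.Adj.ne]) (by simp; grind [→ SimpleGraph.Adj.ne])
    hpq hc'p hc'q (one_le_deg (a := z) (by simp [*]) hcz) (by omega)
    (by omega) (by omega)
  exact loc' h hG.deg ![u, a, b, c, a₂, b₂, c'] [(0, 1), (0, 2), (1, 3), (1, 4), (2, 3),
      (2, 5), (3, 6)]
      ![2, 3, 3, 3, 3, 3, 3] [0, 3] [(1, 4), (2, 5)] [6] [] 1

/-! ### A twin next to the vertex of degree two -/

/-- The neighbour `b` of `u` begins a copy of `K₃,₃` minus an edge, with vertices `b p q` and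
`b₁ b₂ v`, that is left through `b u` and `v w`. -/
structure Branch (G : SimpleGraph V) (W : Finset V) (u b b₁ b₂ p q v w : V) : Prop where
  mem₁ : b₁ ∈ W
  mem₂ : b₂ ∈ W
  memp : p ∈ W
  memq : q ∈ W
  memv : v ∈ W
  memw : w ∈ W
  adj₁ : G.Adj b b₁
  adj₂ : G.Adj b b₂
  adj₁p : G.Adj b₁ p
  adj₁q : G.Adj b₁ q
  adj₂p : G.Adj b₂ p
  adj₂q : G.Adj b₂ q
  adjpv : G.Adj p v
  adjqv : G.Adj q v
  adjvw : G.Adj v w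
  nu : u ≠ b₁ ∧ u ≠ b₂ ∧ u ≠ p ∧ u ≠ q ∧ u ≠ v ∧ u ≠ w
  nb₁₂ : b₁ ≠ b₂
  npq : p ≠ q
  nbp : b ≠ p ∧ b ≠ q ∧ b ≠ v ∧ b ≠ w
  nv : v ≠ b₁ ∧ v ≠ b₂
  nw : w ≠ b₁ ∧ w ≠ b₂ ∧ w ≠ p ∧ w ≠ q
  fullb : ∀ x ∈ W, G.Adj b x → x = u ∨ x = b₁ ∨ x = b₂
  full₁ : ∀ x ∈ W, G.Adj b₁ x → x = b ∨ x = p ∨ x = q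
  full₂ : ∀ x ∈ W, G.Adj b₂ x → x = b ∨ x = p ∨ x = q
  fullp : ∀ x ∈ W, G.Adj p x → x = b₁ ∨ x = b₂ ∨ x = v
  fullq : ∀ x ∈ W, G.Adj q x → x = b₁ ∨ x = b₂ ∨ x = v
  fullv : ∀ x ∈ W, G.Adj v x → x = p ∨ x = q ∨ x = w

/-- Both `u` and `p` stay unmatched, which gains 3 and so affords covering `a` by `weak`. That needs
a neighbour of `a` that survives the deletion; if the only candidate is `q`, then `a` is matched to
`q` instead. -/
lemma twin_low (ih : IH W) (hG : Ok G W) {u a b b₁ b₂ p q : V} (hu : Deg2 G W u a b)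
    (hT : TwinAt G (W \ {u}) b b₁ b₂ p q) (hbu : b₁ ≠ u ∧ b₂ ≠ u ∧ p ≠ u ∧ q ≠ u)
    (hb : ∀ x ∈ W, G.Adj b x → x = u ∨ x = b₁ ∨ x = b₂)
    (hb₁ : ∀ x ∈ W, G.Adj b₁ x → x = b ∨ x = p ∨ x = q)
    (hb₂ : ∀ x ∈ W, G.Adj b₂ x → x = b ∨ x = p ∨ x = q)
    (ha : a ≠ b₁ ∧ a ≠ b₂ ∧ a ≠ p ∧ a ≠ q) (hp : (nb G W p).card ≤ 2) : Sol G W ∅ 0 := by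
  obtain ⟨m1, m2, mp, mq, n12, npq, nbp, nbq, _, _, _, _, _, _, _, _, _, _⟩ := hT
  obtain ⟨humem, hamem, hbmem, hua, hub, hnab, hab, hdu, full, hmin⟩ := hu
  obtain ⟨_, _, _, _⟩ := ha
  obtain ⟨_, _, _, _⟩ := hbu
  replace m1 := (Finset.mem_sdiff.1 m1).1
  replace m2 := (Finset.mem_sdiff.1 m2).1
  replace mp := (Finset.mem_sdiff.1 mp).1
  replace mq := (Finset.mem_sdiff.1 mq).1
  have hpp : ∀ x ∈ W, G.Adj p x → x = b₁ ∨ x = b₂ := fun x hx h =>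
    eq_of_deg_le_two hp m1 (by grind [→ SimpleGraph.Adj.symm]) m2
      (by grind [→ SimpleGraph.Adj.symm]) n12 hx h
  by_cases hout : ∃ x ∈ W, G.Adj a x ∧ x ≠ u ∧ x ≠ q
  · obtain ⟨x, hx, hax, hxu, hxq⟩ := hout
    have h1 : x ≠ b := by rintro rfl; exact hnab hax
    have h2 : x ≠ b₁ := by rintro rfl; rcases hb₁ a hamem hax.symm with h | h | h <;> contradiction
    have h3 : x ≠ b₂ := by rintro rfl; rcases hb₂ a hamem hax.symm with h | h | h <;> contradiction
    have h4 : x ≠ p := by rintro rfl; rcases hpp a hamem hax.symm with h | h <;> contradiction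
    have hd := card_nb_sdiff_lt (W := W) (S := {u, p, b, b₁, b₂, q}) humem (by simp) hua.symm
    have hd3 := hG.deg a hamem
    have h := (ih.sdiff hG humem (S := {u, p, b, b₁, b₂, q}) (by simp)).weak a
      (by simp [*, hua.ne.symm]) (one_le_deg (a := x) (by simp [*]) hax) (by omega)
    exact loc' h hG.deg ![u, a, b, b₁, b₂, p, q] [(0, 1), (0, 2), (2, 3), (2, 4), (3, 5), (3, 6),
      (4, 5), (4, 6)] ![2, 3, 3, 3, 3, 2, 3] [0, 5] [(2, 3), (4, 6)] [1] [] 3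
  · push Not at hout
    obtain ⟨x, hx, hax, hxu⟩ := exists_nb_ne (hmin a hamem) u
    obtain rfl := hout x hx hax hxu
    have hda : (nb G W a).card ≤ 2 := by
      refine (Finset.card_le_card (t := {u, x}) fun y hy => ?_).trans Finset.card_le_two
      have := mem_nb.1 hy
      have := hout y this.1 this.2
      simp; tauto
    have h := (ih.sdiff hG humem (S := {u, a, x, b, b₁, p, b₂}) (by simp)).zero
    exact loc' h hG.deg ![u, a, b, b₁, b₂, p, x] [(0, 1), (0, 2), (2, 3), (2, 4), (3, 5), (3, 6),
      (4, 5), (4, 6), (1, 6)] ![2, 2, 3, 3, 3, 2, 3] [0] [(1, 6), (2, 3), (5, 4)] [] [] 1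

/-- A twin neighbour `b` of `u` either can be reduced or begins a branch. -/
lemma twin_reduce (ih : IH W) (hG : Ok G W) {u a b b₁ b₂ p q : V} (hu : Deg2 G W u a b)
    (hno : ∀ x ∈ W, G.Adj a x → G.Adj b x → x = u) (hT : TwinAt G (W \ {u}) b b₁ b₂ p q) :
    Sol G W ∅ 0 ∨ ∃ v w, Branch G W u b b₁ b₂ p q v w ∧ a ≠ v ∧ a ≠ w ∧ a ≠ b₁ ∧ a ≠ b₂ ∧ a ≠ p ∧
      a ≠ q ∧ ¬ ((nb G W a).card ≤ 2 ∧ G.Adj a w) := by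
  have hu' := hu
  have hT' := hT
  obtain ⟨m1, m2, mp, mq, n12, npq, nbp, nbq, h1, h2, h1p, h1q, h2p, h2q, -, f, f1, f2⟩ := hT
  obtain ⟨humem, ha, hb, hua, hub, hnab, hab, hdu, full, hmin⟩ := hu
  simp only [Finset.mem_sdiff, Finset.mem_singleton] at m1 m2 mp mq f f1 f2
  have hub₁ := m1.2
  have hub₂ := m2.2
  have hup := mp.2
  have huq := mq.2
  replace m1 := m1.1
  replace m2 := m2.1
  replace mp := mp.1
  replace mq := mq.1
  have ha1 : a ≠ b₁ := by rintro rfl; exact hnab h1.symm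
  have ha2 : a ≠ b₂ := by rintro rfl; exact hnab h2.symm
  have hap : a ≠ p := by rintro rfl; exact hub₁ (hno _ m1 h1p.symm h1)
  have haq : a ≠ q := by rintro rfl; exact hub₁ (hno _ m1 h1q.symm h1)
  have nu : ∀ x ∈ W, x ≠ a → x ≠ b → ¬ G.Adj x u := fun x hx hxa hxb h => by
    rcases full x hx h.symm with h | h <;> contradiction
  have fb : ∀ x ∈ W, G.Adj b x → x = u ∨ x = b₁ ∨ x = b₂ := fun x hx h => by
    by_cases hxu : x = u
    · exact Or.inl hxu
    · exact Or.inr (f x ⟨hx, hxu⟩ h)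
  have fb₁ : ∀ x ∈ W, G.Adj b₁ x → x = b ∨ x = p ∨ x = q := fun x hx h =>
    f1 x ⟨hx, by rintro rfl; exact nu b₁ m1 ha1.symm h1.ne.symm h⟩ h
  have fb₂ : ∀ x ∈ W, G.Adj b₂ x → x = b ∨ x = p ∨ x = q := fun x hx h =>
    f2 x ⟨hx, by rintro rfl; exact nu b₂ m2 ha2.symm h2.ne.symm h⟩ h
  clear f f1 f2
  by_cases hdp : (nb G W p).card ≤ 2
  · exact Or.inl (twin_low ih hG hu' hT' ⟨hub₁, hub₂, hup, huq⟩ fb fb₁ fb₂ ⟨ha1, ha2, hap, haq⟩ hdp)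
  by_cases hdq : (nb G W q).card ≤ 2
  · exact Or.inl (twin_low ih hG hu' hT'.swap ⟨hub₁, hub₂, huq, hup⟩ fb (by grind) (by grind)
      ⟨ha1, ha2, haq, hap⟩ hdq)
  clear hT'
  by_cases hpq : G.Adj p q
  · left
    have fp : ∀ x ∈ W, G.Adj p x → x = b₁ ∨ x = b₂ ∨ x = q := fun x hx h =>
      eq_of_deg_le_three (hG.deg p mp) m1 h1p.symm m2 h2p.symm mq hpq n12 h1q.ne h2q.ne hx h
    have fq : ∀ x ∈ W, G.Adj q x → x = b₁ ∨ x = b₂ ∨ x = p := fun x hx h =>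
      eq_of_deg_le_three (hG.deg q mq) m1 h1q.symm m2 h2q.symm mp hpq.symm n12 h1p.ne h2p.ne hx h
    obtain ⟨x, hx, hax, hxu⟩ := exists_nb_ne (hmin a ha) u
    have h1 : x ≠ b := by rintro rfl; exact hnab hax
    have h2 : x ≠ b₁ := by rintro rfl; rcases fb₁ a ha hax.symm with h | h | h <;> contradiction
    have h3 : x ≠ b₂ := by rintro rfl; rcases fb₂ a ha hax.symm with h | h | h <;> contradiction
    have h4 : x ≠ p := by rintro rfl; rcases fp a ha hax.symm with h | h | h <;> contradiction
    have h5 : x ≠ q := by rintro rfl; rcases fq a ha hax.symm with h | h | h <;> contradiction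
    have hd := card_nb_sdiff_lt (W := W) (S := {u, b₁, b, b₂, p, q}) humem (by simp) hua.symm
    have hd3 := hG.deg a ha
    have h := (ih.sdiff hG humem (S := {u, b₁, b, b₂, p, q}) (by simp)).weak a
      (by simp [*, hua.ne.symm]) (one_le_deg (a := x) (by simp [*]) hax) (by omega)
    exact loc' h hG.deg ![u, a, b, b₁, b₂, p, q] [(0, 1), (0, 2), (2, 3), (2, 4), (3, 5), (3, 6),
      (4, 5), (4, 6), (5, 6)] ![2, 3, 3, 3, 3, 3, 3] [0, 3] [(2, 4), (5, 6)] [1] [] 3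
  obtain ⟨v, mv, hpv, hv1, hv2⟩ := exists_nb_ne_ne (by omega : 3 ≤ (nb G W p).card) b₁ b₂
  obtain ⟨v', mv', hqv, hv1', hv2'⟩ := exists_nb_ne_ne (by omega : 3 ≤ (nb G W q).card) b₁ b₂
  have fp : ∀ x ∈ W, G.Adj p x → x = b₁ ∨ x = b₂ ∨ x = v := fun x hx h =>
    eq_of_deg_le_three (hG.deg p mp) m1 h1p.symm m2 h2p.symm mv hpv n12 hv1.symm hv2.symm hx h
  have fq : ∀ x ∈ W, G.Adj q x → x = b₁ ∨ x = b₂ ∨ x = v' := fun x hx h =>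
    eq_of_deg_le_three (hG.deg q mq) m1 h1q.symm m2 h2q.symm mv' hqv n12 hv1'.symm hv2'.symm hx h
  have hvu : v ≠ u := by rintro rfl; exact nu p mp hap.symm nbp.symm hpv
  have hvu' : v' ≠ u := by rintro rfl; exact nu q mq haq.symm nbq.symm hqv
  have hvb : v ≠ b := by rintro rfl; rcases fb p mp hpv.symm with h | h | h <;> grind
  have hvb' : v' ≠ b := by rintro rfl; rcases fb q mq hqv.symm with h | h | h <;> grind
  -- If `p` and `q` leave the `K₂,₃` through different vertices, each is matched to its own exit and
  -- `b₁`, `b₂` stay unmatched. A common exit `v` completes `K₃,₃` minus an edge.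
  by_cases hvv : v = v'
  swap
  · left
    have : p ≠ v' := by rintro rfl; exact hpq hqv.symm
    have : q ≠ v := by rintro rfl; exact hpq hpv
    have h := (ih.sdiff hG humem (S := {b₁, b₂, u, b, p, v, q, v'}) (by simp)).zero
    exact loc' h hG.deg ![u, b, b₁, b₂, p, q, v, v'] [(0, 1), (1, 2), (1, 3), (2, 4), (2, 5),
      (3, 4), (3, 5), (4, 6), (5, 7)] ![2, 3, 3, 3, 3, 3, 3, 3] [2, 3] [(0, 1), (4, 6), (5, 7)]
      [] [] 0
  subst hvv
  by_cases hva : v = a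
  · subst hva
    left
    have h := (ih.sdiff hG humem (S := {u, b, b₁, p, b₂, q, v}) (by simp)).zero
    exact loc' h hG.deg ![u, v, b, b₁, b₂, p, q] [(0, 1), (0, 2), (2, 3), (2, 4), (3, 5), (3, 6),
      (4, 5), (4, 6), (1, 5), (1, 6)] ![2, 3, 3, 3, 3, 3, 3] [0] [(2, 3), (5, 4), (6, 1)]
      [] [] 0 (hc := by decide)
  by_cases hdv : (nb G W v).card ≤ 2
  · left
    have h := (ih.sdiff hG humem (S := {b, v, u, a, b₁, p, b₂, q}) (by simp)).zero
    exact loc' h hG.deg ![u, a, b, b₁, b₂, p, q, v] [(0, 1), (0, 2), (2, 3), (2, 4), (3, 5),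
      (3, 6), (4, 5), (4, 6), (5, 7), (6, 7)] ![2, 3, 3, 3, 3, 3, 3, 2] [2, 7]
      [(0, 1), (3, 5), (4, 6)] [] [] 2
  obtain ⟨w, mw, hvw, hwp, hwq⟩ := exists_nb_ne_ne (by omega : 3 ≤ (nb G W v).card) p q
  have fv : ∀ x ∈ W, G.Adj v x → x = p ∨ x = q ∨ x = w := fun x hx h =>
    eq_of_deg_le_three (hG.deg v mv) mp hpv.symm mq hqv.symm mw hvw npq hwp.symm hwq.symm hx h
  have hwu : w ≠ u := by rintro rfl; exact nu v mv hva hvb hvw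
  have hwb : w ≠ b := by rintro rfl; rcases fb v mv hvw.symm with h | h | h <;> contradiction
  have hw1 : w ≠ b₁ := by
    rintro rfl; rcases fb₁ v mv hvw.symm with h | h | h <;> grind [→ SimpleGraph.Adj.ne]
  have hw2 : w ≠ b₂ := by
    rintro rfl; rcases fb₂ v mv hvw.symm with h | h | h <;> grind [→ SimpleGraph.Adj.ne]
  by_cases hwa : w = a
  · subst hwa
    left
    have h := (ih.sdiff hG humem (S := {u, q, b, b₁, p, b₂, v, w}) (by simp)).zero
    exact loc' h hG.deg ![u, w, b, b₁, b₂, p, q, v] [(0, 1), (0, 2), (2, 3), (2, 4), (3, 5),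
      (3, 6), (4, 5), (4, 6), (5, 7), (6, 7), (1, 7)] ![2, 3, 3, 3, 3, 3, 3, 3] [0, 6]
      [(2, 3), (5, 4), (7, 1)] [] [] 2
  -- Removing this case guarantees `a` a neighbour other than `u` and `w`, as `twin_side` requires.
  by_cases haw : (nb G W a).card ≤ 2 ∧ G.Adj a w
  · left
    obtain ⟨hda, haw⟩ := haw
    by_cases hdw : (nb G W w).card ≤ 2
    · have h := (ih.sdiff hG humem (S := {u, a, w, b, b₁, p, b₂, q, v}) (by simp)).zero
      exact loc' h hG.deg ![u, a, b, b₁, b₂, p, q, v, w] [(0, 1), (0, 2), (2, 3), (2, 4), (3, 5),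
        (3, 6), (4, 5), (4, 6), (5, 7), (6, 7), (7, 8), (1, 8)] ![2, 2, 3, 3, 3, 3, 3, 3, 2] [0]
        [(1, 8), (2, 3), (5, 4), (6, 7)] [] [] 0
    · obtain ⟨x, hx, hwx, hxv, hxa⟩ := exists_nb_ne_ne (by omega : 3 ≤ (nb G W w).card) v a
      have x1 : x ≠ u := by rintro rfl; rcases full w mw hwx.symm with h | h <;> contradiction
      have x2 : x ≠ b := by rintro rfl; rcases fb w mw hwx.symm with h | h | h <;> contradiction
      have x3 : x ≠ b₁ := by rintro rfl; rcases fb₁ w mw hwx.symm with h | h | h <;> contradiction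
      have x4 : x ≠ b₂ := by rintro rfl; rcases fb₂ w mw hwx.symm with h | h | h <;> contradiction
      have x5 : x ≠ p := by
        rintro rfl; rcases fp w mw hwx.symm with h | h | h <;> grind [→ SimpleGraph.Adj.ne]
      have x6 : x ≠ q := by
        rintro rfl; rcases fq w mw hwx.symm with h | h | h <;> grind [→ SimpleGraph.Adj.ne]
      have hd := card_nb_sdiff_lt (W := W) (S := {b, v, u, a, b₁, p, b₂, q}) mv (by simp) hvw.symm
      have hd3 := hG.deg w mw
      have h := (ih.sdiff hG humem (S := {b, v, u, a, b₁, p, b₂, q}) (by simp)).weak w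
        (by simp [*, hvw.ne.symm]) (one_le_deg (a := x) (by simp [*]) hwx) (by omega)
      exact loc' h hG.deg ![u, a, b, b₁, b₂, p, q, v, w] [(0, 1), (0, 2), (2, 3), (2, 4), (3, 5),
        (3, 6), (4, 5), (4, 6), (5, 7), (6, 7), (7, 8)] ![2, 2, 3, 3, 3, 3, 3, 3, 3] [2, 7]
        [(0, 1), (3, 5), (4, 6)] [8] [] 2
  right
  refine ⟨v, w, ?_, Ne.symm hva, Ne.symm hwa, ha1, ha2, hap, haq, haw⟩
  constructor <;> first | assumption | grind

lemma TwinAt.of_subset {R : Finset V} (h3 : ∀ v ∈ W, (nb G W v).card ≤ 3) (hR : R ⊆ W)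
    {v v₁ v₂ p q : V} (hv : v ∈ W) (hd : (nb G W v).card ≤ 2) (h : TwinAt G R v v₁ v₂ p q) :
    TwinAt G W v v₁ v₂ p q := by
  obtain ⟨m1, m2, mp, mq, n12, npq, nvp, nvq, h1, h2, h1p, h1q, h2p, h2q, hd2, f, f1, f2⟩ := h
  have := hR m1
  have := hR m2
  have := hR mp
  have := hR mq
  have := card_nb_mono G hR v
  constructor <;> first | assumption | skip
  · omega
  · exact fun x hx hvx => eq_of_deg_le_two hd (hR m1) h1 (hR m2) h2 n12 hx hvx
  · exact fun x hx hvx => eq_of_deg_le_three (h3 _ (hR m1)) hv h1.symm (hR mp) h1p (hR mq)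
      h1q nvp nvq npq hx hvx
  · exact fun x hx hvx => eq_of_deg_le_three (h3 _ (hR m2)) hv h2.symm (hR mp) h2p (hR mq)
      h2q nvp nvq npq hx hvx

set_option maxHeartbeats 1000000 in
set_option maxRecDepth 20000 in
/-- Both neighbours of `u` begin a branch. -/
lemma two_branches (ih : IH W) (hG : Ok G W) {u a b b₁ b₂ p q v w a₁ a₂ x y v' w' : V}
    (hu : Deg2 G W u a b) (hB : Branch G W u b b₁ b₂ p q v w) (hA : Branch G W u a a₁ a₂ x y v' w')
    (hab : a ≠ v ∧ a ≠ w ∧ a ≠ b₁ ∧ a ≠ b₂ ∧ a ≠ p ∧ a ≠ q)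
    (hba : b ≠ v' ∧ b ≠ w' ∧ b ≠ a₁ ∧ b ≠ a₂ ∧ b ≠ x ∧ b ≠ y)
    (hR : ∀ z, z = a₁ ∨ z = a₂ ∨ z = x ∨ z = y →
      z ≠ b₁ ∧ z ≠ b₂ ∧ z ≠ p ∧ z ≠ q ∧ z ≠ v ∧ z ≠ w) : Sol G W ∅ 0 := by
  obtain ⟨humem, hamem, hbmem, hua, hub, hnab, hneab, hdu, full, hmin⟩ := hu
  obtain ⟨mb1, mb2, mp, mq, mv, mw, hb1, hb2, h1p, h1q, h2p, h2q, hpv, hqv, hvw,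
    ⟨nu1, nu2, nup, nuq, nuv, nuw⟩, n12, npq, ⟨nbp, nbq, nbv, nbw⟩, ⟨nv1, nv2⟩,
    ⟨nw1, nw2, nwp, nwq⟩, fb, fb1, fb2, fp, fq, fv⟩ := hB
  obtain ⟨ma1, ma2, mx, my, mv', mw', ha1, ha2, h1x, h1y, h2x, h2y, hxv, hyv, hvw',
    ⟨nu1', nu2', nux, nuy, nuv', nuw'⟩, n12', nxy, ⟨nax, nay, nav', naw'⟩, ⟨nv1', nv2'⟩,
    ⟨nw1', nw2', nwx, nwy⟩, fa, fa1, fa2, fx, fy, fv'⟩ := hA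
  obtain ⟨nav, naw, nab1, nab2, nap, naq⟩ := hab
  obtain ⟨nbv', nbw', nba1, nba2, nbx, nby⟩ := hba
  obtain ⟨ra1, ra2, ra3, ra4, ra5, ra6⟩ := hR a₁ (by simp)
  obtain ⟨rb1, rb2, rb3, rb4, rb5, rb6⟩ := hR a₂ (by simp)
  obtain ⟨rx1, rx2, rx3, rx4, rx5, rx6⟩ := hR x (by simp)
  obtain ⟨ry1, ry2, ry3, ry4, ry5, ry6⟩ := hR y (by simp)
  clear hR
  have s1 : v' ≠ b₁ := by rintro rfl; rcases fb1 x mx hxv.symm with h | h | h <;> grind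
  have s2 : v' ≠ b₂ := by rintro rfl; rcases fb2 x mx hxv.symm with h | h | h <;> grind
  have s3 : v' ≠ p := by rintro rfl; rcases fp x mx hxv.symm with h | h | h <;> contradiction
  have s4 : v' ≠ q := by rintro rfl; rcases fq x mx hxv.symm with h | h | h <;> contradiction
  have s5 : v' ≠ v := by rintro rfl; rcases fv x mx hxv.symm with h | h | h <;> contradiction
  have n1 := ha1.ne
  have n2 := ha2.ne
  have n3 := h1x.ne
  have n4 := h2x.ne
  have n5 := h1y.ne
  have n6 := h2y.ne
  have n7 := hxv.ne
  have n8 := hyv.ne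
  have k1 := hb1.ne
  have k2 := hb2.ne
  have k3 := h1p.ne
  have k4 := h2p.ne
  have k5 := h1q.ne
  have k6 := h2q.ne
  have k7 := hpv.ne
  have k8 := hqv.ne
  have k9 := hvw.ne
  have l1 := hua.ne
  have l2 := hub.ne
  by_cases hwv : w = v'
  · subst hwv
    have h := (ih.sdiff hG humem (S := {b, v, a₁, u, a, b₁, p, b₂, q, x, a₂, y, w})
      (by simp)).zero
    exact loc' h hG.deg ![u, a, b, b₁, b₂, p, q, v, a₁, a₂, x, y, w] [(0, 1), (0, 2), (2, 3),
      (2, 4), (3, 5), (3, 6), (4, 5), (4, 6), (5, 7), (6, 7), (1, 8), (1, 9), (8, 10), (8, 11),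
      (9, 10), (9, 11), (10, 12), (11, 12), (7, 12)] ![2, 3, 3, 3, 3, 3, 3, 3, 3, 3, 3, 3, 3]
      [2, 7, 8] [(0, 1), (3, 5), (4, 6), (10, 9), (11, 12)] [] [] 3
      (hE := by simp [*])
  -- A neighbour of `w` outside both branches allows `weak` to cover `w`, so that `v` can stay
  -- unmatched. Otherwise `w` joins `v` and `v'` only and is absorbed into the configuration.
  by_cases hout : ∃ z ∈ W, G.Adj w z ∧ z ≠ v ∧ z ≠ v'
  · obtain ⟨z, hz, hwz, hzv, hzv'⟩ := hout
    have x1 : z ≠ u := by rintro rfl; rcases full w mw hwz.symm with h | h <;> grind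
    have x2 : z ≠ b := by rintro rfl; rcases fb w mw hwz.symm with h | h | h <;> grind
    have x3 : z ≠ b₁ := by rintro rfl; rcases fb1 w mw hwz.symm with h | h | h <;> grind
    have x4 : z ≠ b₂ := by rintro rfl; rcases fb2 w mw hwz.symm with h | h | h <;> grind
    have x5 : z ≠ p := by rintro rfl; rcases fp w mw hwz.symm with h | h | h <;> grind
    have x6 : z ≠ q := by rintro rfl; rcases fq w mw hwz.symm with h | h | h <;> grind
    have y2 : z ≠ a := by rintro rfl; rcases fa w mw hwz.symm with h | h | h <;> grind
    have y3 : z ≠ a₁ := by rintro rfl; rcases fa1 w mw hwz.symm with h | h | h <;> grind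
    have y4 : z ≠ a₂ := by rintro rfl; rcases fa2 w mw hwz.symm with h | h | h <;> grind
    have y5 : z ≠ x := by rintro rfl; rcases fx w mw hwz.symm with h | h | h <;> grind
    have y6 : z ≠ y := by rintro rfl; rcases fy w mw hwz.symm with h | h | h <;> grind
    have hd := card_nb_sdiff_lt (W := W) (S := {b, v, a₁, u, a, b₁, p, b₂, q, x, a₂, y, v'}) mv
      (by simp) hvw.symm
    have hd3 := hG.deg w mw
    have hwR : w ∈ W \ {b, v, a₁, u, a, b₁, p, b₂, q, x, a₂, y, v'} := by
      simp only [Finset.mem_sdiff, Finset.mem_insert, Finset.mem_singleton]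
      grind
    have h := (ih.sdiff hG humem (S := {b, v, a₁, u, a, b₁, p, b₂, q, x, a₂, y, v'})
      (by simp)).weak w hwR (one_le_deg (a := z) (by simp [*]) hwz) (by omega)
    exact loc' h hG.deg ![u, a, b, b₁, b₂, p, q, v, a₁, a₂, x, y, v', w] [(0, 1), (0, 2), (2, 3),
      (2, 4), (3, 5), (3, 6), (4, 5), (4, 6), (5, 7), (6, 7), (1, 8), (1, 9), (8, 10), (8, 11),
      (9, 10), (9, 11), (10, 12), (11, 12), (7, 13)] ![2, 3, 3, 3, 3, 3, 3, 3, 3, 3, 3, 3, 3, 3]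
      [2, 7, 8] [(0, 1), (3, 5), (4, 6), (10, 9), (11, 12)] [13] [] 2
      (hE := by simp [*])
  · push Not at hout
    obtain ⟨z, hz, hwz, hzv⟩ := exists_nb_ne (hmin w mw) v
    obtain rfl := hout z hz hwz hzv
    have hdw : (nb G W w).card ≤ 2 := by
      refine (Finset.card_le_card (t := {v, z}) fun y hy => ?_).trans Finset.card_le_two
      have := mem_nb.1 hy
      have := hout y this.1 this.2
      simp; tauto
    have hzw := hwz.symm
    have h := (ih.sdiff hG humem (S := {b, v, z, w, u, a, b₁, p, b₂, q, x, a₁, y, a₂})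
      (by simp)).zero
    exact loc' h hG.deg ![u, a, b, b₁, b₂, p, q, v, a₁, a₂, x, y, z, w] [(0, 1), (0, 2), (2, 3),
      (2, 4), (3, 5), (3, 6), (4, 5), (4, 6), (5, 7), (6, 7), (1, 8), (1, 9), (8, 10), (8, 11),
      (9, 10), (9, 11), (10, 12), (11, 12), (7, 13), (12, 13)]
      ![2, 3, 3, 3, 3, 3, 3, 3, 3, 3, 3, 3, 3, 2]
      [2, 7] [(12, 13), (0, 1), (3, 5), (4, 6), (10, 8), (11, 9)] [] [] 0
      (hE := by simp [*]) (hδ := by simp [Fin.forall_fin_succ, hdu, hdw])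

/-- Deleting `u` together with the whole branch at `b` gains 1, which pays for covering `a` unless
`a` is a twin in what remains. In that case `a` was a twin in `W \ {u}` too, so it begins a branch
of its own and `two_branches` applies. -/
lemma twin_side (ih : IH W) (hG : Ok G W) {u a b : V} (hu : Deg2 G W u a b)
    (hno : ∀ x ∈ W, G.Adj a x → G.Adj b x → x = u) (hT : Twin G (W \ {u}) b) : Sol G W ∅ 0 := by
  obtain ⟨b₁, b₂, p, q, hT⟩ := hT.exists
  rcases twin_reduce ih hG hu hno hT with h | ⟨v, w, hB, nav, naw, na1, na2, nap, naq, haw⟩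
  · exact h
  have hu' := hu
  have hB' := hB
  obtain ⟨humem, hamem, hbmem, hua, hub, hnab, hneab, hdu, full, hmin⟩ := hu
  obtain ⟨mb1, mb2, mp, mq, mv, mw, hb1, hb2, h1p, h1q, h2p, h2q, hpv, hqv, hvw,
    ⟨nu1, nu2, nup, nuq, nuv, nuw⟩, n12, npq, ⟨nbp, nbq, nbv, nbw⟩, ⟨nv1, nv2⟩,
    ⟨nw1, nw2, nwp, nwq⟩, fb, fb1, fb2, fp, fq, fv⟩ := hB
  have haR : a ∈ W \ {u, q, b, b₁, p, b₂, v, w} := by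
    simp [*, hua.ne.symm]
  have hd := card_nb_sdiff_lt (W := W) (S := {u, q, b, b₁, p, b₂, v, w}) humem (by simp) hua.symm
  have hd3 := hG.deg a hamem
  obtain ⟨z, hz, haz, hzu, hzw⟩ : ∃ z ∈ W, G.Adj a z ∧ z ≠ u ∧ z ≠ w := by
    by_cases hda : (nb G W a).card ≤ 2
    · obtain ⟨z, hz, haz, hzu⟩ := exists_nb_ne (hmin a hamem) u
      exact ⟨z, hz, haz, hzu, by rintro rfl; exact haw ⟨hda, haz⟩⟩
    · obtain ⟨z, hz, haz, hzu, hzw⟩ := exists_nb_ne_ne (by omega : 3 ≤ (nb G W a).card) u w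
      exact ⟨z, hz, haz, hzu, hzw⟩
  have x2 : z ≠ b := by rintro rfl; rcases fb a hamem haz.symm with h | h | h <;> grind
  have x3 : z ≠ b₁ := by rintro rfl; rcases fb1 a hamem haz.symm with h | h | h <;> contradiction
  have x4 : z ≠ b₂ := by rintro rfl; rcases fb2 a hamem haz.symm with h | h | h <;> contradiction
  have x5 : z ≠ p := by rintro rfl; rcases fp a hamem haz.symm with h | h | h <;> contradiction
  have x6 : z ≠ q := by rintro rfl; rcases fq a hamem haz.symm with h | h | h <;> contradiction
  have x7 : z ≠ v := by rintro rfl; rcases fv a hamem haz.symm with h | h | h <;> contradiction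
  have hc := ih.sdiff hG humem (S := {u, q, b, b₁, p, b₂, v, w}) (by simp)
  by_cases hTa : Twin G (W \ {u, q, b, b₁, p, b₂, v, w}) a
  swap
  · have h := hc.cover a haR (one_le_deg (a := z) (by simp [*]) haz) (by omega) hTa
    exact loc' h hG.deg ![u, a, b, b₁, b₂, p, q, v, w] [(0, 1), (0, 2), (2, 3), (2, 4), (3, 5),
      (3, 6), (4, 5), (4, 6), (5, 7), (6, 7), (7, 8)] ![2, 3, 3, 3, 3, 3, 3, 3, 3] [0, 6]
      [(2, 3), (5, 4), (7, 8)] [1] [] 1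
  obtain ⟨a₁, a₂, x, y, hTa⟩ := hTa.exists
  have r1 := hTa.mem₁
  have r2 := hTa.mem₂
  have r3 := hTa.memp
  have r4 := hTa.memq
  simp only [Finset.mem_sdiff, Finset.mem_insert, Finset.mem_singleton, not_or] at r1 r2 r3 r4
  have hsub : W \ {u, q, b, b₁, p, b₂, v, w} ⊆ W \ {u} :=
    Finset.sdiff_subset_sdiff subset_rfl (by simp)
  have hdu1 := card_nb_sdiff_lt (W := W) (S := {u}) humem (by simp) hua.symm
  have hTa' := hTa.of_subset (hG.subset Finset.sdiff_subset).deg hsub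
    (by simp [hamem, hua.ne.symm]) (by omega)
  rcases twin_reduce ih hG hu'.symm (fun x hx h1 h2 => hno x hx h2 h1) hTa' with
    h | ⟨v', w', hA, mav, maw, ma1, ma2, map, maq, -⟩
  · exact h
  · refine two_branches ih hG hu' hB' hA ⟨nav, naw, na1, na2, nap, naq⟩
      ⟨mav, maw, ma1, ma2, map, maq⟩ ?_
    rintro z (rfl | rfl | rfl | rfl) <;> tauto

/-! ### Covering a neighbour of the vertex of degree two -/

lemma Deg2.cover (ih : IH W) (hG : Ok G W) {u a b z : V} {S : Finset V} (hu : Deg2 G W u a b)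
    (hTb : ¬ Twin G (W \ {u}) b) (huS : u ∈ S) (hbS : b ∉ S) (hz : z ∈ W) (hzS : z ∉ S)
    (hbz : G.Adj b z) : Sol G (W \ S) {b} (-1) := by
  have h1 := card_nb_sdiff_lt hu.memu huS hu.adjb.symm
  have h2 := card_nb_sdiff_lt (S := {u}) hu.memu (by simp) hu.adjb.symm
  have h3 := hG.deg b hu.memb
  exact (ih.sdiff hG hu.memu huS).cover b (by simp [hu.memb, hbS])
    (one_le_deg (a := z) (by simp [hz, hzS]) hbz) (by omega)
    (fun h => hTb (h.of_subset (hG.subset Finset.sdiff_subset).deg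
      (Finset.sdiff_subset_sdiff subset_rfl (by simpa using huS)) (by omega)))

lemma Deg2.weak (ih : IH W) (hG : Ok G W) {u a b z : V} {S : Finset V} (hu : Deg2 G W u a b)
    (huS : u ∈ S) (hbS : b ∉ S) (hz : z ∈ W) (hzS : z ∉ S)
    (hbz : G.Adj b z) : Sol G (W \ S) {b} (-2) := by
  have h1 := card_nb_sdiff_lt hu.memu huS hu.adjb.symm
  have h3 := hG.deg b hu.memb
  exact (ih.sdiff hG hu.memu huS).weak b (by simp [hu.memb, hbS])
    (one_le_deg (a := z) (by simp [hz, hzS]) hbz) (by omega)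

lemma triangle (ih : IH W) (hG : Ok G W) {u a b : V} (hu : u ∈ W) (ha : a ∈ W) (hb : b ∈ W)
    (hua : G.Adj u a) (hub : G.Adj u b) (hab : G.Adj a b) (hdu : (nb G W u).card ≤ 2) :
    Sol G W ∅ 0 := by
  have h := (ih.sdiff hG hu (S := {u, a, b}) (by simp)).zero
  exact loc' h hG.deg ![u, a, b] [(0, 1), (0, 2), (1, 2)] ![2, 3, 3] [0] [(1, 2)] [] [] 1

/-- Leaving `u` unmatched and matching `a c` gains 1 once one of `a`, `c` has degree at most two.
This pays for covering `b`, which is not a twin. -/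
lemma near_low (ih : IH W) (hG : Ok G W) {u a b c : V} (hu : Deg2 G W u a b)
    (hno : ∀ x ∈ W, G.Adj a x → G.Adj b x → x = u) (hTb : ¬ Twin G (W \ {u}) b) (hc : c ∈ W)
    (hac : G.Adj a c) (hcu : c ≠ u) (hd : (nb G W a).card ≤ 2 ∨ (nb G W c).card ≤ 2) :
    Sol G W ∅ 0 := by
  have hu' := hu
  obtain ⟨humem, ha, hb, hua, hub, hnab, hab, hdu, full, hmin⟩ := hu
  obtain ⟨z, hz, hbz, hzu⟩ := exists_nb_ne (hmin b hb) u
  have hza : z ≠ a := by rintro rfl; exact hnab hbz.symm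
  have hzc : z ≠ c := by rintro rfl; exact hcu (hno _ hc hac hbz)
  have hcb : c ≠ b := by rintro rfl; exact hnab hac
  have h := hu'.cover ih hG hTb (S := {u, a, c}) (by simp) (by simp [hab.symm, hub.ne.symm, hcb.symm])
    hz (by simp [*]) hbz
  rcases hd with hd | hd
  · exact loc' h hG.deg ![u, a, b, c] [(0, 1), (0, 2), (1, 3)] ![2, 2, 3, 3] [0] [(1, 3)] [2] [] 1
  · exact loc' h hG.deg ![u, a, b, c] [(0, 1), (0, 2), (1, 3)] ![2, 3, 3, 2] [0] [(1, 3)] [2] [] 1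

/-! ### The generic vertex of degree two -/

/-- The generic situation around a vertex `u` of degree two. -/
structure Gen (G : SimpleGraph V) (W : Finset V) (u a b a₁ a₂ : V) : Prop extends
    Deg2 G W u a b where
  mem₁ : a₁ ∈ W
  mem₂ : a₂ ∈ W
  adj₁ : G.Adj a a₁
  adj₂ : G.Adj a a₂
  ne₁₂ : a₁ ≠ a₂
  ne₁ : a₁ ≠ u
  ne₂ : a₂ ≠ u
  no : ∀ x ∈ W, G.Adj a x → G.Adj b x → x = u
  twin : ¬ Twin G (W \ {u}) b
  deg₁ : 3 ≤ (nb G W a₁).card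
  deg₂ : 3 ≤ (nb G W a₂).card
  degb : 3 ≤ (nb G W b).card
  fulla : ∀ x ∈ W, G.Adj a x → x = u ∨ x = a₁ ∨ x = a₂

/-- Suppressing `t a₁ a a₂` in `W \ {u}` and covering `b` in the new graph loses `1 + 1`, exactly
what the unmatched `u` gains. The move fails if the new edge creates an obstruction, or if it makes
`b` a twin. As `b` was not a twin before, the edge `t a₂` must then belong to the new `K₂,₃`, which
gives the vertices `s` and `q`. -/
lemma Gen.suppress (ih : IH W) (hG : Ok G W) {u a b a₁ a₂ t : V} (hu : Gen G W u a b a₁ a₂)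
    (ht : t ∈ W) (h1t : G.Adj a₁ t) (hta : t ≠ a) (hta₂ : t ≠ a₂) (hn : ¬ G.Adj t a₂) :
    Sol G W ∅ 0 ∨ (∃ U, Bad G (W \ {u}) a a₁ t a₂ U) ∨ ∃ s ∈ W, ∃ q ∈ W, G.Adj b t ∧ G.Adj b s ∧
      G.Adj s a₂ ∧ G.Adj t q ∧ G.Adj s q ∧ s ≠ t ∧ q ≠ a₂ ∧ q ≠ b ∧ q ≠ u ∧ q ≠ a ∧ q ≠ a₁ ∧
      s ≠ u ∧ s ≠ a ∧ s ≠ a₁ := by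
  obtain ⟨hu', m1, m2, h1, h2, n12, n1, n2, hno, hTb, hd1, hd2, hdb, fa⟩ := hu
  obtain ⟨humem, ha, hb, hua, hub, hnab, hab, hdu, full, hmin⟩ := id hu'
  have hG1 : Ok G (W \ {u}) := hG.subset Finset.sdiff_subset
  have b1 : a₁ ≠ b := by rintro rfl; exact hnab h1
  have b2 : a₂ ≠ b := by rintro rfl; exact hnab h2
  have htu : t ≠ u := by
    rintro rfl
    rcases full _ m1 h1t.symm with h | h
    · exact h1.ne h.symm
    · exact b1 h
  have hbt : b ≠ t := by rintro rfl; exact n1 (hno _ m1 h1 h1t.symm)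
  have hba₂ : ¬ G.Adj b a₂ := fun h => n2 (hno _ m2 h2 h)
  have hba₁ : ¬ G.Adj b a₁ := fun h => n1 (hno _ m1 h1 h)
  have ma : a ∈ W \ {u} := by simp [ha, hua.ne.symm]
  have mb : b ∈ W \ {u} := by simp [hb, hub.ne.symm]
  have ma₁ : a₁ ∈ W \ {u} := by simp [m1, n1]
  have ma₂ : a₂ ∈ W \ {u} := by simp [m2, n2]
  have mt : t ∈ W \ {u} := by simp [ht, htu]
  rcases ok_sup_edge_or_bad hG1.deg (fun U hU => hG1.degen U (hU.trans Finset.sdiff_subset)) ma ma₁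
    mt ma₂ h2 h1t hta n12.symm hta₂ hn with h | hU
  swap
  · exact Or.inr (Or.inl hU)
  have hcl := ih _ ((W \ {u}) \ {a, a₁}) ((sdiff_lt ma (by simp)).trans (sdiff_lt humem (by simp))) h
  have mb' : b ∈ (W \ {u}) \ {a, a₁} := by simp [mb, hab.symm, b1.symm]
  have hnb := nb_sup_edge_of_ne G (t := t) (o := a₂) ((W \ {u}) \ {a, a₁}) hbt b2.symm
  have hdb' : (nb G (W \ {u}) b).card ≤ 2 := by
    have := card_nb_sdiff_lt (S := {u}) humem (by simp) hub.symm
    have := hG.deg b hb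
    omega
  obtain ⟨z, hz, hbz, hzu⟩ := exists_nb_ne (hmin b hb) u
  have hza : z ≠ a := by rintro rfl; exact hnab hbz.symm
  have hza₁ : z ≠ a₁ := by rintro rfl; exact hba₁ hbz
  by_cases hT : Twin (G ⊔ SimpleGraph.edge t a₂) ((W \ {u}) \ {a, a₁}) b
  swap
  · left
    have h' := (hcl.cover b mb' (by rw [hnb]; exact one_le_deg (a := z) (by simp [*]) hbz)
      (by rw [hnb]; exact (card_nb_mono G Finset.sdiff_subset _).trans hdb') hT).suppress
      ma ma₁ mt ma₂ h1 h2 h1t hta n12.symm hta₂ hn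
    refine hu'.unmatched hG h' (by simp) (by simp) ?_
    have := hG1.deg a₁ ma₁
    have := card_nb_sdiff_lt (S := {u}) humem (by simp) hua.symm
    have := hG.deg a ha
    omega
  right; right
  have hT0 := hT
  obtain ⟨v₁, v₂, p, q, hT⟩ := hT.exists
  have hbv : ∀ v, (G ⊔ SimpleGraph.edge t a₂).Adj b v → G.Adj b v := by
    intro v
    simp only [SimpleGraph.sup_adj, SimpleGraph.edge_adj]
    grind
  have hg1 := hbv _ hT.adj₁
  have hg2 := hbv _ hT.adj₂
  have hv1 : v₁ ≠ a₂ := by rintro rfl; exact hba₂ hg1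
  have hv2 : v₂ ≠ a₂ := by rintro rfl; exact hba₂ hg2
  have hT' : ∃ s p q, TwinAt (G ⊔ SimpleGraph.edge t a₂) ((W \ {u}) \ {a, a₁}) b t s p q := by
    by_cases e1 : v₁ = t
    · subst e1; exact ⟨_, _, _, hT⟩
    by_cases e2 : v₂ = t
    · subst e2; exact ⟨_, _, _, hT.symm⟩
    -- If `t` is not a neighbour of `b` in the twin, no edge at `b`, `v₁` or `v₂` is new, so `b`
    -- would already be a twin in `W \ {u}`.
    exfalso
    refine hTb (Twin.of_subset (R := (W \ {u}) \ {a, a₁}) hG1.deg Finset.sdiff_subset hdb' ?_)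
    obtain ⟨_, _, mp, mq, n12', npq, nbp, nbq, g1, g2, g1p, g1q, g2p, g2q, d, f, f1, f2⟩ := hT
    have conv : ∀ v w, v ≠ t → v ≠ a₂ → ((G ⊔ SimpleGraph.edge t a₂).Adj v w ↔ G.Adj v w) := by
      intro v w h1 h2
      simp only [SimpleGraph.sup_adj, SimpleGraph.edge_adj]
      grind
    have c1 := fun w => conv v₁ w e1 hv1
    have c2 := fun w => conv v₂ w e2 hv2
    have c3 := fun w => conv b w hbt b2.symm
    simp only [c1, c2, c3] at g1 g2 g1p g1q g2p g2q f f1 f2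
    rw [hnb] at d
    exact TwinAt.twin (v₁ := v₁) (v₂ := v₂) (p := p) (q := q)
      (by constructor <;> assumption) mb'
  clear! v₁ v₂ p q
  obtain ⟨s, p, q, hT⟩ := hT'
  have ma₂' : a₂ ∈ (W \ {u}) \ {a, a₁} := by simp [ma₂, h2.ne.symm, n12.symm]
  have hT' : ∃ q, TwinAt (G ⊔ SimpleGraph.edge t a₂) ((W \ {u}) \ {a, a₁}) b t s a₂ q := by
    have := hT.full₁ a₂ ma₂' (by simp [SimpleGraph.edge_adj, hta₂])
    rcases this with h | rfl | rfl
    · exact (b2 h).elim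
    · exact ⟨q, hT⟩
    · exact ⟨p, hT.swap⟩
  clear! q p
  obtain ⟨q, _, ms, _, mq, nts, hqa₂, _, nbq, g1, g2, _, g1q, g2p, g2q, _, _, _, _⟩ := hT'
  have hsa₂ : s ≠ a₂ := g2p.ne
  simp only [Finset.mem_sdiff, SimpleGraph.sup_adj, SimpleGraph.edge_adj,
    Finset.mem_insert, Finset.mem_singleton, not_or] at ms mq g1 g2 g1q g2p g2q
  refine ⟨s, ms.1.1, q, mq.1.1, ?_, ?_, ?_, ?_, ?_, nts.symm, hqa₂.symm, nbq.symm, mq.1.2, mq.2.1,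
    mq.2.2, ms.1.2, ms.2.1, ms.2.2⟩
  all_goals grind

/-- The case of adjacent `a₁` and `a₂`. -/
lemma Gen.adjacent (ih : IH W) (hG : Ok G W) {u a b a₁ a₂ : V} (hu : Gen G W u a b a₁ a₂)
    (h12 : G.Adj a₁ a₂) : Sol G W ∅ 0 := by
  have hu0 := hu
  obtain ⟨hu', m1, m2, h1, h2, n12, n1, n2, hno, hTb, hd1, hd2, hdb, fa⟩ := hu
  obtain ⟨humem, ha, hb, hua, hub, hnab, hab, hdu, full, hmin⟩ := id hu'
  have b1 : a₁ ≠ b := by rintro rfl; exact hnab h1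
  have b2 : a₂ ≠ b := by rintro rfl; exact hnab h2
  have hba₂ : ¬ G.Adj b a₂ := fun h => n2 (hno _ m2 h2 h)
  have hba₁ : ¬ G.Adj b a₁ := fun h => n1 (hno _ m1 h1 h)
  have nau := hua.ne.symm
  have nbu := hub.ne.symm
  obtain ⟨y, my, h1y, hya, hya₂⟩ := exists_nb_ne_ne hd1 a a₂
  obtain ⟨y₂, my₂, h2y, hy₂a, hy₂a₁⟩ := exists_nb_ne_ne hd2 a a₁
  have f2 : ∀ x ∈ W, G.Adj a₂ x → x = a ∨ x = a₁ ∨ x = y₂ := fun x hx h =>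
    eq_of_deg_le_three (hG.deg _ m2) ha h2.symm m1 h12.symm my₂ h2y h1.ne hy₂a.symm hy₂a₁.symm hx h
  have hya₁ := h1y.ne.symm
  have hyb : y ≠ b := by rintro rfl; exact hba₁ h1y.symm
  have nu : ∀ x ∈ W, x ≠ a → x ≠ b → ¬ G.Adj x u := fun x hx hxa hxb h => by
    rcases full x hx h.symm with h | h <;> contradiction
  have hyu : y ≠ u := by rintro rfl; exact nu _ m1 h1.ne.symm b1 h1y
  by_cases hyy : y = y₂
  · subst hyy
    by_cases hdy : (nb G W y).card ≤ 2
    · obtain ⟨z, hz, hbz, hzu⟩ := exists_nb_ne (hmin b hb) u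
      have hza : z ≠ a := by rintro rfl; exact hnab hbz.symm
      have hza₁ : z ≠ a₁ := by rintro rfl; exact hba₁ hbz
      have hza₂ : z ≠ a₂ := by rintro rfl; exact hba₂ hbz
      have hzy : z ≠ y := by
        rintro rfl
        rcases eq_of_deg_le_two hdy m1 h1y.symm m2 h2y.symm n12 hb hbz.symm with h | h
        · exact b1 h.symm
        · exact b2 h.symm
      have h := hu'.cover ih hG hTb (S := {u, a, a₁, a₂, y}) (by simp) (by simp; grind) hz
        (by simp [*]) hbz
      exact loc' h hG.deg ![u, a, b, a₁, a₂, y] [(0, 1), (0, 2), (1, 3), (1, 4), (3, 4), (3, 5),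
        (4, 5)] ![2, 3, 3, 3, 3, 2] [0] [(1, 3), (4, 5)] [2] [] 1
    obtain ⟨y', my', hyy', hy1, hy2⟩ := exists_nb_ne_ne (by omega : 3 ≤ (nb G W y).card) a₁ a₂
    have fy : ∀ x ∈ W, G.Adj y x → x = a₁ ∨ x = a₂ ∨ x = y' := fun x hx h =>
      eq_of_deg_le_three (hG.deg _ my) m1 h1y.symm m2 h2y.symm my' hyy' n12 hy1.symm hy2.symm hx h
    have hy'u : y' ≠ u := by rintro rfl; exact nu _ my hya hyb hyy'
    have hy'a : y' ≠ a := by rintro rfl; rcases fa _ my hyy'.symm with h | h | h <;> contradiction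
    by_cases hy'b : y' = b
    · subst hy'b
      have h := (ih.sdiff hG humem (S := {u, a₂, a, a₁, y, y'}) (by simp)).zero
      exact loc' h hG.deg ![u, a, y', a₁, a₂, y] [(0, 1), (0, 2), (1, 3), (1, 4), (3, 4), (3, 5),
        (4, 5), (2, 5)] ![2, 3, 3, 3, 3, 3] [0, 4] [(1, 3), (5, 2)] [] [] 3
    obtain ⟨z, hz, hbz, hzu, hzy'⟩ := exists_nb_ne_ne hdb u y'
    have hza : z ≠ a := by rintro rfl; exact hnab hbz.symm
    have hza₁ : z ≠ a₁ := by rintro rfl; exact hba₁ hbz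
    have hza₂ : z ≠ a₂ := by rintro rfl; exact hba₂ hbz
    have hzy : z ≠ y := by
      rintro rfl
      rcases fy _ hb hbz.symm with h | h | h <;> grind
    have h := hu'.weak ih hG (S := {u, a₂, a, a₁, y, y'}) (by simp) (by simp; grind) hz
      (by simp [*]) hbz
    exact loc' h hG.deg ![u, a, b, a₁, a₂, y, y'] [(0, 1), (0, 2), (1, 3), (1, 4), (3, 4), (3, 5),
      (4, 5), (5, 6)] ![2, 3, 3, 3, 3, 3, 3] [0, 4] [(1, 3), (5, 6)] [2] [] 2
  have hya₂' : ¬ G.Adj y a₂ := fun h => by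
    rcases f2 _ my h.symm with h | h | h <;> contradiction
  rcases hu0.suppress ih hG my h1y hya hya₂ hya₂' with h | ⟨U, hU⟩ |
    ⟨s, ms, q, mq, hbt, hbs, hsa, htq, hsq, hst, hqa₂, hqb, hqu, hqa, hqa₁, hsu, hsa', hsa₁⟩
  · exact h
  -- With `a` and `a₁` on the suppressed path, `a₂` has at most the neighbour `y₂` in `U`, whereas
  -- an obstruction needs two.
  · have h1 : nb G U a₂ ⊆ {y₂} := by
      intro x hx
      rw [mem_nb] at hx
      have hxW := Finset.mem_sdiff.1 (hU.sub hx.1)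
      rcases f2 x hxW.1 hx.2 with rfl | rfl | rfl
      · exact (hU.notMem hx.1).elim
      · exact (hU.notMem₁ hx.1).elim
      · simp
    have := hU.two'.trans (Finset.card_le_card h1)
    simp at this
  · have h := (ih.sdiff hG humem (S := {a₁, s, u, b, a, a₂, y, q}) (by simp)).zero
    exact loc' h hG.deg ![u, a, b, a₁, a₂, y, s, q] [(0, 1), (0, 2), (1, 3), (1, 4), (3, 4), (3, 5),
      (4, 6), (2, 5), (2, 6), (5, 7), (6, 7)] ![2, 3, 3, 3, 3, 3, 3, 3] [3, 6]
      [(0, 2), (1, 4), (5, 7)] [] [] 2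

set_option maxHeartbeats 1000000 in
set_option maxRecDepth 20000 in
/-- Two linked paths around `u`: `a₁ a₂` have the common neighbour `x`, and the neighbours `y s` of
`b` have the common neighbour `q`. -/
lemma Gen.linked (ih : IH W) (hG : Ok G W) {u a b a₁ a₂ x y s q : V} (hu : Gen G W u a b a₁ a₂)
    (mx : x ∈ W) (my : y ∈ W) (ms : s ∈ W) (mq : q ∈ W) (h12 : ¬ G.Adj a₁ a₂)
    (h1x : G.Adj a₁ x) (h2x : G.Adj a₂ x) (h1y : G.Adj a₁ y) (h2s : G.Adj a₂ s) (hby : G.Adj b y)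
    (hbs : G.Adj b s) (hyq : G.Adj y q) (hsq : G.Adj s q) (hsy : s ≠ y) (hqb : q ≠ b) (hqa : q ≠ a)
    (hqu : q ≠ u) (hqa₁ : q ≠ a₁) (hqa₂ : q ≠ a₂) (hya : y ≠ a) (hsa : s ≠ a) (hxy : x ≠ y)
    (hxa : x ≠ a) (hya₂ : y ≠ a₂) (hsa₁ : s ≠ a₁) (hsu : s ≠ u) (hn : ¬ G.Adj y a₂) :
    Sol G W ∅ 0 := by
  obtain ⟨hu', m1, m2, h1, h2, n12, n1, n2, hno, hTb, hd1, hd2, hdb, fa⟩ := hu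
  obtain ⟨humem, ha, hb, hua, hub, hnab, hab, hdu, full, hmin⟩ := id hu'
  have b1 : a₁ ≠ b := by rintro rfl; exact hnab h1
  have b2 : a₂ ≠ b := by rintro rfl; exact hnab h2
  have hba₁ : ¬ G.Adj b a₁ := fun h => n1 (hno _ m1 h1 h)
  have hba₂ : ¬ G.Adj b a₂ := fun h => n2 (hno _ m2 h2 h)
  have nau := hua.ne.symm
  have nbu := hub.ne.symm
  have nu : ∀ x ∈ W, x ≠ a → x ≠ b → ¬ G.Adj x u := fun x hx hxa hxb h => by
    rcases full x hx h.symm with h | h <;> contradiction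
  have hyu : y ≠ u := by rintro rfl; exact nu _ m1 h1.ne.symm b1 h1y
  have hxu : x ≠ u := by rintro rfl; exact nu _ m1 h1.ne.symm b1 h1x
  have hxb : x ≠ b := by rintro rfl; exact hba₁ h1x.symm
  have hxa₁ := h1x.ne.symm
  have hxa₂ := h2x.ne.symm
  have hya₁ := h1y.ne.symm
  have hsa₂ := h2s.ne.symm
  have hyb := hby.ne.symm
  have hsb := hbs.ne.symm
  have hqy := hyq.ne.symm
  have hqs := hsq.ne.symm
  have fy : ∀ z ∈ W, G.Adj y z → z = a₁ ∨ z = b ∨ z = q := fun z hz h =>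
    eq_of_deg_le_three (hG.deg _ my) m1 h1y.symm hb hby.symm mq hyq b1 hqa₁.symm hqb.symm hz h
  have fs : ∀ z ∈ W, G.Adj s z → z = a₂ ∨ z = b ∨ z = q := fun z hz h =>
    eq_of_deg_le_three (hG.deg _ ms) m2 h2s.symm hb hbs.symm mq hsq b2 hqa₂.symm hqb.symm hz h
  have hxs : x ≠ s := by
    rintro rfl; rcases fs _ m1 h1x.symm with h | h | h <;> grind
  have hxq : x ≠ q := by
    rintro rfl
    rcases eq_of_deg_le_three (hG.deg _ mx) m1 h1x.symm m2 h2x.symm my hyq.symm n12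
      hya₁.symm hya₂.symm ms hsq.symm with h | h | h <;> contradiction
  have fa₁ : ∀ z ∈ W, G.Adj a₁ z → z = a ∨ z = x ∨ z = y := fun z hz h =>
    eq_of_deg_le_three (hG.deg _ m1) ha h1.symm mx h1x my h1y hxa.symm hya.symm hxy hz h
  have fa₂ : ∀ z ∈ W, G.Adj a₂ z → z = a ∨ z = x ∨ z = s := fun z hz h =>
    eq_of_deg_le_three (hG.deg _ m2) ha h2.symm mx h2x ms h2s hxa.symm hsa.symm hxs hz h
  have fb : ∀ z ∈ W, G.Adj b z → z = u ∨ z = y ∨ z = s := fun z hz h =>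
    eq_of_deg_le_three (hG.deg _ hb) humem hub.symm my hby ms hbs hyu.symm hsu.symm hsy.symm hz h
  by_cases hadj : G.Adj x q
  · have h := (ih.sdiff hG humem (S := {u, a₁, s, a, a₂, b, y, x, q}) (by simp)).zero
    exact loc' h hG.deg ![u, a, b, a₁, a₂, y, s, x, q] [(0, 1), (0, 2), (1, 3), (1, 4), (3, 7),
      (4, 7), (3, 5), (4, 6), (2, 5), (2, 6), (5, 8), (6, 8), (7, 8)] ![2, 3, 3, 3, 3, 3, 3, 3, 3]
      [0, 3, 6] [(1, 4), (2, 5), (7, 8)] [] [] 5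
  -- the outer neighbours of `x` and `q` are outside the configuration
  have outx : ∀ z ∈ W, G.Adj x z → z ≠ a₁ → z ≠ a₂ → z ≠ u ∧ z ≠ a ∧ z ≠ b ∧ z ≠ y ∧ z ≠ s ∧
      z ≠ q ∧ z ≠ x := by
    intro z hz hxz hz1 hz2
    refine ⟨?_, ?_, ?_, ?_, ?_, ?_, ?_⟩ <;> rintro rfl
    · exact nu _ mx hxa hxb hxz
    · rcases fa _ mx hxz.symm with h | h | h <;> contradiction
    · rcases fb _ mx hxz.symm with h | h | h <;> contradiction
    · rcases fy _ mx hxz.symm with h | h | h <;> contradiction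
    · rcases fs _ mx hxz.symm with h | h | h <;> contradiction
    · contradiction
    · exact hxz.ne rfl
  have outq : ∀ z ∈ W, G.Adj q z → z ≠ y → z ≠ s → z ≠ u ∧ z ≠ a ∧ z ≠ b ∧ z ≠ a₁ ∧ z ≠ a₂ ∧
      z ≠ q ∧ z ≠ x := by
    intro z hz hqz hz1 hz2
    refine ⟨?_, ?_, ?_, ?_, ?_, ?_, ?_⟩ <;> rintro rfl
    · exact nu _ mq hqa hqb hqz
    · rcases fa _ mq hqz.symm with h | h | h <;> contradiction
    · rcases fb _ mq hqz.symm with h | h | h <;> contradiction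
    · rcases fa₁ _ mq hqz.symm with h | h | h <;> grind
    · rcases fa₂ _ mq hqz.symm with h | h | h <;> grind
    · exact hqz.ne rfl
    · exact hadj hqz.symm
  -- The set `{x, b, q}` can stay unmatched if the third neighbours of `x` and `q` are covered.
  -- `weak` covers one vertex only, so when both `x` and `q` have degree three, `u` and `s` stay
  -- unmatched instead, together with `a₁` if the two third neighbours differ.
  by_cases hdx : (nb G W x).card ≤ 2
  · by_cases hdq : (nb G W q).card ≤ 2
    · have h := (ih.sdiff hG humem (S := {x, b, q, u, a, a₁, y, a₂, s}) (by simp)).zero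
      exact loc' h hG.deg ![u, a, b, a₁, a₂, y, s, x, q] [(0, 1), (0, 2), (1, 3), (1, 4), (3, 7),
        (4, 7), (3, 5), (4, 6), (2, 5), (2, 6), (5, 8), (6, 8)] ![2, 3, 3, 3, 3, 3, 3, 2, 2]
        [7, 2, 8] [(0, 1), (3, 5), (4, 6)] [] [] 6
    obtain ⟨d, md, hqd, hdy, hds⟩ := exists_nb_ne_ne (by omega : 3 ≤ (nb G W q).card) y s
    obtain ⟨d1, d2, d3, d4, d5, d6, d7⟩ := outq d md hqd hdy hds
    obtain ⟨z, mz, hdz, hzq⟩ := exists_nb_ne (hmin d md) q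
    have hzx : z ≠ x := by
      rintro rfl
      rcases eq_of_deg_le_two hdx m1 h1x.symm m2 h2x.symm n12 md hdz.symm with h | h <;>
      contradiction
    have z1 : z ≠ u := by rintro rfl; exact nu _ md d2 d3 hdz
    have z2 : z ≠ a := by rintro rfl; rcases fa _ md hdz.symm with h | h | h <;> contradiction
    have z3 : z ≠ b := by rintro rfl; rcases fb _ md hdz.symm with h | h | h <;> contradiction
    have z4 : z ≠ a₁ := by rintro rfl; rcases fa₁ _ md hdz.symm with h | h | h <;> contradiction
    have z5 : z ≠ a₂ := by rintro rfl; rcases fa₂ _ md hdz.symm with h | h | h <;> contradiction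
    have z6 : z ≠ y := by rintro rfl; rcases fy _ md hdz.symm with h | h | h <;> contradiction
    have z7 : z ≠ s := by rintro rfl; rcases fs _ md hdz.symm with h | h | h <;> contradiction
    have hd := card_nb_sdiff_lt (W := W) (S := {x, b, q, u, a, a₁, y, a₂, s}) mq (by simp) hqd.symm
    have hd3 := hG.deg d md
    have h := (ih.sdiff hG humem (S := {x, b, q, u, a, a₁, y, a₂, s}) (by simp)).weak d
      (by simp [*]) (one_le_deg (a := z) (by simp [*]) hdz) (by omega)
    exact loc' h hG.deg ![u, a, b, a₁, a₂, y, s, x, q, d] [(0, 1), (0, 2), (1, 3), (1, 4), (3, 7),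
        (4, 7), (3, 5), (4, 6), (2, 5), (2, 6), (5, 8), (6, 8), (8, 9)]
        ![2, 3, 3, 3, 3, 3, 3, 2, 3, 3] [7, 2, 8] [(0, 1), (3, 5), (4, 6)] [9] [] 5
  obtain ⟨c, mc, hxc, hc1, hc2⟩ := exists_nb_ne_ne (by omega : 3 ≤ (nb G W x).card) a₁ a₂
  obtain ⟨c3, c4, c5, c6, c7, c8, c9⟩ := outx c mc hxc hc1 hc2
  by_cases hdq : (nb G W q).card ≤ 2
  · obtain ⟨z, mz, hcz, hzx⟩ := exists_nb_ne (hmin c mc) x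
    have hzq : z ≠ q := by
      rintro rfl
      rcases eq_of_deg_le_two hdq my hyq.symm ms hsq.symm hsy.symm mc hcz.symm with h | h <;>
      contradiction
    have z1 : z ≠ u := by rintro rfl; exact nu _ mc c4 c5 hcz
    have z2 : z ≠ a := by rintro rfl; rcases fa _ mc hcz.symm with h | h | h <;> contradiction
    have z3 : z ≠ b := by rintro rfl; rcases fb _ mc hcz.symm with h | h | h <;> contradiction
    have z4 : z ≠ a₁ := by rintro rfl; rcases fa₁ _ mc hcz.symm with h | h | h <;> contradiction
    have z5 : z ≠ a₂ := by rintro rfl; rcases fa₂ _ mc hcz.symm with h | h | h <;> contradiction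
    have z6 : z ≠ y := by rintro rfl; rcases fy _ mc hcz.symm with h | h | h <;> contradiction
    have z7 : z ≠ s := by rintro rfl; rcases fs _ mc hcz.symm with h | h | h <;> contradiction
    have hd := card_nb_sdiff_lt (W := W) (S := {x, b, q, u, a, a₁, y, a₂, s}) mx (by simp) hxc.symm
    have hd3 := hG.deg c mc
    have h := (ih.sdiff hG humem (S := {x, b, q, u, a, a₁, y, a₂, s}) (by simp)).weak c
      (by simp [*]) (one_le_deg (a := z) (by simp [*]) hcz) (by omega)
    exact loc' h hG.deg ![u, a, b, a₁, a₂, y, s, x, q, c] [(0, 1), (0, 2), (1, 3), (1, 4), (3, 7),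
        (4, 7), (3, 5), (4, 6), (2, 5), (2, 6), (5, 8), (6, 8), (7, 9)]
        ![2, 3, 3, 3, 3, 3, 3, 3, 2, 3] [7, 2, 8] [(0, 1), (3, 5), (4, 6)] [9] [] 5
  obtain ⟨d, md, hqd, hdy, hds⟩ := exists_nb_ne_ne (by omega : 3 ≤ (nb G W q).card) y s
  obtain ⟨d1, d2, d3, d4, d5, d6, d7⟩ := outq d md hqd hdy hds
  by_cases hcd : c = d
  · subst hcd
    have h := (ih.sdiff hG humem (S := {u, s, b, y, q, c, x, a₁, a, a₂}) (by simp)).zero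
    exact loc' h hG.deg ![u, a, b, a₁, a₂, y, s, x, q, c] [(0, 1), (0, 2), (1, 3), (1, 4), (3, 7),
        (4, 7), (3, 5), (4, 6), (2, 5), (2, 6), (5, 8), (6, 8), (7, 9), (8, 9)]
        ![2, 3, 3, 3, 3, 3, 3, 3, 3, 3] [0, 6] [(2, 5), (8, 9), (7, 3), (1, 4)] [] [] 1
  · have h := (ih.sdiff hG humem (S := {u, a₁, s, a, a₂, b, y, x, c, q, d}) (by simp)).zero
    exact loc' h hG.deg ![u, a, b, a₁, a₂, y, s, x, q, c, d] [(0, 1), (0, 2), (1, 3), (1, 4),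
        (3, 7), (4, 7), (3, 5), (4, 6), (2, 5), (2, 6), (5, 8), (6, 8), (7, 9), (8, 10)]
        ![2, 3, 3, 3, 3, 3, 3, 3, 3, 3, 3] [0, 3, 6] [(1, 4), (2, 5), (7, 9), (8, 10)] [] [] 2
        (hc := by decide)

/-- The vertices `a₁` and `a₂` have a second common neighbour `x`. -/
lemma Gen.common (ih : IH W) (hG : Ok G W) {u a b a₁ a₂ x y : V} (hu : Gen G W u a b a₁ a₂)
    (mx : x ∈ W) (my : y ∈ W) (h12 : ¬ G.Adj a₁ a₂) (h1x : G.Adj a₁ x) (h2x : G.Adj a₂ x)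
    (h1y : G.Adj a₁ y) (hxa : x ≠ a) (hya : y ≠ a) (hxy : x ≠ y) (h2y : ¬ G.Adj a₂ y) :
    Sol G W ∅ 0 := by
  have hya₂ : y ≠ a₂ := by rintro rfl; exact h12 h1y
  have n1 := hu.ne₁
  have n2 := hu.ne₂
  have hua := hu.adja.ne
  have h1a := hu.adj₁.ne
  rcases hu.suppress ih hG my h1y hya hya₂ (fun h => h2y h.symm) with h | ⟨U, hU⟩ |
    ⟨s, ms, q, mq, hbt, hbs, hsa, htq, hsq, hst, hqa₂, hqb, hqu, hqa, hqa₁, hsu, hsa', hsa₁⟩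
  · exact h
  · have hxu : x ≠ u := by
      rintro rfl
      rcases hu.full _ hu.mem₁ h1x.symm with h | h
      · exact h1a h.symm
      · exact hu.nab (h ▸ hu.adj₁)
    -- The common neighbour `x` is drawn into `U` through `a₂`, yet it is adjacent to `a₁` outside
    -- `U`.
    have hxU : x ∈ U := hU.closed a₂ hU.right x (by simp [mx, hxu]) h2x hxa h1x.ne.symm
    exact (hU.not_adj (hG.subset Finset.sdiff_subset).deg hxU hxy h2x.ne.symm
      (by simp [hu.mem₁, n1]) hU.notMem₁ h1x.symm).elim
  · exact hu.linked ih hG mx my ms mq h12 h1x h2x h1y hsa.symm hbt hbs htq hsq hst hqb hqa hqu hqa₁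
      hqa₂ hya hsa' hxy hxa hya₂ hsa₁ hsu (fun h => h2y h.symm)

/-- One of the suppressions at `a₁` is possible. -/
lemma Gen.or_bad (ih : IH W) (hG : Ok G W) {u a b a₁ a₂ x y : V} (hu : Gen G W u a b a₁ a₂)
    (mx : x ∈ W) (my : y ∈ W) (h12 : ¬ G.Adj a₁ a₂) (h1x : G.Adj a₁ x) (h1y : G.Adj a₁ y)
    (hxa : x ≠ a) (hya : y ≠ a) (hxy : x ≠ y) (h2x : ¬ G.Adj a₂ x) (h2y : ¬ G.Adj a₂ y) :
    Sol G W ∅ 0 ∨ ∃ U, Bad G (W \ {u}) a a₁ x a₂ U := by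
  have hya₂ : y ≠ a₂ := by rintro rfl; exact h12 h1y
  have hxa₂ : x ≠ a₂ := by rintro rfl; exact h12 h1x
  rcases hu.suppress ih hG mx h1x hxa hxa₂ (fun h => h2x h.symm) with h | h |
    ⟨s, ms, q, mq, hbx, hbs, hsa, htq, hsq, hsx, hqa₂, hqb, hqu, hqa, hqa₁, hsu, hsa', hsa₁⟩
  · exact Or.inl h
  · exact Or.inr h
  left
  have hbu := hu.adjb.ne
  have hxu : x ≠ u := by
    rintro rfl
    rcases hu.full _ hu.mem₁ h1x.symm with h | h
    · exact hu.adj₁.ne h.symm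
    · exact hu.nab (h ▸ hu.adj₁)
  have hsy : s ≠ y := by rintro rfl; exact h2y hsa.symm
  have hyu : y ≠ u := by
    rintro rfl
    rcases hu.full _ hu.mem₁ h1y.symm with h | h
    · exact hu.adj₁.ne h.symm
    · exact hu.nab (h ▸ hu.adj₁)
  -- The neighbours of `b` are `u`, `x` and `s`, so the twin outcome cannot occur for `y` as well.
  have hyb : ¬ G.Adj b y := by
    intro h
    rcases eq_of_deg_le_three (hG.deg b hu.memb) hu.memu hu.adjb.symm mx hbx ms hbs hxu.symm
      hsu.symm hsx.symm my h with h | h | h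
    · exact hyu h
    · exact hxy h.symm
    · exact hsy h.symm
  rcases hu.suppress ih hG my h1y hya hya₂ (fun h => h2y h.symm) with h | ⟨U, hU⟩ |
    ⟨_, _, _, _, h, _⟩
  · exact h
  · have hba₁ : b ≠ a₁ := by rintro rfl; exact hu.nab hu.adj₁
    have hsU : s ∈ U := hU.closed a₂ hU.right s (by simp [ms, hsu]) hsa.symm hsa' hsa₁
    -- An obstruction for `y` would contain `s` and hence `b`, but `b` has degree at most two once
    -- `u` is deleted.
    have hbU : b ∈ U := hU.closed s hsU b (by simp [hu.memb, hbu.symm]) hbs.symm hu.ne.symm hba₁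
    have hby : b ≠ y := by rintro rfl; exact hu.ne₁ (hu.no _ hu.mem₁ hu.adj₁ h1y.symm)
    have hba₂ : b ≠ a₂ := by rintro rfl; exact hu.nab hu.adj₂
    have h3 := hU.three b hbU hby hba₂
    have h4 := card_nb_mono G hU.sub b
    have h5 := card_nb_sdiff_lt (S := {u}) hu.memu (by simp) hu.adjb.symm
    have h6 := hG.deg b hu.memb
    omega
  · exact (hyb h).elim

/-- Both suppressions at `a₁` are impossible. -/
lemma Gen.both_bad (ih : IH W) (hG : Ok G W) {u a b a₁ a₂ x y : V} (hu : Gen G W u a b a₁ a₂)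
    (hTa : ¬ Twin G (W \ {u}) a) (mx : x ∈ W) (my : y ∈ W) (h1x : G.Adj a₁ x) (h1y : G.Adj a₁ y)
    (hxa : x ≠ a) (hya : y ≠ a) (hxy : x ≠ y) {U U' : Finset V}
    (hU : Bad G (W \ {u}) a a₁ x a₂ U) (hU' : Bad G (W \ {u}) a a₁ y a₂ U') : Sol G W ∅ 0 := by
  have hb : ∀ (z : V) (T : Finset V), G.Adj a₁ z → Bad G (W \ {u}) a a₁ z a₂ T → b ∉ T := by
    intro z T h1z hT hbT
    have hbz : b ≠ z := by rintro rfl; exact hu.ne₁ (hu.no _ hu.mem₁ hu.adj₁ h1z.symm)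
    have hba₂ : b ≠ a₂ := by rintro rfl; exact hu.nab hu.adj₂
    have h3 := hT.three b hbT hbz hba₂
    have h4 := card_nb_mono G hT.sub b
    have h5 := card_nb_sdiff_lt (S := {u}) hu.memu (by simp) hu.adjb.symm
    have h6 := hG.deg b hu.memb
    omega
  have hbU := hb x U h1x hU
  have hbU' := hb y U' h1y hU'
  have hba₁ : b ≠ a₁ := by rintro rfl; exact hu.nab hu.adj₁
  -- This set is closed under adjacency in `W \ {u}` and misses `b`, so `u` separates `a` from `b`.
  -- The two can then be covered independently at a loss of 1 each.
  set A := U ∪ U' ∪ {a, a₁} with hA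
  have mA : ∀ z, z ∈ A ↔ z ∈ U ∨ z ∈ U' ∨ z = a ∨ z = a₁ := by
    intro z; simp [hA]; tauto
  have hAW : A ⊆ W \ {u} := by
    intro z hz
    rcases (mA z).1 hz with h | h | rfl | rfl
    · exact hU.sub h
    · exact hU'.sub h
    · simp [hu.mema, hu.adja.ne.symm]
    · simp [hu.mem₁, hu.ne₁]
  have hbA : b ∉ A := by
    rw [mA]; have := hu.ne.symm; tauto
  have hcl : ∀ s ∈ A, ∀ z ∈ W \ {u}, G.Adj s z → z ∈ A := by
    intro s hs z hz hsz
    rw [mA]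
    have hz' := hz
    simp only [Finset.mem_sdiff, Finset.mem_singleton] at hz
    rcases (mA s).1 hs with h | h | rfl | rfl
    · by_contra! hne
      exact hne.1 (hU.closed s h z hz' hsz hne.2.2.1 hne.2.2.2)
    · by_contra! hne
      exact hne.2.1 (hU'.closed s h z hz' hsz hne.2.2.1 hne.2.2.2)
    · rcases hu.fulla z hz.1 hsz with h | h | rfl
      · exact (hz.2 h).elim
      · simp [h]
      · exact Or.inl hU.right
    · rcases eq_of_deg_le_three (hG.deg _ hu.mem₁) hu.mema hu.adj₁.symm mx h1x my h1y hxa.symm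
        hya.symm hxy hz.1 hsz with rfl | rfl | rfl
      · simp
      · exact Or.inl hU.left
      · exact Or.inr (Or.inl hU'.left)
  have maA : a ∈ A := by simp [hA]
  have hG1 : Ok G (W \ {u}) := hG.subset Finset.sdiff_subset
  have hlt : A.card < W.card := (Finset.card_le_card hAW).trans_lt (sdiff_lt hu.memu (by simp))
  have hda : (nb G (W \ {u}) a).card ≤ 2 := by
    have h5 := card_nb_sdiff_lt (S := {u}) hu.memu (by simp) hu.adja.symm
    have h6 := hG.deg a hu.mema
    omega
  have hdb : (nb G (W \ {u}) b).card ≤ 2 := by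
    have h5 := card_nb_sdiff_lt (S := {u}) hu.memu (by simp) hu.adjb.symm
    have h6 := hG.deg b hu.memb
    omega
  have h1 := (ih G A hlt (hG1.subset hAW)).cover a maA
    (one_le_deg (a := a₁) (by simp [hA]) hu.adj₁) ((card_nb_mono G hAW a).trans hda)
    (fun h => hTa (h.of_subset hG1.deg hAW hda))
  have hsub : (W \ {u}) \ A ⊆ W \ {u} := Finset.sdiff_subset
  have mbW : b ∈ W \ {u} := by simp [hu.memb, hu.adjb.ne.symm]
  have mb : b ∈ (W \ {u}) \ A := Finset.mem_sdiff.2 ⟨mbW, hbA⟩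
  obtain ⟨z, mz, hbz, hzu⟩ := exists_nb_ne (hu.min b hu.memb) u
  have h2 := (ih G ((W \ {u}) \ A) ((Finset.card_le_card hsub).trans_lt
    (sdiff_lt hu.memu (by simp))) (hG1.subset hsub)).cover b mb
    (one_le_deg (a := z) (Finset.mem_sdiff.2 ⟨by simp [mz, hzu], fun h =>
      hbA (hcl z h b mbW hbz.symm)⟩) hbz) ((card_nb_mono G hsub b).trans hdb)
    (fun h => hu.twin (h.of_subset hG1.deg hsub hdb))
  have h3 : Sol G (W \ {u}) {a, b} (-1 + -1) := by
    refine (h1.enlarge ?_).of_closed (h2.enlarge ?_) hAW hcl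
    · intro z hz hzA
      simp only [Finset.mem_insert, Finset.mem_singleton] at hz ⊢
      rcases hz with rfl | rfl
      · rfl
      · exact (hbA hzA).elim
    · intro z hz hzA
      simp only [Finset.mem_insert, Finset.mem_singleton] at hz ⊢
      rcases hz with rfl | rfl
      · exact ((Finset.mem_sdiff.1 hzA).2 maA).elim
      · rfl
  exact hu.toDeg2.unmatched hG h3 (by simp) (by simp) (by norm_num)

/-- The cases follow how many of the further neighbours `x`, `y` of `a₁` are adjacent to `a₂`: both
would make `a` a twin, one is `Gen.common`, and with none either a suppression succeeds or both are
obstructed. -/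
lemma Gen.zero (ih : IH W) (hG : Ok G W) {u a b a₁ a₂ : V} (hu : Gen G W u a b a₁ a₂)
    (hTa : ¬ Twin G (W \ {u}) a) : Sol G W ∅ 0 := by
  by_cases h12 : G.Adj a₁ a₂
  · exact hu.adjacent ih hG h12
  obtain ⟨x, mx, h1x, hxa⟩ := exists_nb_ne ((by norm_num : 2 ≤ 3).trans hu.deg₁) a
  obtain ⟨y, my, h1y, hya, hyx⟩ := exists_nb_ne_ne hu.deg₁ a x
  by_cases h2x : G.Adj a₂ x
  · by_cases h2y : G.Adj a₂ y
    · exfalso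
      have nu : ∀ z ∈ W, z ≠ a → z ≠ b → ¬ G.Adj z u := fun z hz hza hzb h => by
        rcases hu.full z hz h.symm with h | h <;> contradiction
      have b1 : a₁ ≠ b := by rintro rfl; exact hu.nab hu.adj₁
      have hxu : x ≠ u := by rintro rfl; exact nu _ hu.mem₁ hu.adj₁.ne.symm b1 h1x
      have hyu : y ≠ u := by rintro rfl; exact nu _ hu.mem₁ hu.adj₁.ne.symm b1 h1y
      refine hTa (TwinAt.twin (v₁ := a₁) (v₂ := a₂) (p := x) (q := y) ?_
        (by simp [hu.mema, hu.adja.ne.symm]))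
      have m1 : a₁ ∈ W \ {u} := by simp [hu.mem₁, hu.ne₁]
      have m2 : a₂ ∈ W \ {u} := by simp [hu.mem₂, hu.ne₂]
      have hda : (nb G (W \ {u}) a).card ≤ 2 := by
        have h5 := card_nb_sdiff_lt (S := {u}) hu.memu (by simp) hu.adja.symm
        have h6 := hG.deg a hu.mema
        omega
      refine ⟨m1, m2, by simp [mx, hxu], by simp [my, hyu], hu.ne₁₂, hyx.symm, hxa.symm, hya.symm,
        hu.adj₁, hu.adj₂, h1x, h1y, h2x, h2y, ?_, ?_, ?_, ?_⟩
      · exact le_antisymm hda (two_le_deg m1 hu.adj₁ m2 hu.adj₂ hu.ne₁₂)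
      · exact fun z hz h => eq_of_deg_le_two hda m1 hu.adj₁ m2 hu.adj₂ hu.ne₁₂ hz h
      · exact fun z hz h => eq_of_deg_le_three (hG.deg _ hu.mem₁) hu.mema hu.adj₁.symm mx h1x my
          h1y hxa.symm hya.symm hyx.symm (Finset.mem_sdiff.1 hz).1 h
      · exact fun z hz h => eq_of_deg_le_three (hG.deg _ hu.mem₂) hu.mema hu.adj₂.symm mx h2x my
          h2y hxa.symm hya.symm hyx.symm (Finset.mem_sdiff.1 hz).1 h
    · exact hu.common ih hG mx my h12 h1x h2x h1y hxa hya hyx.symm h2y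
  · by_cases h2y : G.Adj a₂ y
    · exact hu.common ih hG my mx h12 h1y h2y h1x hya hxa hyx h2x
    · rcases hu.or_bad ih hG mx my h12 h1x h1y hxa hya hyx.symm h2x h2y with h | ⟨U, hU⟩
      · exact h
      rcases hu.or_bad ih hG my mx h12 h1y h1x hya hxa hyx h2y h2x with h | ⟨U', hU'⟩
      · exact h
      exact hu.both_bad ih hG hTa mx my h1x h1y hxa hya hyx.symm hU hU'

/-! ### The claim `zero` and the induction -/

lemma zero_claim (ih : IH W) (hG : Ok G W) : Sol G W ∅ 0 := by
  rcases W.eq_empty_or_nonempty with rfl | hne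
  · exact Sol.empty G ∅
  by_cases hmin : ∀ x ∈ W, 2 ≤ (nb G W x).card
  swap
  · push Not at hmin
    obtain ⟨x, hx, hdx⟩ := hmin
    exact (leaf_claim ih hG hx (by omega)).mono subset_rfl (by norm_num)
  obtain ⟨u, hu, hdu⟩ := hG.degen W subset_rfl hne
  obtain ⟨a, ha, hua⟩ := exists_nb ((by norm_num : 1 ≤ 2).trans (hmin u hu))
  obtain ⟨b, hb, hub, hba⟩ := exists_nb_ne (hmin u hu) a
  by_cases hab : G.Adj a b
  · exact triangle ih hG hu ha hb hua hub hab hdu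
  have hu' : Deg2 G W u a b := ⟨hu, ha, hb, hua, hub, hab, hba.symm, hdu,
    fun x hx h => eq_of_deg_le_two hdu ha hua hb hub hba.symm hx h, hmin⟩
  by_cases hno : ∀ x ∈ W, G.Adj a x → G.Adj b x → x = u
  swap
  · push Not at hno
    obtain ⟨c, hc, hac, hbc, hcu⟩ := hno
    exact four_cycle ih hG hu' hc hac hbc hcu
  have hno' : ∀ x ∈ W, G.Adj b x → G.Adj a x → x = u := fun x hx h1 h2 => hno x hx h2 h1
  by_cases hTb : Twin G (W \ {u}) b
  · exact twin_side ih hG hu' hno hTb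
  by_cases hTa : Twin G (W \ {u}) a
  · exact twin_side ih hG hu'.symm hno' hTa
  obtain ⟨a₁, m1, h1, n1⟩ := exists_nb_ne (hmin a ha) u
  obtain ⟨b₁, mb1, hb1, nb1⟩ := exists_nb_ne (hmin b hb) u
  by_cases hda : (nb G W a).card ≤ 2
  · exact near_low ih hG hu' hno hTb m1 h1 n1 (Or.inl hda)
  by_cases hdb : (nb G W b).card ≤ 2
  · exact near_low ih hG hu'.symm hno' hTa mb1 hb1 nb1 (Or.inl hdb)
  obtain ⟨a₂, m2, h2, n2, n12⟩ := exists_nb_ne_ne (by omega : 3 ≤ (nb G W a).card) u a₁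
  by_cases hd1 : (nb G W a₁).card ≤ 2
  · exact near_low ih hG hu' hno hTb m1 h1 n1 (Or.inr hd1)
  by_cases hd2 : (nb G W a₂).card ≤ 2
  · exact near_low ih hG hu' hno hTb m2 h2 n2 (Or.inr hd2)
  refine Gen.zero ih hG (u := u) (a := a) (b := b) (a₁ := a₁) (a₂ := a₂) ⟨hu', m1, m2, h1, h2,
    n12.symm, n1, n2, hno, hTb, by omega, by omega, by omega, fun x hx h => ?_⟩ hTa
  exact eq_of_deg_le_three (hG.deg a ha) hu hua.symm m1 h1 m2 h2 n1.symm n2.symm n12.symm hx h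

theorem claims : ∀ (n : ℕ) (G : SimpleGraph V) (W : Finset V), W.card = n → Ok G W →
    Claims G W := by
  intro n
  induction n using Nat.strong_induction_on with
  | _ n ih =>
    intro G W hn hG
    have ih' : IH W := fun G' W' hlt hG' => ih _ (hn ▸ hlt) G' W' rfl hG'
    exact ⟨zero_claim ih' hG, fun v hv hd => leaf_claim ih' hG hv hd,
      fun v hv h1 h2 => weak_claim ih' hG hv h1 h2,
      fun v hv h1 h2 hT => cover_claim ih' hG hv h1 h2 hT,
      fun v hv h1 h2 => either_claim ih' hG hv h1 h2⟩

lemma Ok.claims (hG : Ok G W) : Claims G W := MatchingBound.claims _ G W rfl hG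

end MatchingBound

/-! ### From solutions to maximal matchings, and connected graphs -/

namespace MatchingBound

open Finset
open scoped Classical

variable {V : Type*}

lemma two_mul_ncard_edgeSet [Fintype V] {G : SimpleGraph V} {M : G.Subgraph} (hM : M.IsMatching) :
    2 * M.edgeSet.ncard = (univ.filter (· ∈ M.verts)).card := by
  have h1 : ed M.spanningCoe univ = M.edgeSet.ncard := by
    rw [ed, ← Set.ncard_coe_finset]
    congr 1
    ext e
    simp
  rw [← h1, two_ed, Finset.card_filter]
  refine Finset.sum_congr rfl fun v _ => ?_
  split_ifs with hv
  · obtain ⟨w, hw, hw'⟩ := hM hv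
    rw [Finset.card_eq_one]
    refine ⟨w, ?_⟩
    ext x
    simp only [mem_nb, Finset.mem_univ, true_and, SimpleGraph.Subgraph.spanningCoe_adj,
      Finset.mem_singleton]
    exact ⟨fun h => hw' x h, fun h => h ▸ hw⟩
  · rw [Finset.card_eq_zero]
    ext x
    simp only [mem_nb, Finset.mem_univ, true_and, SimpleGraph.Subgraph.spanningCoe_adj,
      Finset.notMem_empty, iff_false]
    exact fun h => hv h.fst_mem

/-- A solution for the whole vertex set yields a small maximal matching. -/
lemma Sol.edgeDominationNumber_le [Fintype V] {G : SimpleGraph V} {Z : Finset V} {k : ℤ}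
    (h : Sol G univ Z k) :
    6 * (G.edgeDominationNumber : ℤ) + k ≤ 4 * Fintype.card V - ed G univ := by
  obtain ⟨I, -, -, h3, ⟨f, h4⟩, h5⟩ := h
  simp only [Finset.mem_sdiff, Finset.mem_univ, true_and] at h4
  let M : G.Subgraph :=
    { verts := {v | v ∉ I}
      Adj := fun v w => v ∉ I ∧ f v = w
      adj_sub := by
        rintro v w ⟨hv, rfl⟩
        exact (h4 v hv).2.2
      edge_vert := fun h => h.1
      symm := ⟨by
        rintro v w ⟨hv, rfl⟩
        exact ⟨(h4 v hv).1, (h4 v hv).2.1⟩⟩ }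
  have hM : M.IsMatching := fun v hv => ⟨f v, ⟨hv, rfl⟩, fun w hw => hw.2.symm⟩
  have hmax : M.IsMaximalMatching := by
    refine ⟨hM, fun M' hM' hle => ?_⟩
    have hadj : ∀ v w, M'.Adj v w → M.Adj v w := by
      have key : ∀ v w, v ∉ I → M'.Adj v w → f v = w := fun v w hv hvw =>
        hM'.eq_of_adj_left (hle.2 (show M.Adj v (f v) from ⟨hv, rfl⟩)) hvw
      -- An edge of `M'` with both ends in `I` contradicts independence; with one end in `I` it
      -- would have to be the matching edge at its other end, whose partner lies outside `I`.
      intro v w hvw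
      by_cases hv : v ∈ I
      · by_cases hw : w ∈ I
        · exact (h3 v hv w hw (M'.adj_sub hvw)).elim
        · have := key w v hw hvw.symm
          exact ((h4 w hw).1 (this ▸ hv)).elim
      · exact ⟨hv, key v w hv hvw⟩
    refine ⟨fun v hv => ?_, fun v w => hadj v w⟩
    obtain ⟨w, hw, -⟩ := hM' hv
    exact (hadj v w hw).1
  have h6 := (G.edgeDominationNumber_isLeast).2 ⟨M, hmax, rfl⟩
  have h7 : 2 * M.edgeSet.ncard = (univ \ I).card := by
    rw [two_mul_ncard_edgeSet hM]
    congr 1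
    ext v
    simp [M]
  have h9 := Finset.card_sdiff_add_card_eq_card (Finset.subset_univ I)
  rw [Finset.card_univ] at h9 h5
  omega

lemma eq_univ_of_closed [Fintype V] {G : SimpleGraph V} (hG : G.Connected) {U : Finset V}
    (hU : U.Nonempty) (hcl : ∀ s ∈ U, ∀ x, G.Adj s x → x ∈ U) : U = univ := by
  obtain ⟨s, hs⟩ := hU
  rw [Finset.eq_univ_iff_forall]
  intro x
  obtain ⟨p⟩ := hG.preconnected s x
  induction p with
  | nil => exact hs
  | cons h _ ih => exact ih (hcl _ hs _ h)

/-- A set in which all inner degrees are three is saturated, hence closed under adjacency, and by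
connectivity it is everything. So every proper subset of a connected subcubic graph is 2-degenerate.
-/
lemma exists_low [Fintype V] {G : SimpleGraph V} (hG : G.Connected)
    (h3 : ∀ v, (nb G univ v).card ≤ 3) {U : Finset V} (hU : U.Nonempty) (hne : U ≠ univ) :
    ∃ v ∈ U, (nb G U v).card ≤ 2 := by
  by_contra! h
  refine hne (eq_univ_of_closed hG hU fun s hs x hsx => ?_)
  have := Finset.eq_of_subset_of_card_le (nb_mono G (Finset.subset_univ U) s)
    ((h3 s).trans (h s hs))
  have hx : x ∈ nb G univ s := by simp [hsx]
  rw [← this] at hx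
  exact (mem_nb.1 hx).1

lemma ok_of_ne_univ [Fintype V] {G : SimpleGraph V} (hG : G.Connected)
    (h3 : ∀ v, (nb G univ v).card ≤ 3) {W : Finset V} (hne : W ≠ univ) : Ok G W := by
  refine ⟨fun v _ => (card_nb_mono G (Finset.subset_univ W) v).trans (h3 v), fun U hU hUn =>
    exists_low hG h3 hUn ?_⟩
  rintro rfl
  exact hne (Finset.univ_subset_iff.1 hU)

lemma sdiff_ne_univ [Fintype V] {S : Finset V} {x : V} (hx : x ∈ S) : univ \ S ≠ univ := by
  intro h
  have := Finset.mem_univ x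
  rw [← h] at this
  simp [hx] at this

lemma sol_of_connected [Fintype V] {G : SimpleGraph V} (hG : G.Connected)
    (h3 : ∀ v, (nb G univ v).card ≤ 3) (hc : ∃ v, (nb G univ v).card ≤ 2) : Sol G univ ∅ 0 := by
  obtain ⟨v, hv⟩ := hc
  refine (Ok.claims ⟨fun v _ => h3 v, fun U _ hUn => ?_⟩).zero
  by_cases hU : U = univ
  · subst hU
    exact ⟨v, Finset.mem_univ v, hv⟩
  · exact exists_low hG h3 hUn hU

/-! ### Cubic graphs and `K₃,₃` -/

section cubic

variable [Fintype V] {G : SimpleGraph V}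

/-- Deleting the matched pair `a b` loses 3, but leaves `c` with degree at most one, which gains 1.
-/
lemma cubic_triangle (hG : G.Connected) (h3 : ∀ v, (nb G univ v).card ≤ 3) {a b c : V}
    (hab : G.Adj a b) (hac : G.Adj a c) (hbc : G.Adj b c) : Sol G univ ∅ (-2) := by
  have hok := ok_of_ne_univ hG h3 (sdiff_ne_univ (S := {a, b}) (x := a) (by simp))
  have hd := card_nb_sdiff_add_two_le (W := univ) (S := {a, b}) (Finset.mem_univ a) (by simp)
    hac.symm (Finset.mem_univ b) (by simp) hbc.symm hab.ne
  have h := hok.claims.leaf c (by simp [hac.ne.symm, hbc.ne.symm]) (by have := h3 c; omega)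
  exact loc' h (fun v _ => h3 v) ![a, b] [(0, 1)] ![3, 3] [] [(0, 1)] [] [] (-3)

/-- In a cubic graph without triangles, a nonadjacent pair `v x` of further neighbours of the
edge `a a₁` leads to a good solution. -/
lemma cubic_pair (hG : G.Connected) (h3 : ∀ v, (nb G univ v).card ≤ 3)
    (ht : ∀ a b c, G.Adj a b → G.Adj a c → ¬ G.Adj b c) {a a₁ v x y : V} (h01 : G.Adj a a₁)
    (hav : G.Adj a v) (hva₁ : v ≠ a₁) (h1x : G.Adj a₁ x) (h1y : G.Adj a₁ y) (hxa : x ≠ a)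
    (hya : y ≠ a) (hxy : x ≠ y) (hvx : ¬ G.Adj v x) : Sol G univ ∅ (-2) := by
  have hok : ∀ T ⊆ univ \ {a, a₁}, Ok G T := fun T hT =>
    ok_of_ne_univ hG h3 (by
      rintro rfl
      exact sdiff_ne_univ (S := {a, a₁}) (x := a) (by simp) (Finset.univ_subset_iff.1 hT))
  have main : ∀ t, G.Adj a₁ t → t ≠ a → ¬ G.Adj v t →
      Sol G univ ∅ (-2) ∨ ∃ U, Bad G univ a a₁ t v U := by
    intro t h1t hta hvt
    have htv : t ≠ v := by rintro rfl; exact ht a a₁ t h01 hav h1t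
    have hn : ¬ G.Adj t v := fun h => hvt h.symm
    refine (ok_sup_edge_or_bad (fun v _ => h3 v) (fun U hU => (hok U hU).degen U subset_rfl)
      (Finset.mem_univ a) (Finset.mem_univ a₁) (Finset.mem_univ t) (Finset.mem_univ v) hav h1t hta
      hva₁ htv hn).imp_left fun h => ?_
    -- Both inner vertices of the path have degree three, so the loss is `3 + 3 - 4 = 2`.
    have := h.claims.zero.suppress (Finset.mem_univ a) (Finset.mem_univ a₁) (Finset.mem_univ t)
      (Finset.mem_univ v) h01 hav h1t hta hva₁ htv hn
    refine this.mono (by simp) ?_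
    have := h3 a
    have := h3 a₁
    omega
  have hxv : x ≠ v := by rintro rfl; exact ht a a₁ x h01 hav h1x
  have hyv : y ≠ v := by rintro rfl; exact ht a a₁ y h01 hav h1y
  rcases main x h1x hxa hvx with h | ⟨U, hU⟩
  · exact h
  have hvy : ¬ G.Adj v y := by
    intro h
    have hyU : y ∈ U := hU.closed v hU.right y (Finset.mem_univ y) h hya h1y.ne.symm
    exact hU.not_adj (fun v _ => h3 v) hyU hxy.symm hyv (Finset.mem_univ a₁) hU.notMem₁ h1y.symm
  rcases main y h1y hya hvy with h | ⟨U', hU'⟩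
  · exact h
  rcases two_bad (fun v _ => h3 v) (fun T hT => (hok T hT).claims) hU hU' (Finset.mem_univ a₁)
    (Finset.mem_univ x) (Finset.mem_univ y) h1x h1y hxy hxv hyv with h | h
  · exact loc' h (fun v _ => h3 v) ![a, a₁] [(0, 1)] ![3, 3] [] [(0, 1)] [] [] (-3)
  · exact loc' h (fun v _ => h3 v) ![a₁, a, v, x, y] [(0, 1), (1, 2), (0, 3), (0, 4)]
      ![3, 3, 3, 3, 3] [0] [(1, 2)] [3, 4] [] (-1)

lemma cubic_sol (hG : G.Connected) (h3 : ∀ v, (nb G univ v).card = 3) :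
    Sol G univ ∅ (-3) := by
  obtain ⟨a⟩ := hG.nonempty
  obtain ⟨b, -, hab⟩ := exists_nb (by rw [h3 a]; norm_num : 1 ≤ (nb G univ a).card)
  have h3' := fun v => (h3 v).le
  have h := (ok_of_ne_univ hG h3' (sdiff_ne_univ (S := {a, b}) (x := a) (by simp))).claims.zero
  exact loc' h (fun v _ => h3' v) ![a, b] [(0, 1)] ![3, 3] [] [(0, 1)] [] [] (-3)

/-- If -2 is not reached, there are no triangles and the ends of every path of three edges are
adjacent. The neighbours of `a` and those of an adjacent `a₁` then form a `K₃,₃`; its vertices have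
no further neighbours, so by connectivity it is the whole graph. -/
lemma cubic_sol_or_iso (hG : G.Connected) (h3 : ∀ v, (nb G univ v).card = 3) :
    Sol G univ ∅ (-2) ∨ Nonempty (G ≃g completeBipartiteGraph (Fin 3) (Fin 3)) := by
  have h3' := fun v => (h3 v).le
  by_cases ht : ∀ a b c, G.Adj a b → G.Adj a c → ¬ G.Adj b c
  swap
  · push Not at ht
    obtain ⟨a, b, c, h1, h2, h3⟩ := ht
    exact Or.inl (cubic_triangle hG h3' h1 h2 h3)
  by_contra! hcon
  obtain ⟨hcon, hiso⟩ := hcon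
  have pair : ∀ {a a₁ v x y : V}, G.Adj a a₁ → G.Adj a v → v ≠ a₁ → G.Adj a₁ x → G.Adj a₁ y →
      x ≠ a → y ≠ a → x ≠ y → G.Adj v x := by
    intro a a₁ v x y h1 h2 h4 h5 h6 h7 h8 h9
    by_contra h
    exact hcon (cubic_pair hG h3' ht h1 h2 h4 h5 h6 h7 h8 h9 h)
  obtain ⟨a⟩ := hG.nonempty
  obtain ⟨a₁, -, h1⟩ := exists_nb (by rw [h3 a]; norm_num : 1 ≤ (nb G univ a).card)
  obtain ⟨u, -, hau, hu1⟩ := exists_nb_ne (by rw [h3 a]; norm_num : 2 ≤ (nb G univ a).card) a₁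
  obtain ⟨v, -, hav, hv1, hvu⟩ := exists_nb_ne_ne (h3 a).ge a₁ u
  obtain ⟨x, -, h1x, hxa⟩ := exists_nb_ne (by rw [h3 a₁]; norm_num : 2 ≤ (nb G univ a₁).card) a
  obtain ⟨y, -, h1y, hya, hyx⟩ := exists_nb_ne_ne (h3 a₁).ge a x
  have hux := pair h1 hau hu1 h1x h1y hxa hya hyx.symm
  have huy := pair h1 hau hu1 h1y h1x hya hxa hyx
  have hvx := pair h1 hav hv1 h1x h1y hxa hya hyx.symm
  have hvy := pair h1 hav hv1 h1y h1x hya hxa hyx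
  have full : ∀ {s p q r : V}, G.Adj s p → G.Adj s q → G.Adj s r → p ≠ q → p ≠ r → q ≠ r →
      ∀ z, G.Adj s z → z = p ∨ z = q ∨ z = r := fun h1 h2 h4 n1 n2 n3 z hz =>
    eq_of_deg_le_three (h3' _) (Finset.mem_univ _) h1 (Finset.mem_univ _) h2 (Finset.mem_univ _) h4
      n1 n2 n3 (Finset.mem_univ _) hz
  have hax : ¬ G.Adj a x := ht a₁ a x h1.symm h1x
  have hay : ¬ G.Adj a y := ht a₁ a y h1.symm h1y
  have hxy : ¬ G.Adj x y := ht a₁ x y h1x h1y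
  have h1u : ¬ G.Adj a₁ u := ht a a₁ u h1 hau
  have h1v : ¬ G.Adj a₁ v := ht a a₁ v h1 hav
  have huv : ¬ G.Adj u v := ht a u v hau hav
  have hall : ({a, x, y, a₁, u, v} : Finset V) = univ := by
    refine eq_univ_of_closed hG ⟨a, by simp⟩ fun s hs z hsz => ?_
    simp only [Finset.mem_insert, Finset.mem_singleton] at hs ⊢
    rcases hs with rfl | rfl | rfl | rfl | rfl | rfl
    · have := full h1 hau hav hu1.symm hv1.symm hvu.symm z hsz; tauto
    · have := full h1x.symm hux.symm hvx.symm hu1.symm hv1.symm hvu.symm z hsz; tauto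
    · have := full h1y.symm huy.symm hvy.symm hu1.symm hv1.symm hvu.symm z hsz; tauto
    · have := full h1.symm h1x h1y hxa.symm hya.symm hyx.symm z hsz; tauto
    · have := full hau.symm hux huy hxa.symm hya.symm hyx.symm z hsz; tauto
    · have := full hav.symm hvx hvy hxa.symm hya.symm hyx.symm z hsz; tauto
  let φ : Fin 3 ⊕ Fin 3 → V := Sum.elim ![a, x, y] ![a₁, u, v]
  have hadj : ∀ i j, G.Adj (φ i) (φ j) ↔ (completeBipartiteGraph (Fin 3) (Fin 3)).Adj i j := by
    have l : ∀ i j : Fin 3, ¬ G.Adj (![a, x, y] i) (![a, x, y] j) := by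
      simp [Fin.forall_fin_succ, hax, hay, hxy, G.adj_comm x a, G.adj_comm y a, G.adj_comm y x]
    have r : ∀ i j : Fin 3, ¬ G.Adj (![a₁, u, v] i) (![a₁, u, v] j) := by
      simp [Fin.forall_fin_succ, h1u, h1v, huv, G.adj_comm u a₁, G.adj_comm v a₁, G.adj_comm v u]
    have lr : ∀ i j : Fin 3, G.Adj (![a, x, y] i) (![a₁, u, v] j) := by
      simp [Fin.forall_fin_succ, h1, hau, hav, h1x.symm, h1y.symm, hux.symm, huy.symm, hvx.symm,
        hvy.symm]
    rintro (i | i) (j | j)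
    · simpa [φ] using l i j
    · simpa [φ] using lr i j
    · simpa [φ] using (lr j i).symm
    · simpa [φ] using r i j
  have hinj : Function.Injective φ := by
    have l : Function.Injective ![a, x, y] := by
      rw [← List.nodup_ofFn]; simp [List.ofFn_succ]; grind
    have r : Function.Injective ![a₁, u, v] := by
      rw [← List.nodup_ofFn]; simp [List.ofFn_succ]; grind
    rintro (i | i) (j | j) h
    · exact congrArg _ (l h)
    · have := (hadj (Sum.inl i) (Sum.inr j)).2 (by simp)
      exact (this.ne h).elim
    · have := (hadj (Sum.inr i) (Sum.inl j)).2 (by simp)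
      exact (this.ne h).elim
    · exact congrArg _ (r h)
  have hsurj : Function.Surjective φ := by
    intro z
    have hz := Finset.mem_univ z
    rw [← hall] at hz
    simp only [Finset.mem_insert, Finset.mem_singleton] at hz
    rcases hz with rfl | rfl | rfl | rfl | rfl | rfl
    · exact ⟨Sum.inl 0, rfl⟩
    · exact ⟨Sum.inl 1, rfl⟩
    · exact ⟨Sum.inl 2, rfl⟩
    · exact ⟨Sum.inr 0, rfl⟩
    · exact ⟨Sum.inr 1, rfl⟩
    · exact ⟨Sum.inr 2, rfl⟩
  let e : completeBipartiteGraph (Fin 3) (Fin 3) ≃g G :=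
    ⟨Equiv.ofBijective φ ⟨hinj, hsurj⟩, fun {i j} => hadj i j⟩
  exact hiso.elim e.symm

/-- If a maximal matching missed `v`, all three neighbours of `v` would be matched, with distinct
partners among the two other vertices on the side of `v`. So every maximal matching is perfect and
has three edges. -/
lemma three_le_of_iso (e : G ≃g completeBipartiteGraph (Fin 3) (Fin 3)) :
    3 ≤ G.edgeDominationNumber := by
  obtain ⟨M, hM, hcard⟩ := (G.edgeDominationNumber_isLeast).1
  have hall : ∀ v, v ∈ M.verts := by
    by_contra! h
    obtain ⟨v, hv⟩ := h
    have hnb : ∀ w, G.Adj v w → w ∈ M.verts := by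
      intro w hvw
      by_contra hw
      have hm : (M ⊔ G.subgraphOfAdj hvw).IsMatching := by
        refine hM.1.sup (SimpleGraph.Subgraph.IsMatching.subgraphOfAdj hvw) ?_
        rw [hM.1.support_eq_verts,
          (SimpleGraph.Subgraph.IsMatching.subgraphOfAdj hvw).support_eq_verts,
          Set.disjoint_right]
        intro z hz
        simp only [SimpleGraph.subgraphOfAdj_verts, Set.mem_insert_iff,
          Set.mem_singleton_iff] at hz
        rcases hz with rfl | rfl <;> assumption
      exact hv ((hM.2 hm le_sup_left).1 (Or.inr (by simp)))
    choose! g hg _ using fun w (hw : w ∈ M.verts) => hM.1 hw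
    have hdeg : ∀ i : Fin 3 ⊕ Fin 3,
        (univ.filter ((completeBipartiteGraph (Fin 3) (Fin 3)).Adj i)).card = 3 := by
      intro i
      have h : univ.filter ((completeBipartiteGraph (Fin 3) (Fin 3)).Adj i) =
          (if i.isLeft then univ.map Function.Embedding.inr
            else univ.map Function.Embedding.inl) := by
        ext j
        rcases i with i | i <;> rcases j with j | j <;> simp
      rw [h]
      split_ifs <;> simp
    have hcv : (nb G univ v).card = 3 := by
      rw [← hdeg (e v)]
      refine Finset.card_bij (fun w _ => e w) ?_ ?_ ?_
      · intro w hw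
        exact Finset.mem_filter.2 ⟨Finset.mem_univ _, e.map_adj_iff.2 (mem_nb.1 hw).2⟩
      · intro w _ w' _ h
        exact e.injective h
      · intro i hi
        refine ⟨e.symm i, mem_nb.2 ⟨Finset.mem_univ _, ?_⟩, by simp⟩
        rw [← e.map_adj_iff, e.apply_symm_apply]
        exact (Finset.mem_filter.1 hi).2
    have hV : Fintype.card V = 6 := by
      rw [Fintype.card_congr e.toEquiv]; simp
    -- The right-hand side has `6 - 3 - 1 = 2` elements, too few for three distinct partners.
    have hsub : (nb G univ v).image g ⊆ (univ \ nb G univ v).erase v := by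
      intro z hz
      obtain ⟨w, hw, rfl⟩ := Finset.mem_image.1 hz
      have hvw := (mem_nb.1 hw).2
      have hwg := hg w (hnb w hvw)
      simp only [Finset.mem_erase, Finset.mem_sdiff, Finset.mem_univ, mem_nb, true_and]
      refine ⟨?_, ?_⟩
      · intro h
        rw [h] at hwg
        exact hv hwg.snd_mem
      · intro h
        have a1 := e.map_adj_iff.2 hvw
        have a2 := e.map_adj_iff.2 (M.adj_sub hwg)
        have a3 := e.map_adj_iff.2 h
        rcases h1 : e v with i | i <;> rcases h2 : e w with j | j <;>
          rcases h3 : e (g w) with k | k <;> simp [h1, h2, h3] at a1 a2 a3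
    have hinj : Set.InjOn g (nb G univ v) := by
      intro w hw w' hw' h
      have a1 := hg w (hnb w (mem_nb.1 hw).2)
      have a2 := hg w' (hnb w' (mem_nb.1 hw').2)
      rw [h] at a1
      exact hM.1.eq_of_adj_right a1 a2
    have c1 := Finset.card_le_card hsub
    rw [Finset.card_image_of_injOn hinj, Finset.card_erase_of_mem (by simp)] at c1
    have c2 := Finset.card_sdiff_add_card_eq_card (Finset.subset_univ (nb G univ v))
    rw [Finset.card_univ, hV] at c2
    omega
  have h2 := two_mul_ncard_edgeSet hM.1
  have hV : Fintype.card V = 6 := by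
    rw [Fintype.card_congr e.toEquiv]; simp
  rw [Finset.filter_true_of_mem (fun v _ => hall v), Finset.card_univ, hV] at h2
  omega

end cubic

lemma card_nb_univ [Fintype V] (G : SimpleGraph V) [DecidableRel G.Adj] (v : V) :
    (nb G univ v).card = G.degree v := by
  rw [← SimpleGraph.card_neighborFinset_eq_degree]
  congr 1
  ext x
  simp

lemma ed_univ [Fintype V] (G : SimpleGraph V) [DecidableRel G.Adj] [Fintype G.edgeSet] :
    ed G univ = G.edgeFinset.card := by
  unfold ed
  congr 1
  ext x
  simp

end MatchingBound

/-! ### The main theorem -/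

open MatchingBound in
theorem mainTheorem2 {V : Type*} [Fintype V] [DecidableEq V]
    (G : SimpleGraph V) [DecidableRel G.Adj]
    (hconn : G.Connected) (hsub : G.IsSubcubic) :
    ((G.edgeDominationNumber : ℝ) ≤
        (4 * (Fintype.card V : ℝ) - (G.edgeFinset.card : ℝ)) / 6 + 1 / 2) ∧
    ((G.edgeDominationNumber : ℝ) =
        (4 * (Fintype.card V : ℝ) - (G.edgeFinset.card : ℝ)) / 6 + 1 / 2 ↔
      Nonempty (G ≃g completeBipartiteGraph (Fin 3) (Fin 3))) ∧
    (¬ G.IsCubic →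
      (G.edgeDominationNumber : ℝ) ≤
        (4 * (Fintype.card V : ℝ) - (G.edgeFinset.card : ℝ)) / 6) := by
  have h3 : ∀ v, (nb G Finset.univ v).card ≤ 3 := fun v => by
    rw [card_nb_univ]
    exact (G.degree_le_maxDegree v).trans hsub
  have conv : ∀ k : ℤ, Sol G Finset.univ ∅ k →
      6 * (G.edgeDominationNumber : ℝ) + k ≤
        4 * (Fintype.card V : ℝ) - (G.edgeFinset.card : ℝ) := by
    intro k h
    have := h.edgeDominationNumber_le
    rw [ed_univ] at this
    exact_mod_cast this
  have hnc : ¬ G.IsCubic → Sol G Finset.univ ∅ 0 := by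
    intro h
    refine sol_of_connected hconn h3 ?_
    by_contra! hcon
    refine h fun v => ?_
    rw [← card_nb_univ]
    exact le_antisymm (h3 v) (hcon v)
  have hcub : G.IsCubic → ∀ v, (nb G Finset.univ v).card = 3 := fun h v => by
    rw [card_nb_univ]
    exact h v
  have hle : (G.edgeDominationNumber : ℝ) ≤
      (4 * (Fintype.card V : ℝ) - (G.edgeFinset.card : ℝ)) / 6 + 1 / 2 := by
    by_cases hc : G.IsCubic
    · have := conv _ (cubic_sol hconn (hcub hc))
      push_cast at this
      linarith
    · have := conv _ (hnc hc)
      push_cast at this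
      linarith
  refine ⟨hle, ⟨fun heq => ?_, fun ⟨e⟩ => ?_⟩, fun hc => ?_⟩
  · by_cases hc : G.IsCubic
    · rcases cubic_sol_or_iso hconn (hcub hc) with h | h
      -- A solution of value -2 gives a bound strictly below the one assumed to be attained.
      · have := conv _ h
        push_cast at this
        linarith
      · exact h
    · have := conv _ (hnc hc)
      push_cast at this
      linarith
  · have h1 : Fintype.card V = 6 := by
      rw [Fintype.card_congr e.toEquiv]; simp
    have h2 : G.edgeFinset.card = 9 := by
      classical
      have h := SimpleGraph.encard_edgeSet_completeBipartiteGraph (W₁ := Fin 3) (W₂ := Fin 3)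
      rw [← SimpleGraph.coe_edgeFinset, Set.encard_coe_eq_coe_finsetCard] at h
      rw [e.card_edgeFinset_eq]
      have h' : ENat.card (Fin 3) * ENat.card (Fin 3) = ((9 : ℕ) : ℕ∞) := by simp; norm_num
      rw [h'] at h
      exact_mod_cast h
    have h4 : (3 : ℝ) ≤ G.edgeDominationNumber := by exact_mod_cast three_le_of_iso e
    refine le_antisymm hle ?_
    rw [h1, h2]
    linarith
  · have := conv _ (hnc hc)
    push_cast at this
    linarith
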